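/- **Setting.** An instance of the joint (robust) beamforming and antenna selection problem has $N\ge1$ antennas, $M\ge1$ users, a limit $L\le N$, channels $h_m\in\mathbb C^N$, radii $\varepsilon_m\ge0$, noise levels $\sigma_m>0$ and targets $\gamma_m>0$. The problem is to minimize $\|W\|_F^2$ over $W=[w_1,\dots,w_M]\in\mathbb C^{N\times M}$ with at most $L$ nonzero rows such that $|w_m^H\bar h|^2/(\sum_{l\ne m}|w_l^H\bar h|^2+\sigma_m^2)\ge\gamma_m$ for all $m$ and all $\|\bar h-h_m\|_2\le\varepsilon_m$ ($\varepsilon_m=0$: perfect channel knowledge). *MINIMAL* is branch and bound on nodes $(\mathcal A,\mathcal B)$ of included and excluded antennas. $\Phi(\mathcal B)\in[0,\infty]$ denotes the optimal value with the rows in $\mathcal B$ set to zero and the bound on the number of nonzero rows dropped. The lower bound at a node is $\Phi(\mathcal B)$. The upper bound is $\Phi(\widetilde{\mathcal B})$, where $\widetilde{\mathcal B}\supseteq\mathcal B$ has $N-L$ elements and adds undecided antennas of least power in the relaxed solution. A non-leaf node of lowest lower bound is selected and classified. If it is classified as relevant, it is branched on the undecided antenna of largest power in the relaxed solution (a child with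 $L$ included or $N-L$ excluded antennas is completed to a leaf); otherwise it is discarded. The incumbent is the solution of best upper bound found; nodes whose lower bound exceeds the global upper bound $u_G$ are removed; $l_G$ is the least lower bound over the remaining nodes, updated at each branching. The procedure stops when there is no node to select or $|u_G-l_G|/l_G\le\epsilon$, where $\epsilon\ge0$, and returns the incumbent. A node is *relevant* (label $y=1$) if $\mathcal A\subseteq\mathcal A^\star$ and $\mathcal B\cap\mathcal A^\star=\emptyset$ for a fixed optimal antenna subset $\mathcal A^\star$, $|\mathcal A^\star|=L$; otherwise $y=0$. The *classifier* $\pi_\theta$ maps features $\phi$ of a node (vectors $x_u\in\mathbb R^E$ at the $U=N+M$ vertices of the complete bipartite antenna-user graph and $e_{uv}\in\mathbb R^E$ at its edges) to $\pi_\theta(\phi)=\frac1U\sum_u\zeta(\beta^\top q_u^{(D)})$, where $q^{(0)}_u=x_u$, $q_u^{(d)}=\xi\big(Z_1q_u^{(d-1)}+\sum_{v\sim u}\xi(Z_2q_v^{(d-1)}+Z_3e_{uv})\big)$, $\zeta$ is the logistic sigmoid and $\theta=(Z_1,Z_2,Z_3,\beta)\in\mathbb R^{3E^2+E}$. A node is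 classified as relevant iff $\pi_\theta(\phi)\ge r$, where the threshold $r$ has a given law $\tau$ on $\mathbb R$ and is redrawn for each node ($r=\frac12$: hard decision; $r$ uniform on $[0,1]$: $\pi_\theta(\phi)$ is the probability of being classified as relevant). *Assumptions.* Features satisfy $\|x_u\|_2,\|e_{uv}\|_2\le B_x$; $\xi,\zeta$ are $C_\xi$- and $C_\zeta$-Lipschitz and $\xi(0)=0$; $\Theta=\{\theta:\|Z_i\|_2\le B_Z,\ \|\beta\|_2\le B_\beta\}$ with $B_Z>0$; for outputs of the network with $\theta\in\Theta$, $|\mathcal L|\le B_{\mathcal L}$ and $\mathcal L(\cdot,y)$ is $C_{\mathcal L}$-Lipschitz. $\Theta$ has $\ell_\infty$-diameter at most $H$, and for $1\le i\le I$ and any batches $D_1,\dots,D_i$ of $J$ samples with bounded features, $g_i(\theta)=\frac1i\sum_{t\le i}\frac1J\sum_{(\phi,y)\in D_t}\mathcal L(\pi_\theta(\phi),y)$ is $G$-Lipschitz on $\Theta$ in the $\ell_1$ norm. *Training.* Start from $\theta^{(1)}\in\Theta$. In round $i$, the batch $D_i$ consists of $J$ samples that are i.i.d. given $\theta^{(i)}$,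 each obtained from an independent random problem instance using $\theta^{(i)}$; let $p_i$ be their law given $\theta^{(i)}$. Then $\psi_i$ is drawn with independent $\mathrm{Exp}(\eta)$ coordinates, independently of everything before, and $\theta^{(i+1)}\in\arg\min_{\theta\in\Theta}g_i(\theta)-\psi_i^\top\theta$. For $1\le i\le I$ let $\ell_i=\mathbb E_{(\phi,y)\sim p_i}\mathbb E_\psi[\mathcal L(\pi_{\theta^{(i)}}(\phi),y)]$, where $\mathbb E_\psi$ is over a fresh perturbation in the definition of $\theta^{(i)}$ with the data $D_1,\dots,D_{i-1}$ fixed (for $i=1$, $\theta^{(1)}$ is fixed). The returned $\widehat\theta=\theta^{(\hat\imath)}$ minimizes $\ell_i$ over $i\le I$; write $p_{\widehat\theta}=p_{\hat\imath}$. For the classifications by $\widehat\theta$, either the realized parameter is used, or it is redrawn for each node by a fresh $\psi$ as above. In either case let $\rho$ be the probability that a node $(\phi,y)\sim p_{\widehat\theta}$ is classified correctly, and let $\mathbb E_{p_{\widehat\theta},\psi}$ be the corresponding expectation. **Theorem.** There are a constant $C$ and rates $\eta_I>0$ depending only on $E,G,H$ (and $I$ for the latter) such that the following holds. 1. Suppose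 that MINIMAL is run on an instance that has an optimal solution and that every node it selects is classified correctly with conditional probability at least $\rho$ given the past. If $\rho>\frac12$, then the expected number of visited nodes (nodes of the search tree) satisfies $$Q_{\widehat\theta}\le\frac{2N(2\rho-\rho^N)}{2\rho-1}+1 .$$ 2. Let $\eta=\eta_I$, $0<\delta<1$, and suppose that almost surely $\min_{\theta\in\Theta}\frac1{IJ}\sum_{i\le I}\sum_{(\phi,y)\in D_i}\mathcal L(\pi_\theta(\phi),y)\le\nu$. Then with probability at least $1-\delta$ $$\ell_{\hat\imath}\le\nu+\frac{C}{I^{1/3}}+\mathsf{Gap}\big(\tfrac\delta2,J\big)\sqrt{\frac{2\log(2/\delta)}{I}},$$ where, with $\alpha=(1+UC_\xi)C_\xi B_Z\neq1$, $$\mathsf{Gap}(\delta,K)=\frac{8C_{\mathcal L}}K+\frac{24C_{\mathcal L}B_{\mathcal L}}{\sqrt K}\sqrt{(3E^2+E)\log\Lambda}+3B_{\mathcal L}\sqrt{\frac{\log(2/\delta)}{2K}},$$ $\Lambda=1+12\sqrt{EK}\,B_Z\max\{\Sigma_1,\Sigma_2,\Sigma_3,\frac{B_\beta}{B_Z}\Sigma_\beta\}$,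 $\Sigma_1=C_\zeta B_\beta UC_\xi^3B_ZB_x\frac{\alpha^{D+1}-2\alpha+1}{(\alpha-1)^2}$, $\Sigma_2=UC_\xi\Sigma_1$, $\Sigma_3=C_\zeta B_\beta UC_\xi^2B_ZB_x\frac{\alpha^D-1}{\alpha-1}$, $\Sigma_\beta=C_\zeta B_x\alpha^D+C_\zeta UC_\xi^2B_ZB_x\frac{\alpha^D-1}{\alpha-1}$. 3. If $\mathcal L$ is the logistic loss $-y\log x-(1-y)\log(1-x)$ and nodes are classified as relevant with probability $\pi_{\widehat\theta}(\phi)$ ($r$ uniform on $[0,1]$), then $\rho\ge\exp\big(-\mathbb E_{p_{\widehat\theta},\psi}[\mathcal L(\pi_{\widehat\theta}(\phi),y)]\big)$. 4. Under the first sentence of 1, with probability at least $\rho^N$ MINIMAL stops and returns a feasible $W$ whose power $\|W\|_F^2$ is at most $1+\epsilon$ times the optimal one; for $\epsilon=0$, an optimal solution. Parts 1, 3 and 4 hold for every $\eta>0$. -/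

import Mathlib

open MeasureTheory ProbabilityTheory Finset
open scoped ENNReal NNReal

noncomputable section

/-! ## The joint (robust) beamforming and antenna selection problem

`N` antennas, `M` users, at most `L` active antennas. -/

/-- Data of a problem instance. The robust problem has uncertainty radii `err m`; the radius `0`
gives the problem with perfect channel knowledge. -/
structure BFInstance (N M : ℕ) where
  /-- number of antennas that may be active -/
  L : ℕ
  /-- channel vectors -/
  h : Fin M → EuclideanSpace ℂ (Fin N)
  /-- bounds on the channel errors -/
  err : Fin M → ℝ
  /-- noise levels -/
  sigma : Fin M → ℝ
  /-- required signal to interference and noise ratios -/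
  gamma : Fin M → ℝ
  L_le : L ≤ N
  err_nonneg : ∀ m, 0 ≤ err m
  sigma_pos : ∀ m, 0 < sigma m
  gamma_pos : ∀ m, 0 < gamma m

/-- `|wᵐᴴ g|²`, where `wᵐ` is column `m` of `W`. -/
def gain {N M : ℕ} (W : Matrix (Fin N) (Fin M) ℂ) (m : Fin M) (g : EuclideanSpace ℂ (Fin N)) : ℝ :=
  ‖∑ n, star (W n m) * g n‖ ^ 2

/-- Squared Frobenius norm. -/
def sqFrob {N M : ℕ} (W : Matrix (Fin N) (Fin M) ℂ) : ℝ := ∑ n, ∑ m, ‖W n m‖ ^ 2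

/-- Power of antenna `n`: squared norm of row `n`. -/
def rowPower {N M : ℕ} (W : Matrix (Fin N) (Fin M) ℂ) (n : Fin N) : ℝ := ∑ m, ‖W n m‖ ^ 2

namespace BFInstance

variable {N M : ℕ} (Q : BFInstance N M)

/-- The worst-case signal to interference and noise ratio of every user is large enough. -/
def MeetsSINR (W : Matrix (Fin N) (Fin M) ℂ) : Prop :=
  ∀ m, ∀ g : EuclideanSpace ℂ (Fin N), ‖g - Q.h m‖ ≤ Q.err m →
    Q.gamma m ≤ gain W m g / ((∑ l ∈ univ.erase m, gain W l g) + Q.sigma m ^ 2)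

/-- Feasibility for the joint problem: the ratios are met and at most `L` rows are nonzero. -/
def Feasible (W : Matrix (Fin N) (Fin M) ℂ) : Prop :=
  Q.MeetsSINR W ∧ {n : Fin N | ∃ m, W n m ≠ 0}.ncard ≤ Q.L

/-- `W` is feasible and its power is within the factor `1 + ε` of the power of every feasible
matrix. For `ε = 0`: `W` is an optimal solution of the joint problem. -/
def OptimalWithin (ε : ℝ≥0) (W : Matrix (Fin N) (Fin M) ℂ) : Prop :=
  Q.Feasible W ∧ ∀ W', Q.Feasible W' → sqFrob W ≤ (1 + ε) * sqFrob W'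

/-- `A` is the antenna subset of an optimal solution: `L` antennas outside which some optimal
solution vanishes. -/
def IsOptimalSubset (A : Finset (Fin N)) : Prop :=
  A.card = Q.L ∧ ∃ W, Q.OptimalWithin 0 W ∧ ∀ n, n ∉ A → ∀ m, W n m = 0

/-- Feasible set of the beamforming problem in which the antennas in `B` are shut down and the
bound on the number of active antennas is dropped. -/
def relaxed (B : Finset (Fin N)) : Set (Matrix (Fin N) (Fin M) ℂ) :=
  {W | Q.MeetsSINR W ∧ ∀ n ∈ B, ∀ m, W n m = 0}

/-- Optimal value of that problem, `∞` if it is infeasible. -/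
def value (B : Finset (Fin N)) : ℝ≥0∞ := ⨅ W ∈ Q.relaxed B, ENNReal.ofReal (sqFrob W)

end BFInstance

/-! ## The branch and bound procedure with node classification -/

/-- A node of the search tree: the antennas included (`A`) and excluded (`B`), and the level. -/
structure BBNode (N : ℕ) where
  A : Finset (Fin N)
  B : Finset (Fin N)
  level : ℕ

instance (N : ℕ) : DecidableEq (BBNode N) := Classical.decEq _

namespace BBNode

variable {N : ℕ}

def undecided (n : BBNode N) : Finset (Fin N) := univ \ (n.A ∪ n.B)

/-- Leaf nodes: all antennas are decided, `L` of them included. -/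
def IsLeaf (L : ℕ) (n : BBNode N) : Prop := n.A.card = L ∧ n.B.card = N - L

/-- Nodes that can still be completed to a leaf. -/
def Valid (L : ℕ) (n : BBNode N) : Prop :=
  Disjoint n.A n.B ∧ n.A.card ≤ L ∧ n.B.card ≤ N - L

/-- Once `L` antennas are included, exclude all others; once `N - L` are excluded, include all
others. -/
def close (L : ℕ) (n : BBNode N) : BBNode N :=
  if n.A.card = L then ⟨n.A, univ \ n.A, n.level⟩
  else if n.B.card = N - L then ⟨univ \ n.B, n.B, n.level⟩
  else n

def root (N L : ℕ) : BBNode N := close L ⟨∅, ∅, 0⟩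

/-- The child that excludes the antenna `v`. -/
def left (L : ℕ) (n : BBNode N) (v : Fin N) : BBNode N :=
  close L ⟨n.A, insert v n.B, n.level + 1⟩

/-- The child that includes the antenna `v`. -/
def right (L : ℕ) (n : BBNode N) (v : Fin N) : BBNode N :=
  close L ⟨insert v n.A, n.B, n.level + 1⟩

/-- The label of a node: `true` (relevant) if the decisions made at the node agree with the
optimal antenna subset `Aopt`. -/
def label (Aopt : Finset (Fin N)) (n : BBNode N) : Bool := decide (n.A ⊆ Aopt ∧ n.B ⊆ univ \ Aopt)

end BBNode

/-- The choices that branch and bound leaves open: which minimizers and maximizers are taken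
when there are several. -/
structure BBRules {N M : ℕ} (Q : BFInstance N M) where
  /-- an optimal solution of the relaxed problem with the antennas `B` shut down -/
  solve : Finset (Fin N) → Matrix (Fin N) (Fin M) ℂ
  solve_spec : ∀ B, (Q.relaxed B).Nonempty →
    solve B ∈ Q.relaxed B ∧ ∀ W ∈ Q.relaxed B, sqFrob (solve B) ≤ sqFrob W
  /-- the `N - L` antennas shut down for the upper bound at a node: the excluded ones and
  undecided ones of least power in the relaxed solution -/
  shut : BBNode N → Finset (Fin N)
  shut_spec : ∀ n, n.Valid Q.L → n.B ⊆ shut n ∧ Disjoint n.A (shut n) ∧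
    (shut n).card = N - Q.L ∧
    ∀ i ∈ n.undecided ∩ shut n, ∀ j ∈ n.undecided \ shut n,
      rowPower (solve n.B) i ≤ rowPower (solve n.B) j
  /-- the antenna to branch on: undecided, of largest power in the relaxed solution -/
  branch : BBNode N → Fin N
  branch_spec : ∀ n, n.undecided.Nonempty → branch n ∈ n.undecided ∧
    ∀ i ∈ n.undecided, rowPower (solve n.B) i ≤ rowPower (solve n.B) (branch n)
  /-- node selection: lowest lower bound first -/
  pick : Finset (BBNode N) → BBNode N
  pick_spec : ∀ s, s.Nonempty → pick s ∈ s ∧ ∀ n ∈ s, Q.value (pick s).B ≤ Q.value n.B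

/-- State of the procedure. -/
structure BBState (N M : ℕ) where
  /-- the nodes still under consideration -/
  frontier : Finset (BBNode N)
  /-- global upper bound -/
  upper : ℝ≥0∞
  /-- global lower bound -/
  lower : ℝ≥0∞
  incumbent : Matrix (Fin N) (Fin M) ℂ
  /-- number of nodes of the tree generated so far -/
  visited : ℕ

namespace BBRules

variable {N M : ℕ} {Q : BFInstance N M} (R : BBRules Q)

/-- Lower bound at a node. -/
def lb (_ : BBRules Q) (n : BBNode N) : ℝ≥0∞ := Q.value n.B

/-- Upper bound at a node. -/
def ub (n : BBNode N) : ℝ≥0∞ := Q.value (R.shut n)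

def init : BBState N M where
  frontier := {BBNode.root N Q.L}
  upper := R.ub (BBNode.root N Q.L)
  lower := R.lb (BBNode.root N Q.L)
  incumbent := R.solve (R.shut (BBNode.root N Q.L))
  visited := 1

open Classical in
/-- The nodes that can be selected. -/
def open_ (_ : BBRules Q) (S : BBState N M) : Finset (BBNode N) :=
  S.frontier.filter fun n => ¬ n.IsLeaf Q.L

/-- The selected node. -/
def current (S : BBState N M) : BBNode N := R.pick (R.open_ S)

/-- The procedure goes on while there is a node to select and the relative gap between the global
bounds exceeds `ε`. (A node stays in the frontier only if its lower bound is at most `upper`, so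
the truncated difference loses nothing.) -/
def Continues (ε : ℝ≥0) (S : BBState N M) : Prop :=
  (R.open_ S).Nonempty ∧ (ε : ℝ≥0∞) < (S.upper - S.lower) / S.lower

open Classical in
/-- One iteration; `d` is the decision of the classifier on the selected node: branch it (`true`)
or discard it (`false`). -/
def step (ε : ℝ≥0) (S : BBState N M) (d : Bool) : BBState N M :=
  if R.Continues ε S then
    let n := R.current S
    let rest := S.frontier.erase n
    if d then
      let c₁ := n.left Q.L (R.branch n)
      let c₂ := n.right Q.L (R.branch n)
      let all := insert c₁ (insert c₂ rest)
      let k := if R.ub c₁ ≤ R.ub c₂ then c₁ else c₂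
      let u := if R.ub k ≤ S.upper then R.ub k else S.upper
      { frontier := all.filter fun c => R.lb c ≤ u
        upper := u
        lower := all.inf R.lb
        incumbent := if R.ub k ≤ S.upper then R.solve (R.shut k) else S.incumbent
        visited := S.visited + 2 }
    else { S with frontier := rest.filter fun c => R.lb c ≤ S.upper }
  else S

end BBRules

/-! ## The graph neural network -/

/-- Features of a node: vectors at the antennas and the users, and at the antenna-user edges. -/
abbrev Features (N M E : ℕ) : Type :=
  (Fin N ⊕ Fin M → EuclideanSpace ℝ (Fin E)) × (Fin N → Fin M → EuclideanSpace ℝ (Fin E))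

/-- A training pair: features and label. -/
abbrev Sample (N M E : ℕ) : Type := Features N M E × Bool

/-- Positions in the parameter vector `θ = (vec Z₁, vec Z₂, vec Z₃, β)`. -/
abbrev Coord (E : ℕ) : Type := (Fin 3 × Fin E × Fin E) ⊕ Fin E

abbrev Params (E : ℕ) : Type := Coord E → ℝ

/-- The aggregation matrix `Z₁`, `Z₂` or `Z₃` (`i = 0, 1, 2`). -/
def Params.Z {E : ℕ} (θ : Params E) (i : Fin 3) : Matrix (Fin E) (Fin E) ℝ :=
  Matrix.of fun a b => θ (Sum.inl (i, a, b))

def Params.β {E : ℕ} (θ : Params E) : EuclideanSpace ℝ (Fin E) :=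
  WithLp.toLp 2 fun a => θ (Sum.inr a)

/-- A matrix acting on Euclidean space; its operator norm is the spectral norm. -/
def Params.act {E : ℕ} (θ : Params E) (i : Fin 3) :
    EuclideanSpace ℝ (Fin E) →L[ℝ] EuclideanSpace ℝ (Fin E) :=
  Matrix.toEuclideanCLM (n := Fin E) (𝕜 := ℝ) (θ.Z i)

section GNN

variable {N M E : ℕ} (ξ : EuclideanSpace ℝ (Fin E) → EuclideanSpace ℝ (Fin E))

/-- The sum of the messages that a vertex receives from its neighbours in the complete bipartite
graph between antennas and users. -/
def messages (θ : Params E) (φ : Features N M E)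
    (q : Fin N ⊕ Fin M → EuclideanSpace ℝ (Fin E)) : Fin N ⊕ Fin M → EuclideanSpace ℝ (Fin E)
  | Sum.inl n => ∑ m, ξ (θ.act 1 (q (Sum.inr m)) + θ.act 2 (φ.2 n m))
  | Sum.inr m => ∑ n, ξ (θ.act 1 (q (Sum.inl n)) + θ.act 2 (φ.2 n m))

/-- The embeddings of the vertices after `d` layers. -/
def embed (θ : Params E) (φ : Features N M E) : ℕ → Fin N ⊕ Fin M → EuclideanSpace ℝ (Fin E)
  | 0 => φ.1
  | d + 1 => fun u => ξ (θ.act 0 (embed θ φ d u) + messages ξ θ φ (embed θ φ d) u)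

/-- Output of the network with `depth` layers: mean over the `N + M` vertices of the sigmoid of
`βᵀ q`. -/
def gnn (depth : ℕ) (θ : Params E) (φ : Features N M E) : ℝ :=
  (1 / (N + M : ℝ)) * ∑ u, Real.sigmoid (inner ℝ θ.β (embed ξ θ φ depth u))

end GNN

/-- Logistic (binary cross-entropy) loss. -/
def logisticLoss (x : ℝ) (y : Bool) : ℝ := if y then -Real.log x else -Real.log (1 - x)

/-- The constants in the assumptions on the data and on the network. -/
structure Bounds where
  Bx : ℝ
  Cξ : ℝ
  Cζ : ℝ
  CL : ℝ
  BL : ℝ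
  BZ : ℝ
  Bβ : ℝ

namespace Bounds

variable (c : Bounds)

/-- The parameter set `Θ`. -/
def paramSet (E : ℕ) : Set (Params E) := {θ | (∀ i, ‖θ.act i‖ ≤ c.BZ) ∧ ‖θ.β‖ ≤ c.Bβ}

/-- Bounded features. -/
def Admissible {N M E : ℕ} (φ : Features N M E) : Prop :=
  (∀ u, ‖φ.1 u‖ ≤ c.Bx) ∧ ∀ n m, ‖φ.2 n m‖ ≤ c.Bx

/-- `α`, where `U` is the number of vertices. -/
def α (U : ℕ) : ℝ := (1 + U * c.Cξ) * c.Cξ * c.BZ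

def S₁ (U D : ℕ) : ℝ :=
  c.Cζ * c.Bβ * U * c.Cξ ^ 3 * c.BZ * c.Bx *
    ((c.α U ^ (D + 1) - 2 * c.α U + 1) / (c.α U - 1) ^ 2)

def S₂ (U D : ℕ) : ℝ := U * c.Cξ * c.S₁ U D

def S₃ (U D : ℕ) : ℝ :=
  c.Cζ * c.Bβ * U * c.Cξ ^ 2 * c.BZ * c.Bx * ((c.α U ^ D - 1) / (c.α U - 1))

def Sβ (U D : ℕ) : ℝ :=
  c.Cζ * c.Bx * c.α U ^ D +
    c.Cζ * U * c.Cξ ^ 2 * c.BZ * c.Bx * ((c.α U ^ D - 1) / (c.α U - 1))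

def Lam (E U D K : ℕ) : ℝ :=
  1 + 12 * √(E * K) * c.BZ *
    max (max (c.S₁ U D) (c.S₂ U D)) (max (c.S₃ U D) (c.Bβ / c.BZ * c.Sβ U D))

/-- The generalization gap `Gap(δ, K)` of the network with `D` layers, embedding dimension `E` and
`U` vertices. -/
def gap (E U D : ℕ) (δ : ℝ) (K : ℕ) : ℝ :=
  8 * c.CL / K
    + 24 * c.CL * c.BL / √K * √((3 * (E : ℝ) ^ 2 + E) * Real.log (c.Lam E U D K))
    + 3 * c.BL * √(Real.log (2 / δ) / (2 * K))

end Bounds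

/-! ## Online learning with random perturbation -/

/-- Training batches `D₁, …, Dᵢ` of `J` samples each. -/
abbrev Batches (N M E J i : ℕ) : Type := Fin i → Fin J → Sample N M E

/-- The law of the perturbation: independent exponential coordinates of rate `η`. -/
def perturbLaw (E : ℕ) (η : ℝ) : Measure (Params E) :=
  Measure.pi fun _ : Coord E => expMeasure η

/-- The law of the noise of one round. -/
def roundLaw {Z : Type*} [MeasurableSpace Z] (E J : ℕ) (μ : Measure Z) (η : ℝ) :
    Measure ((Fin J → Z) × Params E) :=
  (Measure.pi fun _ : Fin J => μ).prod (perturbLaw E η)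

/-- The ingredients of the training procedure. -/
structure Training (N M E J : ℕ) (Z : Type*) where
  /-- number of layers -/
  depth : ℕ
  /-- activation function -/
  ξ : EuclideanSpace ℝ (Fin E) → EuclideanSpace ℝ (Fin E)
  loss : ℝ → Bool → ℝ
  /-- Data collection: `gen i θ z` is the training pair obtained in round `i` (counted from `0`)
  from the random problem instance (and further random choices) `z` when nodes are generated with
  the current parameter `θ`. -/
  gen : ℕ → Params E → Z → Sample N M E
  /-- the initial parameter -/
  θinit : Params E
  /-- the optimizer: from the batches collected so far and the perturbation, the next parameter -/
  argmin : (i : ℕ) → Batches N M E J i → Params E → Params E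

namespace Training

variable {N M E J : ℕ} {Z : Type*} (T : Training N M E J Z)

/-- Loss of the parameter `θ` on a sample. -/
def sampleLoss (θ : Params E) (s : Sample N M E) : ℝ := T.loss (gnn T.ξ T.depth θ s.1) s.2

/-- The aggregated empirical loss `gᵢ(θ)`. -/
def g {i : ℕ} (D : Batches N M E J i) (θ : Params E) : ℝ :=
  (1 / (i : ℝ)) * ∑ t, (1 / (J : ℝ)) * ∑ j, T.sampleLoss θ (D t j)

/-- The batches collected in the first `i` rounds and the parameter used in the next one. The
noise of round `i` is `x i = (z, ψ)`: the `J` random instances and the perturbation `ψ`. -/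
def run (x : ℕ → (Fin J → Z) × Params E) : (i : ℕ) → Batches N M E J i × Params E
  | 0 => (Fin.elim0, T.θinit)
  | i + 1 =>
    let D : Batches N M E J (i + 1) :=
      Fin.snoc (α := fun _ => Fin J → Sample N M E) (run x i).1
        (fun j => T.gen i (run x i).2 ((x i).1 j))
    (D, T.argmin (i + 1) D (x i).2)

/-- The batches `D₁, …, Dᵢ`. -/
def data (x : ℕ → (Fin J → Z) × Params E) (i : ℕ) : Batches N M E J i := (T.run x i).1

/-- The parameter used in round `i` (counted from `0`). -/
def param (x : ℕ → (Fin J → Z) × Params E) (i : ℕ) : Params E := (T.run x i).2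

/-- The distribution of the training pairs of round `i`, given the parameter used to collect
them. -/
def sampleLaw [MeasurableSpace Z] (μ : Measure Z) (x : ℕ → (Fin J → Z) × Params E) (i : ℕ) :
    Measure (Sample N M E) :=
  μ.map (T.gen i (T.param x i))

/-- The law, over a fresh perturbation, of the parameter of round `i`, given the data collected
before that round. -/
def paramLaw (η : ℝ) (x : ℕ → (Fin J → Z) × Params E) : ℕ → Measure (Params E)
  | 0 => Measure.dirac T.θinit
  | i + 1 => (perturbLaw E η).map (T.argmin (i + 1) (T.data x (i + 1)))

/-- Expected loss for a sample of law `p` and a parameter of law `κ`, independent. -/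
def expectedLoss (p : Measure (Sample N M E)) (κ : Measure (Params E)) : ℝ :=
  ∫ s, ∫ θ, T.sampleLoss θ s ∂κ ∂p

/-- Expected loss of the parameter of round `i`, over the samples of that round and the
perturbation. -/
def roundLoss [MeasurableSpace Z] (μ : Measure Z) (η : ℝ) (x : ℕ → (Fin J → Z) × Params E)
    (i : ℕ) : ℝ :=
  T.expectedLoss (T.sampleLaw μ x i) (T.paramLaw η x i)

/-- The standing assumptions: on the data, the network and the loss; on the diameter of the
parameter set and the Lipschitz continuity of the aggregated losses in the `ℓ₁` norm (for all
batches of bounded features); and `argmin` is a (measurable) exact optimizer. -/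
structure Assumptions [MeasurableSpace Z] (c : Bounds) (I : ℕ) (G H : ℝ) : Prop where
  Bx_nonneg : 0 ≤ c.Bx
  Cξ_nonneg : 0 ≤ c.Cξ
  CL_nonneg : 0 ≤ c.CL
  BZ_pos : 0 < c.BZ
  Bβ_nonneg : 0 ≤ c.Bβ
  ξ_zero : T.ξ 0 = 0
  ξ_lip : ∀ a b, ‖T.ξ a - T.ξ b‖ ≤ c.Cξ * ‖a - b‖
  ζ_lip : ∀ a b : ℝ, |Real.sigmoid a - Real.sigmoid b| ≤ c.Cζ * |a - b|
  loss_meas : ∀ y, Measurable fun x => T.loss x y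
  loss_bound : ∀ θ ∈ c.paramSet E, ∀ s : Sample N M E, c.Admissible s.1 →
    |T.sampleLoss θ s| ≤ c.BL
  loss_lip : ∀ θ ∈ c.paramSet E, ∀ θ' ∈ c.paramSet E, ∀ φ φ' : Features N M E,
    c.Admissible φ → c.Admissible φ' → ∀ y,
      |T.loss (gnn T.ξ T.depth θ φ) y - T.loss (gnn T.ξ T.depth θ' φ') y|
        ≤ c.CL * |gnn T.ξ T.depth θ φ - gnn T.ξ T.depth θ' φ'|
  gen_meas : ∀ i, Measurable fun q : Params E × Z => T.gen i q.1 q.2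
  gen_adm : ∀ i, ∀ θ ∈ c.paramSet E, ∀ z, c.Admissible (T.gen i θ z).1
  diam : ∀ θ ∈ c.paramSet E, ∀ θ' ∈ c.paramSet E, ∀ a, |θ a - θ' a| ≤ H
  g_lip : ∀ i, 1 ≤ i → i ≤ I → ∀ D : Batches N M E J i, (∀ t j, c.Admissible (D t j).1) →
    ∀ θ ∈ c.paramSet E, ∀ θ' ∈ c.paramSet E, |T.g D θ - T.g D θ'| ≤ G * ∑ a, |θ a - θ' a|
  init_mem : T.θinit ∈ c.paramSet E
  argmin_meas : ∀ i, Measurable fun q : Batches N M E J i × Params E => T.argmin i q.1 q.2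
  argmin_mem : ∀ i D ψ, (∀ t j, c.Admissible (D t j).1) → T.argmin i D ψ ∈ c.paramSet E
  argmin_min : ∀ i D ψ, (∀ t j, c.Admissible (D t j).1) → ∀ θ ∈ c.paramSet E,
    T.g D (T.argmin i D ψ) - ∑ a, ψ a * T.argmin i D ψ a ≤ T.g D θ - ∑ a, ψ a * θ a

/-! ## The learned classifier and the accelerated procedure -/

/-- A node with features `φ` is classified as relevant if the output of the network reaches the
threshold `r`. The threshold `1/2` is the hard decision; with a threshold uniform on `[0, 1]` the
output is the probability that the node is classified as relevant. -/
def classify (θ : Params E) (r : ℝ) (φ : Features N M E) : Bool :=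
  decide (r ≤ gnn T.ξ T.depth θ φ)

/-- The probability that a node of law `p` is classified correctly, with parameter of law `κ` and
threshold of law `τ`. -/
def accuracy (p : Measure (Sample N M E)) (κ : Measure (Params E)) (τ : Measure ℝ) : ℝ :=
  (p.prod (κ.prod τ)).real {q | T.classify q.2.1 q.2.2 q.1.1 = q.1.2}

variable {Q : BFInstance N M}

/-- State of the accelerated branch and bound procedure after `t` iterations: `w t` holds the
parameter and the threshold used for the classification in iteration `t`, and `feat` computes the
features of the selected node. -/
def minimal (R : BBRules Q) (ε : ℝ≥0) (feat : BBState N M → BBNode N → Features N M E)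
    (w : ℕ → Params E × ℝ) : ℕ → BBState N M
  | 0 => R.init
  | t + 1 =>
    let S := minimal R ε feat w t
    R.step ε S (T.classify (w t).1 (w t).2 (feat S (R.current S)))

/-- Every node that the procedure has to classify is classified correctly with probability at
least `ρ`, given the past. -/
def ClassifiesWith (R : BBRules Q) (ε : ℝ≥0) (feat : BBState N M → BBNode N → Features N M E)
    (Aopt : Finset (Fin N)) (κ : Measure (Params E)) [IsProbabilityMeasure κ] (τ : Measure ℝ)
    [IsProbabilityMeasure τ] (ρ : ℝ) : Prop :=
  ∀ t, ∀ᵐ w ∂(Measure.infinitePi fun _ : ℕ => κ.prod τ),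
    let S := T.minimal R ε feat w t
    R.Continues ε S →
      ρ ≤ T.accuracy (Measure.dirac (feat S (R.current S), (R.current S).label Aopt)) κ τ

/-- The expected number of nodes visited. -/
def expectedNodes (R : BBRules Q) (ε : ℝ≥0) (feat : BBState N M → BBNode N → Features N M E)
    (κ : Measure (Params E)) [IsProbabilityMeasure κ] (τ : Measure ℝ)
    [IsProbabilityMeasure τ] : ℝ≥0∞ :=
  ∫⁻ w, ⨆ t, ((T.minimal R ε feat w t).visited : ℝ≥0∞)
    ∂(Measure.infinitePi fun _ : ℕ => κ.prod τ)

/-- The event that the procedure stops with a solution that is optimal within the tolerance. -/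
def success (R : BBRules Q) (ε : ℝ≥0) (feat : BBState N M → BBNode N → Features N M E) :
    Set (ℕ → Params E × ℝ) :=
  {w | ∃ t, ¬ R.Continues ε (T.minimal R ε feat w t) ∧
    Q.OptimalWithin ε (T.minimal R ε feat w t).incumbent}

end Training

end

noncomputable section

/-! ## Product measures and exponential perturbations -/

/-! The proof combines three arguments that meet only at the end: a regret bound with concentration
for part 2, Jensen's inequality for part 3, and potential functions along the search tree for parts
1 and 4.

Regret. Fix a realization of the noise, hence all the batches. Each batch depends on earlier
parameters, but `paramLaw` averages over a fresh perturbation with the data held fixed, so the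
analysis for a fixed sequence of losses applies pathwise. Shifting an exponential coordinate by `c`
changes the mean of a function of oscillation at most `H` by at most `η c H`. The same shift moves
that coordinate of the leader upwards, up to a small error, even if the objective changes slightly.
Hence consecutive leaders are close in mean (`IsLeader.integral_abs_sub_le`). Comparison with the
leader of the next round (`be_the_leader`) gives `perturbed_leader_regret`. The perturbation is
added to the mean of the losses and not to their sum, so it counts once per round: the regret after
`n` rounds has order `n/η + √(η n) + 1`. With `η = I^(1/3)` the average regret is of order
`I^(-1/3)`.

Concentration. Given the past, the samples of a round are i.i.d. and their mean loss has expectation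
`roundLoss`. The deviations `excess` are therefore martingale differences with Hoeffding exponential
moments, and the Azuma-Hoeffding inequality bounds their sum (`measure_sum_excess_ge_le`). The best
round is no worse than the average round, and the last term of the gap already absorbs the
deviation.

Accuracy. For a uniform threshold, a sample is classified correctly with probability exactly
`exp(-loss)`, and `exp` is convex.

Search. Branching a relevant node produces exactly one relevant child, with fewer undecided
antennas; descendants of irrelevant nodes are irrelevant. The irrelevant part is dominated by a
subcritical branching process when `ρ > 1/2`, so a suitable weight of the frontier plus the number
of visited nodes is a supermartingale (`nodePotential_step_le`). A relevant node can be lost only by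
misclassification, at most `N` times at risk, so `ρ` to the number of undecided antennas is a
submartingale (`survival_le_step`). If a relevant node is left when the procedure stops, the
incumbent is good enough. -/

theorem measurable_update_pair {ι A : Type*} [DecidableEq ι] [MeasurableSpace A] (i : ι) :
    Measurable fun q : (ι → A) × A => Function.update q.1 i q.2 := by
  refine measurable_pi_iff.2 fun j => ?_
  by_cases h : j = i
  · subst h; simpa using measurable_snd
  · simp only [Function.update_of_ne h]
    fun_prop

/-- Resampling one coordinate does not change a product measure. -/
theorem map_update_infinitePi {ι A : Type*} [DecidableEq ι] [MeasurableSpace A] (ν : Measure A)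
    [IsProbabilityMeasure ν] (i : ι) :
    ((Measure.infinitePi fun _ : ι => ν).prod ν).map (fun q => Function.update q.1 i q.2) =
      Measure.infinitePi fun _ : ι => ν := by
  have hm := measurable_update_pair (A := A) i
  refine Measure.eq_infinitePi _ fun s t ht => ?_
  rw [Measure.map_apply hm (MeasurableSet.pi s.countable_toSet fun j _ => ht j)]
  by_cases hi : i ∈ s
  · have : (fun q : (ι → A) × A => Function.update q.1 i q.2) ⁻¹' Set.pi s t =
        Set.pi (s.erase i : Finset ι) t ×ˢ t i := by
      ext q
      simp only [Set.mem_preimage, Set.mem_pi, Set.mem_prod, Finset.mem_coe, Finset.mem_erase]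
      constructor
      · intro h
        refine ⟨fun j hj => ?_, by simpa using h i hi⟩
        simpa [Function.update_of_ne hj.1] using h j hj.2
      · rintro ⟨h1, h2⟩ j hj
        by_cases hji : j = i
        · subst hji; simpa using h2
        · simpa [Function.update_of_ne hji] using h1 j ⟨hji, hj⟩
    rw [this, Measure.prod_prod, Measure.infinitePi_pi _ fun j _ => ht j, mul_comm,
      Finset.mul_prod_erase s (fun j => ν (t j)) hi]
  · have : (fun q : (ι → A) × A => Function.update q.1 i q.2) ⁻¹' Set.pi s t =
        Set.pi s t ×ˢ Set.univ := by
      ext q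
      simp only [Set.mem_preimage, Set.mem_pi, Set.mem_prod, Finset.mem_coe, Set.mem_univ, and_true]
      refine forall₂_congr fun j hj => ?_
      rw [Function.update_of_ne (by rintro rfl; exact hi hj)]
    rw [this, Measure.prod_prod, Measure.infinitePi_pi _ fun j _ => ht j, measure_univ, mul_one]

theorem lintegral_infinitePi_update {ι A : Type*} [DecidableEq ι] [MeasurableSpace A]
    (ν : Measure A) [IsProbabilityMeasure ν] (i : ι) {F : (ι → A) → ℝ≥0∞} (hF : Measurable F) :
    ∫⁻ x, F x ∂(Measure.infinitePi fun _ : ι => ν) =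
      ∫⁻ x, ∫⁻ a, F (Function.update x i a) ∂ν ∂(Measure.infinitePi fun _ : ι => ν) := by
  have h : Measurable fun q : (ι → A) × A => F (Function.update q.1 i q.2) :=
    hF.comp (measurable_update_pair i)
  conv_lhs => rw [← map_update_infinitePi ν i]
  rw [lintegral_map hF (measurable_update_pair i), lintegral_prod _ h.aemeasurable]

/-- A function of coordinate `i` and of the other coordinates is integrated over coordinate `i`
first. -/
theorem lintegral_infinitePi_eval {ι A : Type*} [MeasurableSpace A]
    (ν : Measure A) [IsProbabilityMeasure ν] (i : ι) {F : (ι → A) → A → ℝ≥0∞}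
    (hF : Measurable fun q : (ι → A) × A => F q.1 q.2)
    (hdep : ∀ x x' : ι → A, (∀ j, j ≠ i → x j = x' j) → F x = F x') :
    ∫⁻ x, F x (x i) ∂(Measure.infinitePi fun _ : ι => ν) =
      ∫⁻ x, ∫⁻ a, F x a ∂ν ∂(Measure.infinitePi fun _ : ι => ν) := by
  classical
  rw [lintegral_infinitePi_update ν i (F := fun x => F x (x i))
    (hF.comp (measurable_id.prodMk (measurable_pi_apply i)))]
  refine lintegral_congr fun x => lintegral_congr fun a => ?_
  rw [hdep (Function.update x i a) x fun j hj => Function.update_of_ne hj _ _,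
    Function.update_self]

theorem lintegral_expMeasure {η : ℝ} {F : ℝ → ℝ≥0∞} (hF : Measurable F) :
    ∫⁻ x, F x ∂expMeasure η = ∫⁻ x, exponentialPDF η x * F x := by
  have hm : Measurable (gammaPDF 1 η) := (measurable_gammaPDFReal 1 η).ennreal_ofReal
  rw [expMeasure, gammaMeasure, lintegral_withDensity_eq_lintegral_mul _ hm hF]
  rfl

/-- Shifting an exponential variable by `s` changes its law by a factor of at most
`exp (η * s)`. -/
theorem lintegral_expMeasure_shift_le {η s : ℝ} (hs : 0 ≤ s) {F : ℝ → ℝ≥0∞}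
    (hF : Measurable F) :
    ∫⁻ x, F (x + s) ∂expMeasure η ≤ ENNReal.ofReal (Real.exp (η * s)) * ∫⁻ x, F x ∂expMeasure η := by
  have hm : Measurable (exponentialPDF η) := (measurable_exponentialPDFReal η).ennreal_ofReal
  have hmF : Measurable fun x => exponentialPDF η x * F x := hm.mul hF
  have hFs : Measurable fun x => F (x + s) := hF.comp (measurable_add_const s)
  rw [lintegral_expMeasure hFs, lintegral_expMeasure hF,
    ← lintegral_const_mul _ hmF,
    ← lintegral_add_right_eq_self (fun x => ENNReal.ofReal (Real.exp (η * s)) *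
      (exponentialPDF η x * F x)) s]
  -- The right-hand integral has been translated by `s`, so integrands are compared pointwise: for
  -- `x ≥ 0` the density at `x` is `exp (η * s)` times the density at `x + s`, and for `x < 0` the
  -- left side vanishes.
  refine lintegral_mono fun x => ?_
  rw [← mul_assoc]
  refine mul_le_mul_left ?_ _
  rcases lt_or_ge x 0 with hx | hx
  · simp [exponentialPDF_of_neg hx]
  · rw [exponentialPDF_of_nonneg hx, exponentialPDF_of_nonneg (by linarith),
      ← ENNReal.ofReal_mul (Real.exp_pos _).le]
    refine ENNReal.ofReal_le_ofReal (le_of_eq ?_)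
    rw [mul_left_comm, ← Real.exp_add]
    ring_nf

theorem lintegral_abs_expMeasure {η : ℝ} (hη : 0 < η) :
    ∫⁻ x, ENNReal.ofReal |x| ∂expMeasure η = ENNReal.ofReal (1 / η) := by
  rw [lintegral_expMeasure (by fun_prop)]
  -- On the half-line, `x` times the exponential density is `1/η` times the Gamma density of shape
  -- 2, whose mass is 1.
  have : ∀ x, exponentialPDF η x * ENNReal.ofReal |x| = ENNReal.ofReal (1 / η) * gammaPDF 2 η x := by
    intro x
    rcases lt_or_ge x 0 with hx | hx
    · simp [exponentialPDF_of_neg hx, gammaPDF_of_neg hx]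
    · rw [exponentialPDF_of_nonneg hx, gammaPDF_of_nonneg hx,
        ← ENNReal.ofReal_mul (by positivity), ← ENNReal.ofReal_mul (by positivity), abs_of_nonneg hx]
      congr 1
      rw [show (2 : ℝ) - 1 = 1 by norm_num, Real.rpow_one, Real.Gamma_two, Real.rpow_two]
      field_simp
  simp_rw [this]
  have hm : Measurable (gammaPDF 2 η) := (measurable_gammaPDFReal 2 η).ennreal_ofReal
  rw [lintegral_const_mul _ hm,
    lintegral_gammaPDF_eq_one two_pos hη, mul_one]

theorem isProbabilityMeasure_perturbLaw (E : ℕ) {η : ℝ} (hη : 0 < η) :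
    IsProbabilityMeasure (perturbLaw E η) := by
  have := isProbabilityMeasure_expMeasure hη
  unfold perturbLaw; infer_instance

/-- Shifting one coordinate of the perturbation. -/
theorem lintegral_perturbLaw_shift_le {E : ℕ} {η s : ℝ} (hη : 0 < η) (hs : 0 ≤ s) (i : Coord E)
    {F : Params E → ℝ≥0∞} (hF : Measurable F) :
    ∫⁻ x, F (Function.update x i (x i + s)) ∂perturbLaw E η ≤
      ENNReal.ofReal (Real.exp (η * s)) * ∫⁻ x, F x ∂perturbLaw E η := by
  have := isProbabilityMeasure_expMeasure hη
  have hu : Measurable fun q : Params E × ℝ => Function.update q.1 i q.2 :=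
    measurable_update_pair i
  have hl : Measurable fun x : Params E =>
      ∫⁻ a, F (Function.update x i a) ∂expMeasure η :=
    Measurable.lintegral_prod_right' (hF.comp hu)
  rw [perturbLaw, ← Measure.infinitePi_eq_pi,
    lintegral_infinitePi_eval (F := fun x a => F (Function.update x i (a + s))) (expMeasure η) i
      (hF.comp (hu.comp (measurable_fst.prodMk (measurable_snd.add_const s))))
      (fun x x' h => by
        funext a
        congr 1
        funext j
        by_cases hj : j = i
        · subst hj; simp
        · simp [Function.update_of_ne hj, h j hj]),
    lintegral_infinitePi_update (expMeasure η) i hF,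
    ← lintegral_const_mul _ hl]
  exact lintegral_mono fun x => lintegral_expMeasure_shift_le hs
    (F := fun a => F (Function.update x i a)) (hF.comp (measurable_update x))

/-! ## Follow the perturbed leader -/

theorem integrable_perturbLaw_coord {E : ℕ} {η : ℝ} (hη : 0 < η) (i : Coord E) :
    Integrable (fun ψ : Params E => |ψ i|) (perturbLaw E η) ∧
      ∫ ψ, |ψ i| ∂perturbLaw E η = 1 / η := by
  have := isProbabilityMeasure_expMeasure hη
  have hp : MeasurePreserving (Function.eval i) (perturbLaw E η) (expMeasure η) :=
    measurePreserving_eval (fun _ : Coord E => expMeasure η) i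
  have hl : ∫⁻ ψ, ENNReal.ofReal |ψ i| ∂perturbLaw E η = ENNReal.ofReal (1 / η) := by
    rw [← lintegral_abs_expMeasure hη, ← hp.lintegral_comp (by fun_prop)]
  have hm : AEStronglyMeasurable (fun ψ : Params E => |ψ i|) (perturbLaw E η) :=
    Measurable.aestronglyMeasurable (by fun_prop)
  refine ⟨⟨hm, ?_⟩, ?_⟩
  · rw [hasFiniteIntegral_iff_ofReal (Filter.Eventually.of_forall fun _ => abs_nonneg _), hl]
    exact ENNReal.ofReal_lt_top
  · rw [integral_eq_lintegral_of_nonneg_ae (Filter.Eventually.of_forall fun _ => abs_nonneg _) hm,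
      hl, ENNReal.toReal_ofReal (by positivity)]

theorem measurable_update_add {E : ℕ} (i : Coord E) (s : ℝ) :
    Measurable fun x : Params E => Function.update x i (x i + s) := by
  have h : Measurable fun x : Params E => x i + s := by fun_prop
  exact (measurable_update_pair i).comp (measurable_id.prodMk h)

/-- A function of oscillation at most `H` changes its mean by at most `η s H` when one coordinate
of the perturbation is shifted by `s`. -/
theorem integral_perturbLaw_shift_le {E : ℕ} {η s H : ℝ} (hη : 0 < η) (hs : 0 ≤ s) (i : Coord E)
    {φ : Params E → ℝ} (hφ : Measurable φ) (hH : ∀ x y, φ x - φ y ≤ H) :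
    ∫ x, φ (Function.update x i (x i + s)) ∂perturbLaw E η ≤
      ∫ x, φ x ∂perturbLaw E η + η * s * H := by
  have := isProbabilityMeasure_perturbLaw E hη
  have hbdd : BddBelow (Set.range φ) := ⟨φ 0 - H, by
    rintro _ ⟨x, rfl⟩; linarith [hH 0 x]⟩
  set m := ⨅ x, φ x with hm
  have h0 : ∀ x, 0 ≤ φ x - m := fun x => sub_nonneg.2 (ciInf_le hbdd x)
  have h1 : ∀ x, φ x - m ≤ H := fun x => by
    have : φ x - H ≤ m := le_ciInf fun y => by linarith [hH x y]
    linarith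
  have hu := measurable_update_add i s
  have hi : ∀ u : Params E → Params E, Measurable u →
      Integrable (fun x => φ (u x) - m) (perturbLaw E η) := fun u hu =>
    Integrable.of_bound ((hφ.comp hu).sub_const m).aestronglyMeasurable H
      (Filter.Eventually.of_forall fun x => by
        rw [Real.norm_of_nonneg (h0 _)]; exact h1 _)
  have hi' : ∀ u : Params E → Params E, Measurable u →
      Integrable (fun x => φ (u x)) (perturbLaw E η) := fun u hu => by
    refine ((hi u hu).add (integrable_const m)).congr (Filter.Eventually.of_forall fun x => ?_)
    simp
  have hid : Integrable (fun x => φ x - m) (perturbLaw E η) := hi id measurable_id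
  have hid' : Integrable φ (perturbLaw E η) := hi' id measurable_id
  set A := ∫ x, (φ (Function.update x i (x i + s)) - m) ∂perturbLaw E η with hA
  set B := ∫ x, (φ x - m) ∂perturbLaw E η with hB
  have hA' : A = ∫ x, φ (Function.update x i (x i + s)) ∂perturbLaw E η - m := by
    rw [hA, integral_sub (hi' _ hu) (integrable_const m)]; simp
  have hB' : B = ∫ x, φ x ∂perturbLaw E η - m := by
    rw [hB, integral_sub hid' (integrable_const m)]; simp
  have hA0 : 0 ≤ A := integral_nonneg fun x => h0 _
  have hAH : A ≤ H := by
    calc A ≤ ∫ _ : Params E, H ∂perturbLaw E η :=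
          integral_mono (hi _ hu) (integrable_const H) fun x => h1 _
      _ = H := by simp
  have hle : A ≤ Real.exp (η * s) * B := by
    have := lintegral_perturbLaw_shift_le hη hs i (F := fun x => ENNReal.ofReal (φ x - m))
      (hφ.sub_const m).ennreal_ofReal
    rw [← ofReal_integral_eq_lintegral_ofReal (hi _ hu) (Filter.Eventually.of_forall fun x => h0 _),
      ← ofReal_integral_eq_lintegral_ofReal hid
        (Filter.Eventually.of_forall fun x => h0 _), ← ENNReal.ofReal_mul (Real.exp_pos _).le] at this
    exact (ENNReal.ofReal_le_ofReal_iff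
      (mul_nonneg (Real.exp_pos _).le (integral_nonneg fun x => h0 _))).1 this
  -- With the infimum subtracted, `A ≤ exp(ηs) B` and `0 ≤ A ≤ H`, so `B ≥ (1 - ηs) A ≥ A - ηsH`.
  have hexp : 1 - η * s ≤ Real.exp (-(η * s)) := by linarith [Real.add_one_le_exp (-(η * s))]
  have hAB : Real.exp (-(η * s)) * A ≤ B := by
    calc Real.exp (-(η * s)) * A ≤ Real.exp (-(η * s)) * (Real.exp (η * s) * B) := by gcongr
      _ = B := by rw [← mul_assoc, ← Real.exp_add]; simp
  have hηs : 0 ≤ η * s := by positivity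
  nlinarith [mul_le_mul_of_nonneg_right hexp hA0, mul_le_mul_of_nonneg_left hAH hηs]

/-- `a ψ` minimizes `g θ - ψᵀ θ` over `Θ`. -/
def IsLeader {E : ℕ} (Θ : Set (Params E)) (g : Params E → ℝ) (a : Params E → Params E) : Prop :=
  Measurable a ∧ (∀ ψ, a ψ ∈ Θ) ∧
    ∀ ψ, ∀ θ ∈ Θ, g (a ψ) - ∑ k, ψ k * a ψ k ≤ g θ - ∑ k, ψ k * θ k

theorem sum_update_mul {E : ℕ} (ψ θ : Params E) (i : Coord E) (s : ℝ) :
    ∑ k, Function.update ψ i (ψ i + s) k * θ k = ∑ k, ψ k * θ k + s * θ i := by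
  have : ∀ k, Function.update ψ i (ψ i + s) k * θ k = ψ k * θ k + if k = i then s * θ i else 0 := by
    intro k
    by_cases h : k = i
    · subst h; simp; ring
    · simp [h]
  simp [this, sum_add_distrib]

theorem sum_abs_sub_le {E : ℕ} {Θ : Set (Params E)} {H : ℝ}
    (hH : ∀ θ ∈ Θ, ∀ θ' ∈ Θ, ∀ k, |θ k - θ' k| ≤ H) {θ θ' : Params E} (h : θ ∈ Θ) (h' : θ' ∈ Θ) :
    ∑ k, |θ k - θ' k| ≤ Fintype.card (Coord E) * H := by
  calc ∑ k, |θ k - θ' k| ≤ ∑ _k : Coord E, H := sum_le_sum fun k _ => hH θ h θ' h' k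
    _ = _ := by simp

/-- Shifting the perturbation of coordinate `i` upwards nearly increases coordinate `i` of the
leader, also when the objective changes. -/
theorem IsLeader.coord_le {E : ℕ} {Θ : Set (Params E)} {g g' : Params E → ℝ}
    {a b : Params E → Params E} {H d c : ℝ} (ha : IsLeader Θ g a) (hb : IsLeader Θ g' b)
    (hH : ∀ θ ∈ Θ, ∀ θ' ∈ Θ, ∀ k, |θ k - θ' k| ≤ H) (hd : 0 ≤ d) (hc : 0 < c)
    (hg : ∀ θ ∈ Θ, ∀ θ' ∈ Θ, (g' θ - g θ) - (g' θ' - g θ') ≤ d * ∑ k, |θ k - θ' k|)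
    (ψ : Params E) (i : Coord E) :
    a ψ i ≤ b (Function.update ψ i (ψ i + c)) i + d * (Fintype.card (Coord E) * H) / c := by
  set y := b (Function.update ψ i (ψ i + c)) with hy
  have hx := ha.2.1 ψ
  have hyΘ : y ∈ Θ := hb.2.1 _
  -- Each leader is tested against the other. In the sum of the two inequalities the common
  -- perturbation cancels and the shift leaves `c * (a ψ i - y i)`, bounded by the variation of `g'
  -- - g`.
  have h1 := ha.2.2 ψ y hyΘ
  have h2 := hb.2.2 (Function.update ψ i (ψ i + c)) (a ψ) hx
  rw [sum_update_mul, sum_update_mul, ← hy] at h2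
  have h3 := hg (a ψ) hx y hyΘ
  have h4 := mul_le_mul_of_nonneg_left (sum_abs_sub_le hH hx hyΘ) hd
  have h5 : c * (a ψ i - y i) ≤ d * (Fintype.card (Coord E) * H) := by linarith
  have h6 : a ψ i - y i ≤ d * (Fintype.card (Coord E) * H) / c := by
    rw [le_div_iff₀ hc]; linarith
  linarith

theorem IsLeader.integrable_coord {E : ℕ} {Θ : Set (Params E)} {g : Params E → ℝ}
    {a : Params E → Params E} {H : ℝ} (ha : IsLeader Θ g a)
    (hH : ∀ θ ∈ Θ, ∀ θ' ∈ Θ, ∀ k, |θ k - θ' k| ≤ H) (i : Coord E) {m : Measure (Params E)}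
    [IsFiniteMeasure m] : Integrable (fun ψ => a ψ i) m := by
  refine Integrable.of_bound ((measurable_pi_apply i).comp ha.1).aestronglyMeasurable
    (|a 0 i| + H) (Filter.Eventually.of_forall fun ψ => ?_)
  have := hH _ (ha.2.1 ψ) _ (ha.2.1 0) i
  have h2 := abs_sub_abs_le_abs_sub (a ψ i) (a 0 i)
  simp only [Real.norm_eq_abs]
  linarith

/-- Stability of the perturbed leader: under a change of the objective which is `d`-Lipschitz in
the `ℓ₁` norm. -/
theorem IsLeader.integral_abs_sub_le {E : ℕ} {Θ : Set (Params E)} {g g' : Params E → ℝ}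
    {a b : Params E → Params E} {H d c η : ℝ} (hη : 0 < η)
    (ha : IsLeader Θ g a) (hb : IsLeader Θ g' b)
    (hH : ∀ θ ∈ Θ, ∀ θ' ∈ Θ, ∀ k, |θ k - θ' k| ≤ H) (hd : 0 ≤ d) (hc : 0 < c)
    (hg : ∀ θ ∈ Θ, ∀ θ' ∈ Θ, |(g' θ - g θ) - (g' θ' - g θ')| ≤ d * ∑ k, |θ k - θ' k|)
    (i : Coord E) :
    ∫ ψ, |a ψ i - b ψ i| ∂perturbLaw E η ≤
      η * c * H + d * (Fintype.card (Coord E) * H) / c := by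
  have := isProbabilityMeasure_perturbLaw E hη
  have hH0 : 0 ≤ H := (abs_nonneg _).trans (hH _ (ha.2.1 0) _ (ha.2.1 0) i)
  set R := d * (Fintype.card (Coord E) * H) / c with hR
  have hR0 : 0 ≤ R := by positivity
  have hma : Measurable fun ψ => a ψ i := (measurable_pi_apply i).comp ha.1
  have hmb : Measurable fun ψ => b ψ i := (measurable_pi_apply i).comp hb.1
  have hu := measurable_update_add i c
  have h0 : ∀ k : Params E → ℝ, ∀ θ ∈ Θ, ∀ θ' ∈ Θ, (k θ - k θ) - (k θ' - k θ') ≤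
      0 * ∑ k, |θ k - θ' k| := fun k θ _ θ' _ => by simp
  -- Both leaders at `ψ` lie below both leaders at the shifted perturbation: without error for the
  -- same objective, with error `R` across objectives. Undoing the shift in the mean costs `η c H`,
  -- so the mean of max minus min is small.
  have key : ∀ ψ, max (a ψ i) (b ψ i) ≤
      min (a (Function.update ψ i (ψ i + c)) i) (b (Function.update ψ i (ψ i + c)) i) + R := by
    intro ψ
    have haa := ha.coord_le ha hH le_rfl hc (h0 g) ψ i
    have hbb := hb.coord_le hb hH le_rfl hc (h0 g') ψ i
    have hab := ha.coord_le hb hH hd hc (fun θ h θ' h' => (le_abs_self _).trans (hg θ h θ' h')) ψ i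
    have hba := hb.coord_le ha hH hd hc (fun θ h θ' h' => by
      have := (neg_le_abs _).trans (hg θ h θ' h'); linarith) ψ i
    rw [zero_mul, zero_div, add_zero] at haa hbb
    rw [max_le_iff]
    constructor <;> rw [← min_add_add_right] <;> apply le_min <;> linarith
  have hint : ∀ u : Params E → Params E, Measurable u → ∀ F : ℝ → ℝ → ℝ,
      (Measurable fun q : ℝ × ℝ => F q.1 q.2) → (∀ x y, F x y = x ∨ F x y = y) →
      Integrable (fun ψ => F (a (u ψ) i) (b (u ψ) i)) (perturbLaw E η) := by
    intro u hu F hF hxy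
    refine Integrable.of_bound (hF.comp ((hma.comp hu).prodMk (hmb.comp hu))).aestronglyMeasurable
      (|a 0 i| + H) (Filter.Eventually.of_forall fun ψ => ?_)
    have h1 := hH _ (ha.2.1 (u ψ)) _ (ha.2.1 0) i
    have h2 := abs_sub_abs_le_abs_sub (a (u ψ) i) (a 0 i)
    have h3 := hH _ (hb.2.1 (u ψ)) _ (ha.2.1 0) i
    have h4 := abs_sub_abs_le_abs_sub (b (u ψ) i) (a 0 i)
    rw [Real.norm_eq_abs]
    rcases hxy (a (u ψ) i) (b (u ψ) i) with h | h <;> rw [h] <;> linarith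
  have hmax : Integrable (fun ψ => max (a ψ i) (b ψ i)) (perturbLaw E η) :=
    hint id measurable_id max (by fun_prop) max_choice
  have hmin : Integrable (fun ψ => min (a ψ i) (b ψ i)) (perturbLaw E η) :=
    hint id measurable_id min (by fun_prop) min_choice
  have hmin' := hint _ hu min (by fun_prop) min_choice
  have hshift := integral_perturbLaw_shift_le (H := H) hη hc.le i
    (φ := fun ψ => min (a ψ i) (b ψ i)) (hma.min hmb) (by
      intro x y
      have h1 := (abs_le.1 (hH _ (ha.2.1 x) _ (ha.2.1 y) i)).2
      have h2 := (abs_le.1 (hH _ (ha.2.1 x) _ (hb.2.1 y) i)).2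
      have h3 := (abs_le.1 (hH _ (hb.2.1 x) _ (ha.2.1 y) i)).2
      have h4 := (abs_le.1 (hH _ (hb.2.1 x) _ (hb.2.1 y) i)).2
      rcases min_choice (a x i) (b x i) with h | h <;> rcases min_choice (a y i) (b y i) with h' | h' <;>
        rw [h, h'] <;> linarith)
  have h1 : ∫ ψ, max (a ψ i) (b ψ i) ∂perturbLaw E η ≤
      ∫ ψ, min (a (Function.update ψ i (ψ i + c)) i) (b (Function.update ψ i (ψ i + c)) i)
        ∂perturbLaw E η + R := by
    have := integral_mono hmax (hmin'.add (integrable_const R)) key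
    rw [integral_add' hmin' (integrable_const R)] at this
    simpa using this
  have h2 : ∫ ψ, |a ψ i - b ψ i| ∂perturbLaw E η =
      ∫ ψ, max (a ψ i) (b ψ i) ∂perturbLaw E η - ∫ ψ, min (a ψ i) (b ψ i) ∂perturbLaw E η := by
    rw [← integral_sub hmax hmin]
    simp only [max_sub_min_eq_abs']
  rw [h2]
  linarith

/-- Each term is at most twice the increment of the square root, and these increments telescope. -/
theorem sum_inv_sqrt_le (n : ℕ) : ∑ t ∈ range n, 1 / √((t : ℝ) + 1) ≤ 2 * √n := by
  induction n with
  | zero => simp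
  | succ n ih =>
    rw [sum_range_succ]
    have hp : 0 < √((n : ℝ) + 1) := Real.sqrt_pos.2 (by positivity)
    have h1 : √((n : ℝ) + 1) * √((n : ℝ) + 1) = n + 1 := Real.mul_self_sqrt (by positivity)
    have h2 : √(n : ℝ) * √(n : ℝ) = n := Real.mul_self_sqrt (by positivity)
    have h3 : 1 / √((n : ℝ) + 1) ≤ 2 * √((n : ℝ) + 1) - 2 * √n := by
      rw [div_le_iff₀ hp]
      nlinarith [sq_nonneg (√((n : ℝ) + 1) - √n)]
    push_cast
    linarith

/-- Induction on the number of rounds: the comparison point for the first `n` rounds is taken to be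
the minimizer for `n + 1` rounds, which in turn beats every `θ` on the full sum. -/
theorem be_the_leader {α : Type*} (Θ : Set α) (h : ℕ → α → ℝ) (a : ℕ → α) (n : ℕ)
    (hmem : ∀ k, a (k + 1) ∈ Θ)
    (hmin : ∀ k < n, ∀ θ ∈ Θ, ∑ t ∈ range (k + 1), h t (a (k + 1)) ≤ ∑ t ∈ range (k + 1), h t θ) :
    ∀ θ ∈ Θ, ∑ t ∈ range n, h t (a (t + 1)) ≤ ∑ t ∈ range n, h t θ := by
  induction n with
  | zero => simp
  | succ n ih =>
    intro θ hθ
    have h1 := ih (fun k hk => hmin k (by omega)) (a (n + 1)) (hmem n)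
    have h2 := hmin n (by omega) θ hθ
    rw [sum_range_succ] at h2 ⊢
    linarith

theorem IsLeader.integrable_comp {E : ℕ} {Θ : Set (Params E)} {g f : Params E → ℝ}
    {a : Params E → Params E} {G H : ℝ} (ha : IsLeader Θ g a) (hf : Measurable f) (hG : 0 ≤ G)
    (hlip : ∀ θ ∈ Θ, ∀ θ' ∈ Θ, |f θ - f θ'| ≤ G * ∑ k, |θ k - θ' k|)
    (hH : ∀ θ ∈ Θ, ∀ θ' ∈ Θ, ∀ k, |θ k - θ' k| ≤ H) {m : Measure (Params E)} [IsFiniteMeasure m] :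
    Integrable (fun ψ => f (a ψ)) m := by
  refine Integrable.of_bound (hf.comp ha.1).aestronglyMeasurable
    (|f (a 0)| + G * (Fintype.card (Coord E) * H)) (Filter.Eventually.of_forall fun ψ => ?_)
  have h1 := hlip _ (ha.2.1 ψ) _ (ha.2.1 0)
  have h2 := mul_le_mul_of_nonneg_left (sum_abs_sub_le hH (ha.2.1 ψ) (ha.2.1 0)) hG
  have h3 := abs_sub_abs_le_abs_sub (f (a ψ)) (f (a 0))
  rw [Real.norm_eq_abs]
  linarith

/-- The average of `f 0, …, f (n - 1)`. -/
def runningMean {E : ℕ} (f : ℕ → Params E → ℝ) (n : ℕ) (θ : Params E) : ℝ :=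
  (1 / (n : ℝ)) * ∑ t ∈ range n, f t θ

theorem mul_runningMean {E : ℕ} (f : ℕ → Params E → ℝ) (n : ℕ) (θ : Params E) :
    ((n + 1 : ℕ) : ℝ) * runningMean f (n + 1) θ = ∑ t ∈ range (n + 1), f t θ := by
  have : ((n + 1 : ℕ) : ℝ) ≠ 0 := by positivity
  rw [runningMean, ← mul_assoc, mul_one_div_cancel this, one_mul]

/-- A new loss moves the mean by `1/(n+2)` times its difference from the old mean, and both are
`G`-Lipschitz. This decay in `n` is what makes consecutive leaders close. -/
theorem abs_runningMean_succ_sub_le {E : ℕ} {Θ : Set (Params E)} {f : ℕ → Params E → ℝ} {G : ℝ}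
    (hlip : ∀ t, ∀ θ ∈ Θ, ∀ θ' ∈ Θ, |f t θ - f t θ'| ≤ G * ∑ k, |θ k - θ' k|) (n : ℕ) :
    ∀ θ ∈ Θ, ∀ θ' ∈ Θ,
      |(runningMean f (n + 2) θ - runningMean f (n + 1) θ) -
        (runningMean f (n + 2) θ' - runningMean f (n + 1) θ')| ≤
      2 * G / (n + 2) * ∑ k, |θ k - θ' k| := by
  intro θ hθ θ' hθ'
  set S := G * ∑ k, |θ k - θ' k| with hS
  have hm : |runningMean f (n + 1) θ - runningMean f (n + 1) θ'| ≤ S := by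
    have h1 := mul_runningMean f n θ
    have h2 := mul_runningMean f n θ'
    have hn : (0 : ℝ) < ((n + 1 : ℕ) : ℝ) := by positivity
    have h3 : ((n + 1 : ℕ) : ℝ) * |runningMean f (n + 1) θ - runningMean f (n + 1) θ'| ≤
        ((n + 1 : ℕ) : ℝ) * S := by
      rw [← abs_of_pos hn, ← abs_mul, mul_sub, abs_of_pos hn, h1, h2, ← sum_sub_distrib]
      refine (abs_sum_le_sum_abs _ _).trans ((sum_le_sum fun t _ => hlip t θ hθ θ' hθ').trans ?_)
      simp [hS]
    exact le_of_mul_le_mul_left h3 hn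
  have hr : ∀ θ, runningMean f (n + 2) θ - runningMean f (n + 1) θ =
      (1 / (n + 2)) * (f (n + 1) θ - runningMean f (n + 1) θ) := by
    intro θ
    have h1 := mul_runningMean f n θ
    have h2 := mul_runningMean f (n + 1) θ
    rw [sum_range_succ, ← h1] at h2
    push_cast at h2
    have hn : (n : ℝ) + 2 ≠ 0 := by positivity
    field_simp
    linarith
  have hn : (0 : ℝ) < (n : ℝ) + 2 := by positivity
  rw [hr, hr, ← mul_sub, abs_mul, abs_of_pos (by positivity)]
  have h4 := abs_sub (f (n + 1) θ - f (n + 1) θ')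
    (runningMean f (n + 1) θ - runningMean f (n + 1) θ')
  have h5 := hlip (n + 1) θ hθ θ' hθ'
  have h6 : |f (n + 1) θ - runningMean f (n + 1) θ -
      (f (n + 1) θ' - runningMean f (n + 1) θ')| ≤ 2 * S := by
    rw [show f (n + 1) θ - runningMean f (n + 1) θ - (f (n + 1) θ' - runningMean f (n + 1) θ') =
      f (n + 1) θ - f (n + 1) θ' - (runningMean f (n + 1) θ - runningMean f (n + 1) θ') by ring]
    linarith
  calc 1 / ((n : ℝ) + 2) * _ ≤ 1 / ((n : ℝ) + 2) * (2 * S) := by gcongr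
    _ = _ := by rw [hS]; ring

/-- Regret of following the perturbed leader, when the average loss is perturbed. -/
theorem perturbed_leader_regret {E : ℕ} {Θ : Set (Params E)} {G H η : ℝ} (hη : 0 < η)
    (hG : 0 ≤ G) (hH0 : 0 ≤ H) {f : ℕ → Params E → ℝ} (hf : ∀ t, Measurable (f t))
    (hlip : ∀ t, ∀ θ ∈ Θ, ∀ θ' ∈ Θ, |f t θ - f t θ'| ≤ G * ∑ k, |θ k - θ' k|)
    (hH : ∀ θ ∈ Θ, ∀ θ' ∈ Θ, ∀ k, |θ k - θ' k| ≤ H) {a : ℕ → Params E → Params E}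
    (ha : ∀ n, IsLeader Θ (runningMean f (n + 1)) (a (n + 1))) {θ₀ : Params E} (hθ₀ : θ₀ ∈ Θ)
    {κ : ℕ → Measure (Params E)} (hκ₀ : κ 0 = Measure.dirac θ₀)
    (hκ : ∀ n, κ (n + 1) = (perturbLaw E η).map (a (n + 1)))
    (n : ℕ) {θ : Params E} (hθ : θ ∈ Θ) :
    ∑ t ∈ range n, ∫ θ, f t θ ∂κ t ≤ ∑ t ∈ range n, f t θ +
      n * (Fintype.card (Coord E) * H / η) + G * (Fintype.card (Coord E) * H) +
      G * Fintype.card (Coord E) * (1 + 2 * G * Fintype.card (Coord E)) * H * √η * (2 * √n) := by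
  have hprob := isProbabilityMeasure_perturbLaw E hη
  set d : ℝ := (Fintype.card (Coord E) : ℝ) with hd
  have hd0 : 0 ≤ d := by positivity
  set P := perturbLaw E η with hP
  have hint : ∀ t k, Integrable (fun ψ => f t (a (k + 1) ψ)) P := fun t k =>
    (ha k).integrable_comp (hf t) hG (hlip t) hH
  -- stability
  have hstab : ∀ t, ∫ θ, f t θ ∂κ t ≤ ∫ ψ, f t (a (t + 1) ψ) ∂P +
      ((if t = 0 then G * (d * H) else 0) +
        G * d * (1 + 2 * G * d) * H * √η * (1 / √((t : ℝ) + 1))) := by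
    intro t
    have hpos : 0 ≤ G * d * (1 + 2 * G * d) * H * √η * (1 / √((t : ℝ) + 1)) := by positivity
    -- Round 0 plays a fixed point and not a leader, so it is charged the full oscillation `G * (d *
    -- H)` once.
    rcases t with _ | t
    · rw [hκ₀, integral_dirac' _ _ (hf 0).stronglyMeasurable]
      have : ∫ _ψ : Params E, f 0 θ₀ ∂P ≤ ∫ ψ, (f 0 (a 1 ψ) + G * (d * H)) ∂P := by
        refine integral_mono (integrable_const _) ((hint 0 0).add (integrable_const _)) fun ψ => ?_
        have h1 := (le_abs_self _).trans (hlip 0 _ hθ₀ _ ((ha 0).2.1 ψ))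
        have h2 := mul_le_mul_of_nonneg_left (sum_abs_sub_le hH hθ₀ ((ha 0).2.1 ψ)) hG
        show f 0 θ₀ ≤ f 0 (a 1 ψ) + G * (d * H)
        linarith
      rw [integral_add (hint 0 0) (integrable_const _)] at this
      simp only [integral_const, probReal_univ, smul_eq_mul, one_mul] at this
      rw [if_pos rfl]
      simp only [zero_add] at *
      linarith
    · rw [hκ, integral_map (ha t).1.aemeasurable (hf _).aestronglyMeasurable, if_neg (by omega),
        zero_add]
      -- This shift gives both parts of the stability bound, `η c H` and `2G/(t+2) * d H / c`, the
      -- same order `√η / √(t+2)`.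
      have hc : 0 < 1 / √(η * (t + 2)) := by positivity
      have habs : ∀ k, Integrable (fun ψ => |a (t + 1) ψ k - a (t + 1 + 1) ψ k|) P := fun k =>
        (((ha t).integrable_coord hH k).sub ((ha (t + 1)).integrable_coord hH k)).abs
      have habs' : Integrable (fun ψ => G * ∑ k, |a (t + 1) ψ k - a (t + 1 + 1) ψ k|) P :=
        (integrable_finsetSum _ fun k _ => habs k).const_mul G
      have hsum : ∫ ψ, ∑ k, |a (t + 1) ψ k - a (t + 1 + 1) ψ k| ∂P ≤
          d * (1 + 2 * G * d) * H * √η * (1 / √(((t + 1 : ℕ) : ℝ) + 1)) := by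
        rw [integral_finsetSum _ fun k _ => habs k]
        have h1 : ∀ k, ∫ ψ, |a (t + 1) ψ k - a (t + 1 + 1) ψ k| ∂P ≤
            (1 + 2 * G * d) * H * √η * (1 / √(((t + 1 : ℕ) : ℝ) + 1)) := by
          intro k
          refine ((ha t).integral_abs_sub_le hη (ha (t + 1)) hH (d := 2 * G / (t + 2)) (by positivity)
            hc (abs_runningMean_succ_sub_le hlip t) k).trans (le_of_eq ?_)
          rw [← hd]
          have h2 : √(η * (t + 2)) = √η * √((t : ℝ) + 2) := Real.sqrt_mul hη.le _
          have h3 : ((t + 1 : ℕ) : ℝ) + 1 = t + 2 := by push_cast; ring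
          rw [h2, h3]
          have h4 : √η ≠ 0 := (Real.sqrt_pos.2 hη).ne'
          have h5 : √((t : ℝ) + 2) ≠ 0 := (Real.sqrt_pos.2 (by positivity)).ne'
          have h6 : √η ^ 2 = η := Real.sq_sqrt hη.le
          have h7 : √((t : ℝ) + 2) ^ 2 = t + 2 := Real.sq_sqrt (by positivity)
          have h8 : (t : ℝ) + 2 ≠ 0 := by positivity
          field_simp
          rw [h6, h7]
          ring
        refine (sum_le_sum fun k _ => h1 k).trans (le_of_eq ?_)
        rw [sum_const, card_univ, nsmul_eq_mul, ← hd]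
        ring
      have hdiff : ∫ ψ, f (t + 1) (a (t + 1) ψ) ∂P ≤ ∫ ψ, (f (t + 1) (a (t + 1 + 1) ψ) +
          G * ∑ k, |a (t + 1) ψ k - a (t + 1 + 1) ψ k|) ∂P := by
        refine integral_mono (hint _ _) ((hint _ _).add habs') fun ψ => ?_
        have := (le_abs_self _).trans (hlip (t + 1) _ ((ha t).2.1 ψ) _ ((ha (t + 1)).2.1 ψ))
        show f (t + 1) (a (t + 1) ψ) ≤ f (t + 1) (a (t + 1 + 1) ψ) +
          G * ∑ k, |a (t + 1) ψ k - a (t + 1 + 1) ψ k|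
        linarith
      rw [integral_add (hint _ _) habs', integral_const_mul] at hdiff
      have := mul_le_mul_of_nonneg_left hsum hG
      calc _ ≤ _ := hdiff
        _ ≤ _ := by linarith
  -- the leader of the next round
  have hbtl : ∑ t ∈ range n, ∫ ψ, f t (a (t + 1) ψ) ∂P ≤
      ∑ t ∈ range n, f t θ + n * (d * H / η) := by
    have hpt : ∀ ψ, ∑ t ∈ range n, f t (a (t + 1) ψ) ≤
        ∑ t ∈ range n, f t θ + n * (H * ∑ k, |ψ k|) := by
      intro ψ
      -- One `ψ` may serve all rounds, since only the law of each round's parameter enters.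
      -- Multiplying the perturbed mean by the number of rounds gives every round its own copy of
      -- `-ψᵀθ`; hence the factor `n` in the cost of the perturbation.
      have h1 := be_the_leader Θ (fun t θ => f t θ - ∑ k, ψ k * θ k) (fun t => a t ψ) n
        (fun k => (ha k).2.1 ψ) (fun m _ θ hθ => by
          have h2 := (ha m).2.2 ψ θ hθ
          have hn : (0 : ℝ) ≤ ((m + 1 : ℕ) : ℝ) := by positivity
          have h3 := mul_le_mul_of_nonneg_left h2 hn
          rw [mul_sub, mul_sub, mul_runningMean, mul_runningMean] at h3
          simpa only [sum_sub_distrib, sum_const, card_range, nsmul_eq_mul] using h3) θ hθ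
      simp only [sum_sub_distrib, sum_const, card_range, nsmul_eq_mul] at h1
      have h2 : ∀ t, ∑ k, ψ k * a (t + 1) ψ k - ∑ k, ψ k * θ k ≤ H * ∑ k, |ψ k| := by
        intro t
        rw [← sum_sub_distrib, mul_sum]
        refine sum_le_sum fun k _ => ?_
        rw [← mul_sub]
        refine (le_abs_self _).trans ?_
        rw [abs_mul, mul_comm]
        gcongr
        exact hH _ ((ha t).2.1 ψ) _ hθ k
      have h3 : ∑ t ∈ range n, (∑ k, ψ k * a (t + 1) ψ k - ∑ k, ψ k * θ k) ≤
          n * (H * ∑ k, |ψ k|) := by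
        refine (sum_le_sum fun t _ => h2 t).trans (le_of_eq ?_)
        simp
      rw [sum_sub_distrib] at h3
      simp only [sum_const, card_range, nsmul_eq_mul] at h3
      linarith
    have hψ := fun k => integrable_perturbLaw_coord (E := E) hη k
    have hi : Integrable (fun ψ : Params E => ∑ k, |ψ k|) P :=
      integrable_finsetSum _ fun k _ => (hψ k).1
    have := integral_mono (integrable_finsetSum (range n) fun t _ => hint t t)
      ((integrable_const (∑ t ∈ range n, f t θ)).add ((hi.const_mul H).const_mul (n : ℝ))) hpt
    rw [integral_finsetSum _ fun t _ => hint t t, integral_add' (integrable_const _)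
      ((hi.const_mul H).const_mul (n : ℝ)), integral_const_mul, integral_const_mul,
      integral_finsetSum _ fun k _ => (hψ k).1] at this
    simp only [integral_const, probReal_univ, smul_eq_mul, one_mul, ← hP, hP ▸ (hψ _).2, sum_const,
      card_univ, nsmul_eq_mul] at this
    rw [← hd] at this
    calc _ ≤ _ := this
      _ = _ := by ring
  have hfin := sum_le_sum fun t (_ : t ∈ range n) => hstab t
  rw [sum_add_distrib, sum_add_distrib, ← mul_sum] at hfin
  have h1 : ∑ t ∈ range n, (if t = 0 then G * (d * H) else 0) ≤ G * (d * H) := by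
    rw [sum_ite_eq' (range n) 0 fun _ => G * (d * H)]
    split_ifs
    · exact le_rfl
    · positivity
  have h2 := mul_le_mul_of_nonneg_left (sum_inv_sqrt_le n)
    (show 0 ≤ G * d * (1 + 2 * G * d) * H * √η by positivity)
  linarith

/-! ## Measurability of the network and of the training procedure -/

theorem continuous_act {E : ℕ} {X : Type*} [TopologicalSpace X] {θ : X → Params E}
    {v : X → EuclideanSpace ℝ (Fin E)} (hθ : Continuous θ) (hv : Continuous v) (i : Fin 3) :
    Continuous fun x => (θ x).act i (v x) := by
  have h : (fun x => (θ x).act i (v x)) =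
      fun x => WithLp.toLp 2 fun a => ∑ b, θ x (Sum.inl (i, a, b)) * v x b := by
    funext q
    ext a
    simp [Params.act, Params.Z, Matrix.ofLp_toEuclideanCLM, Matrix.mulVec, dotProduct]
  rw [h]
  refine (PiLp.continuous_toLp 2 _).comp (continuous_pi fun a => continuous_finsetSum _ fun b _ => ?_)
  fun_prop

section GNN

variable {N M E : ℕ} {ξ : EuclideanSpace ℝ (Fin E) → EuclideanSpace ℝ (Fin E)}

theorem continuous_embed (hξ : Continuous ξ) (d : ℕ) :
    Continuous fun q : Params E × Features N M E => embed ξ q.1 q.2 d := by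
  induction d with
  | zero => exact continuous_fst.comp continuous_snd
  | succ d ih =>
    have hu : ∀ u, Continuous fun q : Params E × Features N M E => embed ξ q.1 q.2 d u :=
      fun u => (continuous_apply u).comp ih
    have hact : ∀ (i : Fin 3) (v : Params E × Features N M E → EuclideanSpace ℝ (Fin E)),
        Continuous v → Continuous fun q : Params E × Features N M E => q.1.act i (v q) :=
      fun i v hv => continuous_act continuous_fst hv i
    have he : ∀ n m, Continuous fun q : Params E × Features N M E => q.2.2 n m := by
      intro n m
      fun_prop
    refine continuous_pi fun u => ?_
    refine hξ.comp ((hact 0 _ (hu u)).add ?_)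
    rcases u with n | m
    · exact continuous_finsetSum _ fun m _ =>
        hξ.comp ((hact 1 _ (hu _)).add (hact 2 _ (he n m)))
    · exact continuous_finsetSum _ fun n _ =>
        hξ.comp ((hact 1 _ (hu _)).add (hact 2 _ (he n m)))

theorem continuous_gnn (hξ : Continuous ξ) (d : ℕ) :
    Continuous fun q : Params E × Features N M E => gnn ξ d q.1 q.2 := by
  have hβ : Continuous fun q : Params E × Features N M E => q.1.β :=
    (PiLp.continuous_toLp 2 _).comp (by fun_prop)
  refine continuous_const.mul (continuous_finsetSum _ fun u _ => ?_)
  have hu : Continuous fun q : Params E × Features N M E => embed ξ q.1 q.2 d u :=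
    (continuous_apply u).comp (continuous_embed hξ d)
  exact continuous_sigmoid.comp (hβ.inner hu)

theorem measurable_gnn (hξ : Continuous ξ) (d : ℕ) {X : Type*} [MeasurableSpace X]
    {θ : X → Params E} {φ : X → Features N M E} (hθ : Measurable θ) (hφ : Measurable φ) :
    Measurable fun x => gnn ξ d (θ x) (φ x) := by
  have h : Measurable fun q : Params E × Features N M E => gnn ξ d q.1 q.2 :=
    (continuous_gnn hξ d).measurable
  have h2 : Measurable fun x => (θ x, φ x) := hθ.prodMk hφ
  change Measurable ((fun q : Params E × Features N M E => gnn ξ d q.1 q.2) ∘ fun x => (θ x, φ x))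
  exact h.comp h2

/-- A mean of sigmoids over a nonempty set of vertices. Strict bounds keep the logarithms of the
logistic loss away from `log 0`. -/
theorem gnn_mem_Ioo (hN : 0 < N) (d : ℕ) (θ : Params E) (φ : Features N M E) :
    gnn ξ d θ φ ∈ Set.Ioo (0 : ℝ) 1 := by
  have : Nonempty (Fin N ⊕ Fin M) := ⟨Sum.inl ⟨0, hN⟩⟩
  have hU : (0 : ℝ) < N + M := by positivity
  have hcard : ((univ : Finset (Fin N ⊕ Fin M)).card : ℝ) = N + M := by simp
  constructor
  · exact mul_pos (by positivity) (sum_pos (fun u _ => Real.sigmoid_pos _) univ_nonempty)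
  · rw [gnn, one_div, inv_mul_lt_iff₀ hU, mul_one, ← hcard]
    calc _ < ∑ _u : Fin N ⊕ Fin M, (1 : ℝ) :=
          sum_lt_sum_of_nonempty univ_nonempty fun u _ => Real.sigmoid_lt_one _
      _ = _ := by simp

end GNN

theorem Bounds.measurableSet_paramSet (c : Bounds) (E : ℕ) : MeasurableSet (c.paramSet E) := by
  have hact : ∀ i : Fin 3, Measurable fun θ : Params E => ‖θ.act i‖ := by
    intro i
    have h : Continuous fun θ : Params E => θ.Z i :=
      continuous_matrix fun a b => by simpa [Params.Z] using continuous_apply _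
    have h2 : Continuous fun A : Matrix (Fin E) (Fin E) ℝ =>
        Matrix.toEuclideanCLM (n := Fin E) (𝕜 := ℝ) A :=
      LinearMap.continuous_of_finiteDimensional
        ((Matrix.toEuclideanCLM (n := Fin E) (𝕜 := ℝ)).toAlgEquiv.toLinearMap)
    exact (h2.comp h).norm.measurable
  have hβ : Continuous fun θ : Params E => θ.β :=
    (PiLp.continuous_toLp 2 _).comp (by fun_prop)
  have : c.paramSet E = (⋂ i, {θ | ‖θ.act i‖ ≤ c.BZ}) ∩ {θ | ‖θ.β‖ ≤ c.Bβ} := by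
    ext θ; simp [Bounds.paramSet]
  rw [this]
  exact (MeasurableSet.iInter fun i => measurableSet_le (hact i) measurable_const).inter
    (measurableSet_le hβ.norm.measurable measurable_const)

/-! ### The training process: dependence on the past, measurability, invariance of the parameter set
-/

namespace Training

variable {N M E J : ℕ} {Z : Type*} {T : Training N M E J Z}

/-- Predictability: the parameter of round `i` is determined before the noise of round `i`, so that
noise can be integrated out with the past frozen. -/
theorem run_congr {x x' : ℕ → (Fin J → Z) × Params E} {i : ℕ} (h : ∀ k < i, x k = x' k) :
    T.run x i = T.run x' i := by
  induction i with
  | zero => rfl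
  | succ i ih =>
    have h1 := ih fun k hk => h k (by omega)
    simp only [run, h1, h i (by omega)]

theorem data_succ_castSucc (x : ℕ → (Fin J → Z) × Params E) (i : ℕ) (t : Fin i) :
    T.data x (i + 1) t.castSucc = T.data x i t := by
  simp [data, run]

theorem data_succ_last (x : ℕ → (Fin J → Z) × Params E) (i : ℕ) :
    T.data x (i + 1) (Fin.last i) = fun j => T.gen i (T.param x i) ((x i).1 j) := by
  simp [data, run, param]

theorem data_apply (x : ℕ → (Fin J → Z) × Params E) (n : ℕ) (t : Fin n) :
    T.data x n t = fun j => T.gen t (T.param x t) ((x t).1 j) := by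
  induction n with
  | zero => exact t.elim0
  | succ n ih =>
    refine Fin.lastCases ?_ (fun t => ?_) t
    · rw [data_succ_last]; rfl
    · rw [data_succ_castSucc, ih]; rfl

variable [MeasurableSpace Z]

namespace Assumptions

variable {c : Bounds} {I : ℕ} {G H : ℝ} (hT : T.Assumptions c I G H)
include hT

theorem continuous_ξ : Continuous T.ξ :=
  (LipschitzWith.of_dist_le_mul (K := ⟨c.Cξ, hT.Cξ_nonneg⟩) fun a b => by
    rw [dist_eq_norm, dist_eq_norm]; exact hT.ξ_lip a b).continuous

theorem measurable_sampleLoss {X : Type*} [MeasurableSpace X] {θ : X → Params E}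
    {s : X → Sample N M E} (hθ : Measurable θ) (hs : Measurable s) :
    Measurable fun x => T.sampleLoss (θ x) (s x) := by
  have h1 : Measurable (Function.uncurry T.loss) := by
    refine measurable_from_prod_countable_left fun y => ?_
    exact hT.loss_meas y
  have h2 := measurable_gnn hT.continuous_ξ T.depth hθ hs.fst
  exact h1.comp (h2.prodMk hs.snd)

theorem measurable_run (i : ℕ) :
    Measurable fun x : ℕ → (Fin J → Z) × Params E => T.run x i := by
  induction i with
  | zero => exact measurable_const
  | succ i ih =>
    have hd : Measurable fun x : ℕ → (Fin J → Z) × Params E => (T.run x (i + 1)).1 := by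
      refine measurable_pi_iff.2 fun t => ?_
      refine Fin.lastCases ?_ (fun t => ?_) t
      · have : (fun x : ℕ → (Fin J → Z) × Params E => (T.run x (i + 1)).1 (Fin.last i)) =
            fun x j => T.gen i (T.run x i).2 ((x i).1 j) := by
          funext x; exact data_succ_last x i
        rw [this]
        refine measurable_pi_iff.2 fun j => ?_
        have hz : Measurable fun x : ℕ → (Fin J → Z) × Params E => (x i).1 j := by fun_prop
        exact (hT.gen_meas i).comp ((measurable_snd.comp ih).prodMk hz)
      · have : (fun x : ℕ → (Fin J → Z) × Params E => (T.run x (i + 1)).1 t.castSucc) =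
            fun x => (T.run x i).1 t := by
          funext x; exact data_succ_castSucc x i t
        rw [this]
        exact (measurable_pi_apply t).comp (measurable_fst.comp ih)
    have hψ : Measurable fun x : ℕ → (Fin J → Z) × Params E => (x i).2 := by fun_prop
    exact hd.prodMk ((hT.argmin_meas (i + 1)).comp (hd.prodMk hψ))

theorem measurable_data (i : ℕ) :
    Measurable fun x : ℕ → (Fin J → Z) × Params E => T.data x i :=
  measurable_fst.comp (hT.measurable_run i)

theorem measurable_param (i : ℕ) :
    Measurable fun x : ℕ → (Fin J → Z) × Params E => T.param x i :=
  measurable_snd.comp (hT.measurable_run i)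

/-- The two claims need a joint induction: new data are admissible because the parameter lies in
`Θ`, and the optimizer stays in `Θ` because the data are admissible. -/
theorem run_mem (x : ℕ → (Fin J → Z) × Params E) (i : ℕ) :
    (∀ t j, c.Admissible (T.data x i t j).1) ∧ T.param x i ∈ c.paramSet E := by
  induction i with
  | zero => exact ⟨fun t => t.elim0, hT.init_mem⟩
  | succ i ih =>
    have h : ∀ t j, c.Admissible (T.data x (i + 1) t j).1 := by
      intro t j
      refine Fin.lastCases ?_ (fun t => ?_) t
      · rw [data_succ_last]; exact hT.gen_adm i _ ih.2 _
      · rw [data_succ_castSucc]; exact ih.1 t j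
    exact ⟨h, hT.argmin_mem _ _ _ h⟩

theorem data_admissible (x : ℕ → (Fin J → Z) × Params E) (i : ℕ) (t : Fin i) (j : Fin J) :
    c.Admissible (T.data x i t j).1 := (hT.run_mem x i).1 t j

theorem param_mem (x : ℕ → (Fin J → Z) × Params E) (i : ℕ) : T.param x i ∈ c.paramSet E :=
  (hT.run_mem x i).2

theorem gen_admissible (x : ℕ → (Fin J → Z) × Params E) (i : ℕ) (z : Z) :
    c.Admissible (T.gen i (T.param x i) z).1 := hT.gen_adm i _ (hT.param_mem x i) z

theorem measurable_gen (i : ℕ) (θ : Params E) : Measurable (T.gen i θ) :=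
  (hT.gen_meas i).comp (measurable_const.prodMk measurable_id)

theorem measurable_argmin (i : ℕ) (D : Batches N M E J i) : Measurable (T.argmin i D) :=
  (hT.argmin_meas i).comp (measurable_const.prodMk measurable_id)

theorem isProbabilityMeasure_sampleLaw (μ : Measure Z) [IsProbabilityMeasure μ]
    (x : ℕ → (Fin J → Z) × Params E) (i : ℕ) : IsProbabilityMeasure (T.sampleLaw μ x i) :=
  Measure.isProbabilityMeasure_map (hT.measurable_gen i _).aemeasurable

theorem isProbabilityMeasure_paramLaw {η : ℝ} (hη : 0 < η)
    (x : ℕ → (Fin J → Z) × Params E) (i : ℕ) : IsProbabilityMeasure (T.paramLaw η x i) := by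
  have := isProbabilityMeasure_perturbLaw E hη
  cases i with
  | zero => exact Measure.dirac.isProbabilityMeasure
  | succ i => exact Measure.isProbabilityMeasure_map (hT.measurable_argmin _ _).aemeasurable

end Assumptions

end Training

/-! ## Concentration of the batch losses -/

/-- Exponential moments of a sum whose terms have bounded conditional exponential moments. -/
theorem lintegral_exp_sum_le {A : Type*} [MeasurableSpace A] (ν : Measure A)
    [IsProbabilityMeasure ν] {F : ℕ → (ℕ → A) → A → ℝ}
    (hF : ∀ n, Measurable fun q : (ℕ → A) × A => F n q.1 q.2)
    (hdep : ∀ n (x x' : ℕ → A), (∀ k < n, x k = x' k) → F n x = F n x') {l v : ℝ}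
    (hv : ∀ n x, ∫⁻ a, ENNReal.ofReal (Real.exp (l * F n x a)) ∂ν ≤ ENNReal.ofReal (Real.exp v))
    (n : ℕ) :
    ∫⁻ x, ENNReal.ofReal (Real.exp (l * ∑ i ∈ range n, F i x (x i)))
        ∂(Measure.infinitePi fun _ : ℕ => ν) ≤ ENNReal.ofReal (Real.exp (n * v)) := by
  induction n with
  | zero => simp
  | succ n ih =>
    have hS : Measurable fun x : ℕ → A => ∑ i ∈ range n, F i x (x i) :=
      Finset.measurable_sum _ fun i _ => (hF i).comp (measurable_id.prodMk (measurable_pi_apply i))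
    have hexp : ∀ x a, ENNReal.ofReal (Real.exp (l * (∑ i ∈ range n, F i x (x i) + F n x a))) =
        ENNReal.ofReal (Real.exp (l * ∑ i ∈ range n, F i x (x i))) *
          ENNReal.ofReal (Real.exp (l * F n x a)) := fun x a => by
      rw [mul_add, Real.exp_add, ENNReal.ofReal_mul (Real.exp_pos _).le]
    simp_rw [sum_range_succ]
    -- The noise of round `n` is integrated first; the partial sum does not depend on it and factors
    -- out.
    rw [lintegral_infinitePi_eval ν n (F := fun x a =>
      ENNReal.ofReal (Real.exp (l * (∑ i ∈ range n, F i x (x i) + F n x a))))]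
    · calc _ = ∫⁻ x, ENNReal.ofReal (Real.exp (l * ∑ i ∈ range n, F i x (x i))) *
            ∫⁻ a, ENNReal.ofReal (Real.exp (l * F n x a)) ∂ν
              ∂(Measure.infinitePi fun _ : ℕ => ν) := by
            refine lintegral_congr fun x => ?_
            simp_rw [hexp]
            refine lintegral_const_mul _ ?_
            have : Measurable fun a => F n x a := (hF n).comp (measurable_const.prodMk measurable_id)
            fun_prop
        _ ≤ ∫⁻ x, ENNReal.ofReal (Real.exp (l * ∑ i ∈ range n, F i x (x i))) *
            ENNReal.ofReal (Real.exp v) ∂(Measure.infinitePi fun _ : ℕ => ν) :=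
            lintegral_mono fun x => mul_le_mul_right (hv n x) _
        _ ≤ ENNReal.ofReal (Real.exp (n * v)) * ENNReal.ofReal (Real.exp v) := by
            rw [lintegral_mul_const _ (by fun_prop)]
            exact mul_le_mul_left ih _
        _ = _ := by
            rw [← ENNReal.ofReal_mul (Real.exp_pos _).le, ← Real.exp_add]
            push_cast
            ring_nf
    · have h1 : Measurable fun q : (ℕ → A) × A => ∑ i ∈ range n, F i q.1 (q.1 i) :=
        hS.comp measurable_fst
      have h2 := hF n
      exact ((h1.add h2).const_mul l).exp.ennreal_ofReal
    · intro x x' h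
      funext a
      have h1 : F n x = F n x' := hdep n x x' fun k hk => h k hk.ne
      have h2 : ∀ i ∈ range n, F i x (x i) = F i x' (x' i) := fun i hi => by
        have hi := mem_range.1 hi
        rw [hdep i x x' fun k hk => h k (by omega), h i hi.ne]
      rw [h1, sum_congr rfl h2]

/-- Hoeffding's bound for the exponential moments of a sample mean. -/
theorem lintegral_exp_sampleMean_le {Z : Type*} [MeasurableSpace Z] (μ : Measure Z)
    [IsProbabilityMeasure μ] {J : ℕ} (hJ : 0 < J) {u : Z → ℝ} (hu : Measurable u) {B : ℝ}
    (hB : ∀ z, |u z| ≤ B) (l : ℝ) :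
    ∫⁻ z, ENNReal.ofReal (Real.exp (l * (∫ z, u z ∂μ - (1 / (J : ℝ)) * ∑ j, u (z j))))
        ∂(Measure.pi fun _ : Fin J => μ) ≤ ENNReal.ofReal (Real.exp (l ^ 2 * B ^ 2 / (2 * J))) := by
  have hJ' : (0 : ℝ) < J := by exact_mod_cast hJ
  obtain ⟨z₀⟩ : Nonempty Z := nonempty_of_isProbabilityMeasure μ
  have hB0 : 0 ≤ B := (abs_nonneg _).trans (hB z₀)
  have h1 := hasSubgaussianMGF_of_mem_Icc (μ := μ) (X := fun z => - u z) (a := -B) (b := B)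
    hu.neg.aemeasurable (Filter.Eventually.of_forall fun z => by
      have := abs_le.1 (hB z); constructor <;> linarith)
  set w : Z → ℝ := fun z => - u z - ∫ z, - u z ∂μ with hw
  have hwm : Measurable w := hu.neg.sub_const _
  have hind : iIndepFun (fun (j : Fin J) (z : Fin J → Z) => w (z j)) (Measure.pi fun _ => μ) :=
    iIndepFun_pi fun _ => hwm.aemeasurable
  have h2 : ∀ j : Fin J, HasSubgaussianMGF (fun z : Fin J → Z => w (z j))
      ((‖B - -B‖₊ / 2) ^ 2) (Measure.pi fun _ => μ) := fun j => by
    have hp := measurePreserving_eval (fun _ : Fin J => μ) j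
    rw [← hp.map_eq] at h1
    exact h1.of_map hp.measurable.aemeasurable
  have h3 := HasSubgaussianMGF.sum_of_iIndepFun hind (s := univ) fun j _ => h2 j
  -- Range `2B` gives variance proxy `B²` per sample, `J B²` for the sum; the argument `l / J` turns
  -- this into `l² B² / (2J)`.
  have h4 := h3.mgf_le (l / J)
  have heq : ∀ z : Fin J → Z, l / J * ∑ j, w (z j) =
      l * (∫ z, u z ∂μ - (1 / (J : ℝ)) * ∑ j, u (z j)) := by
    intro z
    simp only [hw, integral_neg, sum_sub_distrib, sum_neg_distrib, sum_const, card_univ,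
      Fintype.card_fin, nsmul_eq_mul]
    field_simp
    ring
  have hi := h3.integrable_exp_mul (l / J)
  simp only [mgf, heq] at h4 hi
  rw [← ofReal_integral_eq_lintegral_ofReal hi (Filter.Eventually.of_forall fun _ =>
    (Real.exp_pos _).le)]
  refine ENNReal.ofReal_le_ofReal (h4.trans (le_of_eq ?_))
  congr 1
  have : ((‖B - -B‖₊ : ℝ≥0) : ℝ) = 2 * B := by
    rw [coe_nnnorm, Real.norm_of_nonneg (by linarith)]; ring
  simp only [sum_const, card_univ, Fintype.card_fin, nsmul_eq_mul]
  push_cast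
  rw [coe_nnnorm] at this
  rw [this]
  field_simp

namespace Training

variable {N M E J : ℕ} {Z : Type*} (T : Training N M E J Z)

/-- Expected loss on the sample `s` for a fresh parameter of round `i`. -/
def meanLoss (η : ℝ) (x : ℕ → (Fin J → Z) × Params E) (i : ℕ) (s : Sample N M E) : ℝ :=
  ∫ θ, T.sampleLoss θ s ∂T.paramLaw η x i

/-- Loss of the parameter `θ` on the batch collected in round `i`. -/
def batchLoss (x : ℕ → (Fin J → Z) × Params E) (i : ℕ) (θ : Params E) : ℝ :=
  (1 / (J : ℝ)) * ∑ j, T.sampleLoss θ (T.gen i (T.param x i) ((x i).1 j))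

/-- Amount by which the expected loss of round `i` exceeds the mean over the batch that is
collected with the noise `a`. -/
def excess [MeasurableSpace Z] (μ : Measure Z) (η : ℝ) (i : ℕ) (x : ℕ → (Fin J → Z) × Params E)
    (a : (Fin J → Z) × Params E) : ℝ :=
  T.roundLoss μ η x i - (1 / (J : ℝ)) * ∑ j, T.meanLoss η x i (T.gen i (T.param x i) (a.1 j))

variable {T}

theorem paramLaw_congr (η : ℝ) {x x' : ℕ → (Fin J → Z) × Params E} {i : ℕ}
    (h : ∀ k < i, x k = x' k) : T.paramLaw η x i = T.paramLaw η x' i := by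
  cases i with
  | zero => rfl
  | succ i => simp only [paramLaw, data, run_congr h]

variable [MeasurableSpace Z]

theorem excess_congr (μ : Measure Z) (η : ℝ) {x x' : ℕ → (Fin J → Z) × Params E} {i : ℕ}
    (h : ∀ k < i, x k = x' k) : T.excess μ η i x = T.excess μ η i x' := by
  have h1 : T.param x i = T.param x' i := by rw [param, param, run_congr h]
  funext a
  simp only [excess, roundLoss, sampleLaw, meanLoss, paramLaw_congr η h, h1]

namespace Assumptions

variable {c : Bounds} {I : ℕ} {G H : ℝ} (hT : T.Assumptions c I G H)
include hT

/-- The measure `paramLaw` itself varies with the noise. Written as an integral over the fixed law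
of the perturbation, the dependence moves into a jointly measurable integrand. -/
theorem measurable_meanLoss {η : ℝ} (hη : 0 < η) (i : ℕ) {X : Type*} [MeasurableSpace X]
    {x : X → ℕ → (Fin J → Z) × Params E} {s : X → Sample N M E} (hx : Measurable x)
    (hs : Measurable s) : Measurable fun q => T.meanLoss η (x q) i (s q) := by
  have := isProbabilityMeasure_perturbLaw E hη
  have hm : ∀ s, StronglyMeasurable fun θ => T.sampleLoss θ s := fun s =>
    (hT.measurable_sampleLoss measurable_id measurable_const).stronglyMeasurable
  cases i with
  | zero =>
    have : (fun q => T.meanLoss η (x q) 0 (s q)) = fun q => T.sampleLoss T.θinit (s q) := by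
      funext q
      exact integral_dirac' _ _ (hm _)
    rw [this]
    exact hT.measurable_sampleLoss measurable_const hs
  | succ i =>
    have : (fun q => T.meanLoss η (x q) (i + 1) (s q)) = fun q =>
        ∫ ψ, T.sampleLoss (T.argmin (i + 1) (T.data (x q) (i + 1)) ψ) (s q) ∂perturbLaw E η := by
      funext q
      exact integral_map (hT.measurable_argmin _ _).aemeasurable (hm _).aestronglyMeasurable
    rw [this]
    have hD : Measurable fun q : X × Params E => T.data (x q.1) (i + 1) :=
      (hT.measurable_data (i + 1)).comp (hx.comp measurable_fst)
    have hθ : Measurable fun q : X × Params E =>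
        T.argmin (i + 1) (T.data (x q.1) (i + 1)) q.2 :=
      (hT.argmin_meas (i + 1)).comp (hD.prodMk measurable_snd)
    have h := hT.measurable_sampleLoss hθ (hs.comp (measurable_fst (β := Params E)))
    exact (StronglyMeasurable.integral_prod_right' h.stronglyMeasurable).measurable

theorem paramLaw_mem {η : ℝ} (x : ℕ → (Fin J → Z) × Params E) (i : ℕ) :
    ∀ᵐ θ ∂T.paramLaw η x i, θ ∈ c.paramSet E := by
  cases i with
  | zero =>
    rw [paramLaw, ae_dirac_iff (p := fun θ => θ ∈ c.paramSet E) (c.measurableSet_paramSet E)]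
    exact hT.init_mem
  | succ i =>
    rw [paramLaw, ae_map_iff (p := fun θ => θ ∈ c.paramSet E)
      (hT.measurable_argmin _ _).aemeasurable (c.measurableSet_paramSet E)]
    exact Filter.Eventually.of_forall fun ψ => hT.argmin_mem _ _ _ (hT.data_admissible x _)

theorem abs_meanLoss_le {η : ℝ} (hη : 0 < η) (x : ℕ → (Fin J → Z) × Params E) (i : ℕ)
    {s : Sample N M E} (hs : c.Admissible s.1) : |T.meanLoss η x i s| ≤ c.BL := by
  have := hT.isProbabilityMeasure_paramLaw hη x i
  have h := norm_integral_le_of_norm_le_const (μ := T.paramLaw η x i)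
    (f := fun θ => T.sampleLoss θ s) (C := c.BL) ((hT.paramLaw_mem x i).mono fun θ hθ => by
      rw [Real.norm_eq_abs]; exact hT.loss_bound θ hθ s hs)
  simpa [meanLoss] using h

theorem integrable_sampleLoss {η : ℝ} (hη : 0 < η) (x : ℕ → (Fin J → Z) × Params E) (i : ℕ)
    {s : Sample N M E} (hs : c.Admissible s.1) :
    Integrable (fun θ => T.sampleLoss θ s) (T.paramLaw η x i) := by
  have := hT.isProbabilityMeasure_paramLaw hη x i
  refine Integrable.of_bound
    (hT.measurable_sampleLoss measurable_id measurable_const).aestronglyMeasurable c.BL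
    ((hT.paramLaw_mem x i).mono fun θ hθ => ?_)
  rw [Real.norm_eq_abs]; exact hT.loss_bound θ hθ s hs

theorem roundLoss_eq (μ : Measure Z) {η : ℝ} (hη : 0 < η) (x : ℕ → (Fin J → Z) × Params E)
    (i : ℕ) : T.roundLoss μ η x i = ∫ z, T.meanLoss η x i (T.gen i (T.param x i) z) ∂μ :=
  integral_map (hT.measurable_gen i _).aemeasurable
    (hT.measurable_meanLoss hη i measurable_const measurable_id).aestronglyMeasurable

theorem measurable_excess (μ : Measure Z) [IsProbabilityMeasure μ] {η : ℝ} (hη : 0 < η) (i : ℕ) :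
    Measurable fun q : (ℕ → (Fin J → Z) × Params E) × ((Fin J → Z) × Params E) =>
      T.excess μ η i q.1 q.2 := by
  have hgen : ∀ {X : Type _} [MeasurableSpace X] {x : X → ℕ → (Fin J → Z) × Params E} {z : X → Z},
      Measurable x → Measurable z →
      Measurable fun q => T.meanLoss η (x q) i (T.gen i (T.param (x q) i) (z q)) :=
    fun hx hz => hT.measurable_meanLoss hη i hx
      ((hT.gen_meas i).comp (((hT.measurable_param i).comp hx).prodMk hz))
  have h1 : Measurable fun x : ℕ → (Fin J → Z) × Params E => T.roundLoss μ η x i := by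
    simp_rw [hT.roundLoss_eq μ hη]
    exact (StronglyMeasurable.integral_prod_right'
      (hgen measurable_fst measurable_snd).stronglyMeasurable).measurable
  refine (h1.comp measurable_fst).sub ((Finset.measurable_sum _ fun j _ => ?_).const_mul _)
  exact hgen measurable_fst ((measurable_pi_apply j).comp (measurable_fst.comp measurable_snd))

/-- With the past `x` frozen, the samples are i.i.d. and `roundLoss` is the mean of `meanLoss` over
one of them, so Hoeffding's bound applies. The perturbation in the noise `a` plays no role and is
projected away. -/
theorem lintegral_exp_excess_le (μ : Measure Z) [IsProbabilityMeasure μ] {η : ℝ} (hη : 0 < η)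
    (hJ : 0 < J) (l : ℝ) (i : ℕ) (x : ℕ → (Fin J → Z) × Params E) :
    ∫⁻ a, ENNReal.ofReal (Real.exp (l * T.excess μ η i x a)) ∂roundLaw E J μ η ≤
      ENNReal.ofReal (Real.exp (l ^ 2 * c.BL ^ 2 / (2 * J))) := by
  have := isProbabilityMeasure_perturbLaw E hη
  have hu : Measurable fun z => T.meanLoss η x i (T.gen i (T.param x i) z) :=
    hT.measurable_meanLoss hη i measurable_const (hT.measurable_gen i _)
  refine le_trans (le_of_eq ?_) (lintegral_exp_sampleMean_le μ hJ hu
    (fun z => hT.abs_meanLoss_le hη x i (hT.gen_admissible x i z)) l)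
  have hp : MeasurePreserving Prod.fst (roundLaw E J μ η) (Measure.pi fun _ : Fin J => μ) :=
    measurePreserving_fst
  rw [← hp.lintegral_comp]
  · simp only [excess, hT.roundLoss_eq μ hη]
  · have h : ∀ j, Measurable fun z : Fin J → Z =>
        T.meanLoss η x i (T.gen i (T.param x i) (z j)) :=
      fun j => hu.comp (measurable_pi_apply j)
    fun_prop

theorem BL_nonneg : 0 ≤ c.BL := by
  refine (abs_nonneg _).trans (hT.loss_bound _ hT.init_mem ((0, 0), true) ⟨?_, ?_⟩) <;>
    intros <;> simpa using hT.Bx_nonneg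

/-- The Azuma-Hoeffding inequality for the losses of the batches. -/
theorem measure_sum_excess_ge_le (μ : Measure Z) [IsProbabilityMeasure μ] {η : ℝ} (hη : 0 < η)
    (hJ : 0 < J) {n : ℕ} (hn : 0 < n) {s : ℝ} (hs : 0 < s) :
    (Measure.infinitePi fun _ : ℕ => roundLaw E J μ η)
      {x | c.BL * √(2 * n * s / J) < ∑ i ∈ range n, T.excess μ η i x (x i)} ≤
      ENNReal.ofReal (Real.exp (-s)) := by
  have := isProbabilityMeasure_perturbLaw E hη
  have : IsProbabilityMeasure (roundLaw E J μ η) := by unfold roundLaw; infer_instance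
  have hJ' : (0 : ℝ) < J := by exact_mod_cast hJ
  have hn' : (0 : ℝ) < n := by exact_mod_cast hn
  -- The exponent chosen below divides by `c.BL`; when it is zero all mean losses vanish and the
  -- event is empty.
  rcases hT.BL_nonneg.eq_or_lt with hB | hB
  · have h0 : ∀ i x z, T.meanLoss η x i (T.gen i (T.param x i) z) = 0 := fun i x z =>
      abs_nonpos_iff.1 (hB ▸ hT.abs_meanLoss_le hη x i (hT.gen_admissible x i z))
    have : {x : ℕ → (Fin J → Z) × Params E |
        c.BL * √(2 * n * s / J) < ∑ i ∈ range n, T.excess μ η i x (x i)} = ∅ := by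
      ext x
      simp [excess, hT.roundLoss_eq μ hη, h0, ← hB]
    rw [this]
    simp
  · set r := √(2 * n * s / J) with hr
    have hr0 : 0 < r := Real.sqrt_pos.2 (by positivity)
    have hr2 : r ^ 2 = 2 * n * s / J := Real.sq_sqrt (by positivity)
    -- The optimal Chernoff exponent: the moment bound becomes `exp s` and the threshold `exp (2s)`.
    set l := r * J / (n * c.BL) with hl
    have hl0 : 0 < l := by positivity
    have h := lintegral_exp_sum_le (roundLaw E J μ η) (F := fun i => T.excess μ η i)
      (fun i => hT.measurable_excess μ hη i) (fun i x x' h => excess_congr μ η h)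
      (l := l) (fun i x => hT.lintegral_exp_excess_le μ hη hJ l i x) n
    have hSm : Measurable fun x : ℕ → (Fin J → Z) × Params E =>
        ∑ i ∈ range n, T.excess μ η i x (x i) :=
      Finset.measurable_sum _ fun i _ =>
        (hT.measurable_excess μ hη i).comp (measurable_id.prodMk (measurable_pi_apply i))
    have hmk := meas_ge_le_lintegral_div (μ := Measure.infinitePi fun _ : ℕ => roundLaw E J μ η)
      (f := fun x => ENNReal.ofReal (Real.exp (l * ∑ i ∈ range n, T.excess μ η i x (x i))))
      (hSm.const_mul l).exp.ennreal_ofReal.aemeasurable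
      (ε := ENNReal.ofReal (Real.exp (l * (c.BL * r))))
      (by simpa using Real.exp_pos _) ENNReal.ofReal_ne_top
    calc _ ≤ _ := measure_mono fun x hx => ?_
      _ ≤ _ := hmk
      _ ≤ _ := ENNReal.div_le_div_right h _
      _ = _ := ?_
    · simp only [Set.mem_ofPred_eq] at hx ⊢
      gcongr
    · rw [← ENNReal.ofReal_div_of_pos (Real.exp_pos _), ← Real.exp_sub]
      congr 2
      have : l * (c.BL * r) = 2 * s := by
        rw [hl]; field_simp; rw [hr2]; field_simp
      have h2 : (n : ℝ) * (l ^ 2 * c.BL ^ 2 / (2 * J)) = s := by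
        rw [hl]; field_simp; rw [hr2]; field_simp
      rw [this, h2]; ring

end Assumptions

end Training

/-! ## The expected loss of the returned parameter -/

/-- The rate of the exponential perturbation. -/
def perturbRate (I : ℕ) : ℝ := max 1 ((I : ℝ) ^ (1 / 3 : ℝ))

/-- The constant in the regret bound. -/
def regretConst (E : ℕ) (G H : ℝ) : ℝ :=
  Fintype.card (Coord E) * |H| + |G| * (Fintype.card (Coord E) * |H|) +
    |G| * Fintype.card (Coord E) * (1 + 2 * |G| * Fintype.card (Coord E)) * |H| * 2

theorem perturbRate_pos (I : ℕ) : 0 < perturbRate I := lt_max_of_lt_left one_pos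

namespace Training

variable {N M E J : ℕ} {Z : Type*} {T : Training N M E J Z}

theorem g_data_eq (x : ℕ → (Fin J → Z) × Params E) (n : ℕ) (θ : Params E) :
    T.g (T.data x n) θ = runningMean (T.batchLoss x) n θ := by
  rw [g, runningMean, Finset.sum_range]
  simp only [data_apply, batchLoss]

variable [MeasurableSpace Z]

namespace Assumptions

variable {c : Bounds} {I : ℕ} {G H : ℝ} (hT : T.Assumptions c I G H)
include hT

/-- The loss of a single batch is the aggregated loss of a one-round history, so the Lipschitz
assumption for `i = 1` covers every round. -/
theorem abs_batchLoss_sub_le (hI : 0 < I) (x : ℕ → (Fin J → Z) × Params E) (t : ℕ) {θ θ' : Params E}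
    (hθ : θ ∈ c.paramSet E) (hθ' : θ' ∈ c.paramSet E) :
    |T.batchLoss x t θ - T.batchLoss x t θ'| ≤ |G| * ∑ a, |θ a - θ' a| := by
  have h := hT.g_lip 1 le_rfl hI (fun _ j => T.gen t (T.param x t) ((x t).1 j))
    (fun _ j => hT.gen_admissible x t _) θ hθ θ' hθ'
  simp only [g, univ_unique, sum_singleton, Nat.cast_one, div_one, one_mul] at h
  refine h.trans ?_
  gcongr
  exact le_abs_self G

theorem measurable_batchLoss (x : ℕ → (Fin J → Z) × Params E) (t : ℕ) :
    Measurable (T.batchLoss x t) :=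
  (Finset.measurable_sum _ fun _ _ =>
    hT.measurable_sampleLoss measurable_id measurable_const).const_mul _

theorem isLeader_argmin (x : ℕ → (Fin J → Z) × Params E) (n : ℕ) :
    IsLeader (c.paramSet E) (runningMean (T.batchLoss x) (n + 1))
      (T.argmin (n + 1) (T.data x (n + 1))) := by
  refine ⟨hT.measurable_argmin _ _, fun ψ => hT.argmin_mem _ _ _ (hT.data_admissible x _),
    fun ψ θ hθ => ?_⟩
  rw [← g_data_eq, ← g_data_eq]
  exact hT.argmin_min _ _ _ (hT.data_admissible x _) θ hθ

theorem integral_batchLoss {η : ℝ} (hη : 0 < η) (x : ℕ → (Fin J → Z) × Params E) (t : ℕ) :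
    ∫ θ, T.batchLoss x t θ ∂T.paramLaw η x t =
      (1 / (J : ℝ)) * ∑ j, T.meanLoss η x t (T.gen t (T.param x t) ((x t).1 j)) := by
  simp only [batchLoss, meanLoss]
  rw [integral_const_mul, integral_finsetSum _ fun j _ =>
    hT.integrable_sampleLoss hη x t (hT.gen_admissible x t _)]

/-- With `η = I^(1/3)`, both `I/η` and `√(η I)` equal `I^(2/3)`, and the constant cost of the first
round is at most a multiple of it. The bound holds for every realization of the noise. -/
theorem mean_integral_batchLoss_le (hI : 0 < I) (x : ℕ → (Fin J → Z) × Params E) {θ : Params E}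
    (hθ : θ ∈ c.paramSet E) :
    (1 / (I : ℝ)) * ∑ t ∈ range I, ∫ θ, T.batchLoss x t θ ∂T.paramLaw (perturbRate I) x t ≤
      (1 / (I : ℝ)) * ∑ t ∈ range I, T.batchLoss x t θ +
        regretConst E G H / (I : ℝ) ^ (1 / 3 : ℝ) := by
  have hI' : (1 : ℝ) ≤ I := by exact_mod_cast hI
  have h := perturbed_leader_regret (perturbRate_pos I) (abs_nonneg G) (abs_nonneg H)
    (hT.measurable_batchLoss x) (fun t θ hθ θ' hθ' => hT.abs_batchLoss_sub_le hI x t hθ hθ')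
    (fun θ hθ θ' hθ' k => (hT.diam θ hθ θ' hθ' k).trans (le_abs_self H))
    (a := fun n => T.argmin n (T.data x n)) (hT.isLeader_argmin x) hT.init_mem
    (κ := T.paramLaw (perturbRate I) x) rfl (fun n => rfl) I hθ
  set r : ℝ := (I : ℝ) ^ (1 / 3 : ℝ) with hr
  have hr1 : 1 ≤ r := Real.one_le_rpow hI' (by norm_num)
  have hr0 : 0 < r := by linarith
  have hr3 : (I : ℝ) = r ^ 3 := by
    rw [hr, ← Real.rpow_natCast, ← Real.rpow_mul (by linarith)]; norm_num
  have hη : perturbRate I = r := max_eq_right hr1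
  have hsq : √r * √(I : ℝ) = r ^ 2 := by
    rw [← Real.sqrt_mul hr0.le, hr3, show r * r ^ 3 = (r ^ 2) ^ 2 by ring,
      Real.sqrt_sq (by positivity)]
  rw [hη] at h ⊢
  set d : ℝ := (Fintype.card (Coord E) : ℝ) with hd
  have hd0 : 0 ≤ d := by positivity
  set A := |G| * (d * |H|) with hA
  have hA0 : 0 ≤ A := by positivity
  have hIpos : (0 : ℝ) < I := by linarith
  rw [one_div, inv_mul_le_iff₀ hIpos, mul_add, ← mul_assoc, mul_inv_cancel₀ hIpos.ne', one_mul]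
  refine h.trans ?_
  have h1 : |G| * d * (1 + 2 * |G| * d) * |H| * √r * (2 * √(I : ℝ)) =
      |G| * d * (1 + 2 * |G| * d) * |H| * 2 * r ^ 2 := by rw [← hsq]; ring
  have h2 : (I : ℝ) * (d * |H| / r) = d * |H| * r ^ 2 := by rw [hr3]; field_simp
  have h3 : (I : ℝ) * (regretConst E G H / r) = regretConst E G H * r ^ 2 := by
    rw [hr3]; field_simp
  rw [h1, h2, h3, regretConst, ← hd, ← hA]
  have h4 : A ≤ A * r ^ 2 := le_mul_of_one_le_right hA0 (one_le_pow₀ hr1)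
  linarith

/-- The last term of the gap suffices: `log (4/δ) ≥ log 2 ≥ 2/9` makes it at least `c.BL / √J`. The
other two terms are only used to be nonnegative. -/
theorem BL_mul_sqrt_le_gap (hJ : 0 < J) {n : ℕ} (hn : 0 < n) (U D : ℕ) {δ : ℝ} (hδ : 0 < δ)
    (hδ1 : δ < 1) :
    (1 / (n : ℝ)) * (c.BL * √(2 * n * Real.log (2 / δ) / J)) ≤
      c.gap E U D (δ / 2) J * √(2 * Real.log (2 / δ) / n) := by
  have hJ' : (0 : ℝ) < J := by exact_mod_cast hJ
  have hn' : (0 : ℝ) < n := by exact_mod_cast hn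
  have hB := hT.BL_nonneg
  have hCL := hT.CL_nonneg
  have hgap : c.BL / √J ≤ c.gap E U D (δ / 2) J := by
    have h1 : 0 ≤ 8 * c.CL / J := by positivity
    have h2 : 0 ≤ 24 * c.CL * c.BL / √J * √((3 * (E : ℝ) ^ 2 + E) * Real.log (c.Lam E U D J)) := by
      positivity
    have h3 : c.BL / √J ≤ 3 * c.BL * √(Real.log (2 / (δ / 2)) / (2 * J)) := by
      have h4 : (1 : ℝ) / 9 ≤ Real.log (2 / (δ / 2)) / 2 := by
        have h5 : Real.log 2 ≤ Real.log (2 / (δ / 2)) := by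
          refine Real.log_le_log (by norm_num) ?_
          rw [le_div_iff₀ (by positivity)]; linarith
        linarith [Real.log_two_gt_d9]
      have h6 : 1 / 3 * (1 / √J) ≤ √(Real.log (2 / (δ / 2)) / (2 * J)) := by
        refine Real.le_sqrt_of_sq_le ?_
        rw [mul_pow, div_pow _ (√(J : ℝ)), Real.sq_sqrt hJ'.le]
        calc (1 / 3 : ℝ) ^ 2 * (1 ^ 2 / (J : ℝ)) = (1 / 9) / J := by ring
          _ ≤ (Real.log (2 / (δ / 2)) / 2) / J := by gcongr
          _ = _ := by field_simp
      calc c.BL / √J = 3 * c.BL * (1 / 3 * (1 / √J)) := by ring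
        _ ≤ _ := by gcongr
    unfold Bounds.gap
    linarith
  have hlog : 0 ≤ Real.log (2 / δ) := Real.log_nonneg (by rw [le_div_iff₀ hδ]; linarith)
  have heq : (1 / (n : ℝ)) * (c.BL * √(2 * n * Real.log (2 / δ) / J)) =
      c.BL / √J * √(2 * Real.log (2 / δ) / n) := by
    rw [Real.sqrt_div' _ hJ'.le, Real.sqrt_div' _ hn'.le,
      show 2 * (n : ℝ) * Real.log (2 / δ) = n * (2 * Real.log (2 / δ)) by ring,
      Real.sqrt_mul hn'.le]
    have h1 : √(n : ℝ) ≠ 0 := (Real.sqrt_pos.2 hn').ne'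
    have h2 : √(n : ℝ) ^ 2 = n := Real.sq_sqrt hn'.le
    field_simp
    rw [h2]
    ring
  rw [heq]
  gcongr

/-- The minimum is at most the mean, which splits into the mean excess and the mean loss on the
collected batches. The first is controlled outside an event of probability at most `δ/2` (deviation
parameter `log (2/δ)`), the second by the regret against the `θ` that realizes `ν`. -/
theorem roundLoss_best_le (hI : 0 < I) (hJ : 0 < J) (μ : Measure Z) [IsProbabilityMeasure μ]
    {Ω : Type*} [MeasurableSpace Ω] {P : Measure Ω} [IsProbabilityMeasure P]
    {X : ℕ → Ω → (Fin J → Z) × Params E} (hX : ∀ i, Measurable (X i))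
    (hlaw : ∀ i, P.map (X i) = roundLaw E J μ (perturbRate I)) (hind : iIndepFun X P)
    {best : Ω → ℕ} (hbest : ∀ ω, ∀ i < I, T.roundLoss μ (perturbRate I) (fun k => X k ω) (best ω) ≤
      T.roundLoss μ (perturbRate I) (fun k => X k ω) i)
    {ν δ : ℝ} (hδ : 0 < δ) (hδ1 : δ < 1)
    (hν : ∀ᵐ ω ∂P, ∃ θ ∈ c.paramSet E,
      (1 / (I * J : ℝ)) * ∑ i, ∑ j, T.sampleLoss θ (T.data (fun k => X k ω) I i j) ≤ ν) (U : ℕ) :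
    ENNReal.ofReal (1 - δ) ≤
      P {ω | T.roundLoss μ (perturbRate I) (fun k => X k ω) (best ω) ≤
        ν + regretConst E G H / (I : ℝ) ^ (1 / 3 : ℝ)
          + c.gap E U T.depth (δ / 2) J * √(2 * Real.log (2 / δ) / I)} := by
  have hη := perturbRate_pos I
  set η := perturbRate I
  have hI' : (0 : ℝ) < I := by exact_mod_cast hI
  set good := {ω | T.roundLoss μ η (fun k => X k ω) (best ω) ≤
        ν + regretConst E G H / (I : ℝ) ^ (1 / 3 : ℝ)
          + c.gap E U T.depth (δ / 2) J * √(2 * Real.log (2 / δ) / I)} with hgood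
  set bad := {x : ℕ → (Fin J → Z) × Params E |
    c.BL * √(2 * I * Real.log (2 / δ) / J) < ∑ i ∈ range I, T.excess μ η i x (x i)} with hbad
  have hmap : P.map (fun ω k => X k ω) = Measure.infinitePi fun _ : ℕ => roundLaw E J μ η := by
    rw [hind.map_fun_eq_infinitePi_map hX]
    simp_rw [hlaw]
  have hlogpos : 0 < Real.log (2 / δ) := Real.log_pos (by rw [lt_div_iff₀ hδ]; linarith)
  have hbadP : P ((fun ω k => X k ω) ⁻¹' bad) ≤ ENNReal.ofReal δ := by
    calc _ ≤ P.map (fun ω k => X k ω) bad :=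
          Measure.le_map_apply (measurable_pi_iff.2 hX).aemeasurable _
      _ ≤ ENNReal.ofReal (Real.exp (-Real.log (2 / δ))) := by
          rw [hmap]; exact hT.measure_sum_excess_ge_le μ hη hJ hI hlogpos
      _ ≤ ENNReal.ofReal δ := by
          refine ENNReal.ofReal_le_ofReal ?_
          rw [Real.exp_neg, Real.exp_log (by positivity), inv_div]
          linarith
  have hcompl : P goodᶜ ≤ P ((fun ω k => X k ω) ⁻¹' bad) := by
    refine measure_mono_ae (hν.mono fun ω hω hg => ?_)
    obtain ⟨θ, hθ, hle⟩ := hω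
    by_contra hnb
    refine hg ?_
    set x := fun k => X k ω with hx
    have hnb : ∑ i ∈ range I, T.excess μ η i x (x i) ≤ c.BL * √(2 * I * Real.log (2 / δ) / J) :=
      not_lt.1 hnb
    have h1 := hT.mean_integral_batchLoss_le hI x hθ
    have h2 : (1 / (I : ℝ)) * ∑ t ∈ range I, T.batchLoss x t θ ≤ ν := by
      refine le_trans (le_of_eq ?_) hle
      rw [Finset.sum_range]
      simp only [data_apply, batchLoss]
      rw [← mul_sum, ← mul_assoc]
      congr 1
      field_simp
    have h3 : T.roundLoss μ η x (best ω) ≤ (1 / (I : ℝ)) * ∑ i ∈ range I, T.roundLoss μ η x i := by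
      have h4 := sum_le_sum fun i (hi : i ∈ range I) => hbest ω i (mem_range.1 hi)
      rw [sum_const, card_range, nsmul_eq_mul] at h4
      rw [one_div, le_inv_mul_iff₀ hI']
      exact h4
    have h5 : ∑ i ∈ range I, T.roundLoss μ η x i =
        ∑ i ∈ range I, T.excess μ η i x (x i) +
          ∑ t ∈ range I, ∫ θ, T.batchLoss x t θ ∂T.paramLaw η x t := by
      rw [← sum_add_distrib]
      refine sum_congr rfl fun i _ => ?_
      rw [hT.integral_batchLoss hη, excess]
      ring
    have h6 := hT.BL_mul_sqrt_le_gap hJ hI U T.depth hδ hδ1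
    have h7 := mul_le_mul_of_nonneg_left hnb (show 0 ≤ 1 / (I : ℝ) by positivity)
    rw [h5, mul_add] at h3
    show T.roundLoss μ η x (best ω) ≤ _
    linarith
  -- `best` is an arbitrary function, so the good event need not be measurable; subadditivity of the
  -- outer measure is enough.
  have huniv : (1 : ℝ≥0∞) ≤ P good + P goodᶜ := by
    rw [← measure_univ (μ := P), ← Set.union_compl_self good]
    exact measure_union_le _ _
  rw [ENNReal.ofReal_sub _ hδ.le, ENNReal.ofReal_one, tsub_le_iff_right]
  exact huniv.trans (add_le_add_right (hcompl.trans hbadP) _)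

end Assumptions

end Training

/-! ## Accuracy of the classifier -/

theorem Bounds.measurableSet_admissible (c : Bounds) (N M E : ℕ) :
    MeasurableSet {φ : Features N M E | c.Admissible φ} := by
  have : {φ : Features N M E | c.Admissible φ} =
      (⋂ u, {φ | ‖φ.1 u‖ ≤ c.Bx}) ∩ ⋂ n, ⋂ m, {φ | ‖φ.2 n m‖ ≤ c.Bx} := by
    ext φ; simp [Bounds.Admissible]
  rw [this]
  refine (MeasurableSet.iInter fun u => measurableSet_le ?_ measurable_const).inter
    (MeasurableSet.iInter fun n => MeasurableSet.iInter fun m =>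
      measurableSet_le ?_ measurable_const)
  · exact ((measurable_pi_apply u).comp measurable_fst).norm
  · exact ((measurable_pi_apply m).comp ((measurable_pi_apply n).comp measurable_snd)).norm

/-- A uniform threshold falls below `g` with probability `g` and above it with probability `1 - g`;
the logistic loss is minus the logarithm of the probability of the label. -/
theorem volume_restrict_Icc_decide_le {g : ℝ} (hg : g ∈ Set.Ioo (0 : ℝ) 1) (y : Bool) :
    (volume.restrict (Set.Icc (0 : ℝ) 1)) {r | decide (r ≤ g) = y} =
      ENNReal.ofReal (Real.exp (-logisticLoss g y)) := by
  cases y with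
  | true =>
    have h : {r : ℝ | decide (r ≤ g) = true} = Set.Iic g := by ext r; simp
    have h2 : Set.Iic g ∩ Set.Icc 0 1 = Set.Icc 0 g := by
      ext r
      simp only [Set.mem_inter_iff, Set.mem_Iic, Set.mem_Icc]
      have := hg.2
      exact ⟨fun h => ⟨h.2.1, h.1⟩, fun h => ⟨h.2, h.1, by linarith⟩⟩
    rw [h, Measure.restrict_apply measurableSet_Iic, h2, Real.volume_Icc]
    simp [logisticLoss, Real.exp_log hg.1]
  | false =>
    have h : {r : ℝ | decide (r ≤ g) = false} = Set.Ioi g := by ext r; simp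
    have h2 : Set.Ioi g ∩ Set.Icc 0 1 = Set.Ioc g 1 := by
      ext r
      simp only [Set.mem_inter_iff, Set.mem_Ioi, Set.mem_Icc, Set.mem_Ioc]
      have := hg.1
      exact ⟨fun h => ⟨h.1, h.2.2⟩, fun h => ⟨h.1, by linarith, h.2⟩⟩
    rw [h, Measure.restrict_apply measurableSet_Ioi, h2, Real.volume_Ioc]
    simp [logisticLoss, Real.exp_log (sub_pos.2 hg.2)]

namespace Training

variable {N M E J : ℕ} {Z : Type*} {T : Training N M E J Z} [MeasurableSpace Z]

namespace Assumptions

variable {c : Bounds} {I : ℕ} {G H : ℝ} (hT : T.Assumptions c I G H)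
include hT

theorem measurable_classify {X : Type*} [MeasurableSpace X] {θ : X → Params E} {r : X → ℝ}
    {φ : X → Features N M E} (hθ : Measurable θ) (hr : Measurable r) (hφ : Measurable φ) :
    Measurable fun x => T.classify (θ x) (r x) (φ x) := by
  refine measurable_to_bool ?_
  have : (fun x => T.classify (θ x) (r x) (φ x)) ⁻¹' {true} =
      {x | r x ≤ gnn T.ξ T.depth (θ x) (φ x)} := by
    ext x; simp [classify]
  rw [this]
  exact measurableSet_le hr (measurable_gnn hT.continuous_ξ T.depth hθ hφ)

theorem measurableSet_correct :
    MeasurableSet {q : Sample N M E × Params E × ℝ | T.classify q.2.1 q.2.2 q.1.1 = q.1.2} :=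
  measurableSet_eq_fun (hT.measurable_classify (measurable_snd.fst) (measurable_snd.snd)
    measurable_fst.fst) measurable_fst.snd

theorem accuracy_dirac (φ : Features N M E) (y : Bool) (κ : Measure (Params E))
    [IsProbabilityMeasure κ] (τ : Measure ℝ) [IsProbabilityMeasure τ] :
    T.accuracy (Measure.dirac (φ, y)) κ τ =
      (κ.prod τ).real {a | T.classify a.1 a.2 φ = y} := by
  rw [accuracy, measureReal_def, measureReal_def, Measure.dirac_prod,
    Measure.map_apply measurable_prodMk_left hT.measurableSet_correct]
  rfl

theorem sampleLaw_admissible (μ : Measure Z) (x : ℕ → (Fin J → Z) × Params E) (i : ℕ) :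
    ∀ᵐ s ∂T.sampleLaw μ x i, c.Admissible s.1 := by
  rw [sampleLaw, ae_map_iff (p := fun s : Sample N M E => c.Admissible s.1)
    (hT.measurable_gen i _).aemeasurable
    (measurable_fst (c.measurableSet_admissible N M E))]
  exact Filter.Eventually.of_forall fun z => hT.gen_admissible x i z

/-- Accuracy from the logistic loss, by Jensen's inequality. -/
theorem exp_neg_expectedLoss_le (hN : 0 < N) (hloss : T.loss = logisticLoss)
    {p : Measure (Sample N M E)} [IsProbabilityMeasure p] (hp : ∀ᵐ s ∂p, c.Admissible s.1)
    {κ : Measure (Params E)} [IsProbabilityMeasure κ] (hκ : ∀ᵐ θ ∂κ, θ ∈ c.paramSet E) :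
    Real.exp (-T.expectedLoss p κ) ≤
      T.accuracy p κ (volume.restrict (Set.Icc (0 : ℝ) 1)) := by
  set f : Sample N M E × Params E → ℝ := fun q => T.sampleLoss q.2 q.1 with hf
  have hfm : Measurable f := hT.measurable_sampleLoss measurable_snd measurable_fst
  have hbound : ∀ᵐ q ∂p.prod κ, ‖f q‖ ≤ c.BL := by
    filter_upwards [Measure.quasiMeasurePreserving_fst.ae hp,
      Measure.quasiMeasurePreserving_snd.ae hκ] with q h1 h2
    exact hT.loss_bound _ h2 _ h1
  have hint : Integrable f (p.prod κ) := Integrable.of_bound hfm.aestronglyMeasurable c.BL hbound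
  have hexpint : Integrable (fun q => Real.exp (-f q)) (p.prod κ) :=
    Integrable.of_bound hfm.neg.exp.aestronglyMeasurable (Real.exp c.BL)
      (hbound.mono fun q hq => by
        rw [Real.norm_of_nonneg (Real.exp_pos _).le, Real.exp_le_exp]
        exact (neg_le_abs _).trans hq)
  have hem : Measurable fun q => Real.exp (-f q) := hfm.neg.exp
  have hexp : T.expectedLoss p κ = ∫ q, f q ∂p.prod κ := (integral_prod f hint).symm
  have hacc : T.accuracy p κ (volume.restrict (Set.Icc (0 : ℝ) 1)) =
      ∫ q, Real.exp (-f q) ∂p.prod κ := by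
    rw [accuracy, measureReal_def, Measure.prod_apply hT.measurableSet_correct,
      integral_eq_lintegral_of_nonneg_ae (Filter.Eventually.of_forall fun q => (Real.exp_pos _).le)
        hem.aestronglyMeasurable, lintegral_prod _ hem.ennreal_ofReal.aemeasurable]
    congr 1
    refine lintegral_congr fun s => ?_
    rw [Measure.prod_apply (measurable_prodMk_left hT.measurableSet_correct)]
    refine lintegral_congr fun θ => ?_
    have := volume_restrict_Icc_decide_le (gnn_mem_Ioo (ξ := T.ξ) hN T.depth θ s.1) s.2
    rw [← hloss] at this
    exact this
  rw [hexp, hacc, ← integral_neg]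
  exact convexOn_exp.map_integral_le Real.continuous_exp.continuousOn isClosed_univ
    (Filter.Eventually.of_forall fun _ => Set.mem_univ _) hint.neg hexpint

end Assumptions

end Training

/-! ## Nodes of the search tree -/

namespace BBNode

variable {N L : ℕ}

/-- Valid nodes that are leaves or have strictly fewer decisions of each kind than a leaf. -/
def Closed (L : ℕ) (n : BBNode N) : Prop :=
  n.Valid L ∧ (n.IsLeaf L ∨ (n.A.card < L ∧ n.B.card < N - L))

/-- The decisions made at the node agree with `Aopt`. -/
def Relevant (Aopt : Finset (Fin N)) (n : BBNode N) : Prop := n.A ⊆ Aopt ∧ n.B ⊆ univ \ Aopt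

theorem label_eq_true_iff {Aopt : Finset (Fin N)} {n : BBNode N} :
    n.label Aopt = true ↔ n.Relevant Aopt := by simp [label, Relevant]

theorem card_univ_sdiff (A : Finset (Fin N)) : (univ \ A).card = N - A.card := by
  rw [Finset.card_univ_sdiff, Fintype.card_fin]

theorem Valid.close_closed {n : BBNode N} (h : n.Valid L) (hL : L ≤ N) : (n.close L).Closed L := by
  obtain ⟨hd, hA, hB⟩ := h
  unfold close
  split_ifs with h1 h2
  · refine ⟨⟨disjoint_sdiff, h1.le, ?_⟩, Or.inl ⟨h1, ?_⟩⟩ <;> simp [card_univ_sdiff, h1]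
  · refine ⟨⟨sdiff_disjoint, ?_, h2.le⟩, Or.inl ⟨?_, h2⟩⟩ <;>
      simp only [card_univ_sdiff, h2] <;> omega
  · exact ⟨⟨hd, hA, hB⟩, Or.inr ⟨lt_of_le_of_ne hA h1, lt_of_le_of_ne hB h2⟩⟩

theorem Valid.subset_close {n : BBNode N} (h : n.Valid L) :
    n.A ⊆ (n.close L).A ∧ n.B ⊆ (n.close L).B := by
  unfold close
  split_ifs with h1 h2
  · exact ⟨Subset.rfl, subset_sdiff.2 ⟨subset_univ _, h.1.symm⟩⟩
  · exact ⟨subset_sdiff.2 ⟨subset_univ _, h.1⟩, Subset.rfl⟩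
  · exact ⟨Subset.rfl, Subset.rfl⟩

/-- Once `L` antennas of `Aopt` are included, they are all of `Aopt`, and likewise for the
complement, so the completion makes no wrong decision. -/
theorem Relevant.close {Aopt : Finset (Fin N)} {n : BBNode N} (h : n.Relevant Aopt)
    (hcard : Aopt.card = L) : (n.close L).Relevant Aopt := by
  unfold BBNode.close
  split_ifs with h1 h2
  · have : n.A = Aopt := eq_of_subset_of_card_le h.1 (by omega)
    exact ⟨h.1, by rw [this]⟩
  · have : n.B = univ \ Aopt :=
      eq_of_subset_of_card_le h.2 (by rw [card_univ_sdiff]; omega)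
    refine ⟨?_, h.2⟩
    simp [this]
  · exact h

theorem undecided_close_subset {n : BBNode N} (h : n.Valid L) :
    (n.close L).undecided ⊆ n.undecided := by
  obtain ⟨h1, h2⟩ := h.subset_close
  exact sdiff_subset_sdiff Subset.rfl (union_subset_union h1 h2)

theorem mem_undecided {n : BBNode N} {v : Fin N} : v ∈ n.undecided ↔ v ∉ n.A ∧ v ∉ n.B := by
  simp [undecided]

theorem Closed.card_lt {n : BBNode N} (h : n.Closed L) (hl : ¬ n.IsLeaf L) :
    n.A.card < L ∧ n.B.card < N - L := h.2.resolve_left hl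

theorem Closed.undecided_nonempty {n : BBNode N} (h : n.Closed L) (hl : ¬ n.IsLeaf L) :
    n.undecided.Nonempty := by
  obtain ⟨h1, h2⟩ := h.card_lt hl
  rw [← card_pos, undecided, card_univ_sdiff, card_union_of_disjoint h.1.1]
  omega

/-- The child that excludes `v`, before completion to a leaf. -/
def preLeft (n : BBNode N) (v : Fin N) : BBNode N := ⟨n.A, insert v n.B, n.level + 1⟩

/-- The child that includes `v`, before completion to a leaf. -/
def preRight (n : BBNode N) (v : Fin N) : BBNode N := ⟨insert v n.A, n.B, n.level + 1⟩

theorem Closed.valid_preLeft {n : BBNode N} (h : n.Closed L) (hl : ¬ n.IsLeaf L) {v : Fin N}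
    (hv : v ∈ n.undecided) : (n.preLeft v).Valid L := by
  obtain ⟨h1, h2⟩ := h.card_lt hl
  obtain ⟨hA, hB⟩ := mem_undecided.1 hv
  refine ⟨?_, h1.le, ?_⟩
  · exact disjoint_insert_right.2 ⟨hA, h.1.1⟩
  · simp only [preLeft, card_insert_of_notMem hB]; omega

theorem Closed.valid_preRight {n : BBNode N} (h : n.Closed L) (hl : ¬ n.IsLeaf L) {v : Fin N}
    (hv : v ∈ n.undecided) : (n.preRight v).Valid L := by
  obtain ⟨h1, h2⟩ := h.card_lt hl
  obtain ⟨hA, hB⟩ := mem_undecided.1 hv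
  refine ⟨?_, ?_, h2.le⟩
  · exact disjoint_insert_left.2 ⟨hB, h.1.1⟩
  · simp only [preRight, card_insert_of_notMem hA]; omega

theorem Closed.left {n : BBNode N} (h : n.Closed L) (hL : L ≤ N) (hl : ¬ n.IsLeaf L) {v : Fin N}
    (hv : v ∈ n.undecided) : (n.left L v).Closed L := (h.valid_preLeft hl hv).close_closed hL

theorem Closed.right {n : BBNode N} (h : n.Closed L) (hL : L ≤ N) (hl : ¬ n.IsLeaf L) {v : Fin N}
    (hv : v ∈ n.undecided) : (n.right L v).Closed L := (h.valid_preRight hl hv).close_closed hL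

theorem Closed.card_undecided_left_lt {n : BBNode N} (h : n.Closed L) (hl : ¬ n.IsLeaf L)
    {v : Fin N} (hv : v ∈ n.undecided) : (n.left L v).undecided.card < n.undecided.card := by
  have h1 : (n.preLeft v).undecided ⊆ n.undecided :=
    sdiff_subset_sdiff Subset.rfl (union_subset_union Subset.rfl (subset_insert v n.B))
  refine card_lt_card (Finset.ssubset_of_subset_of_ssubset
    (undecided_close_subset (h.valid_preLeft hl hv)) ((ssubset_iff_of_subset h1).2 ⟨v, hv, ?_⟩))
  simp [mem_undecided, preLeft]

theorem Closed.card_undecided_right_lt {n : BBNode N} (h : n.Closed L) (hl : ¬ n.IsLeaf L)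
    {v : Fin N} (hv : v ∈ n.undecided) : (n.right L v).undecided.card < n.undecided.card := by
  have h1 : (n.preRight v).undecided ⊆ n.undecided :=
    sdiff_subset_sdiff Subset.rfl (union_subset_union (subset_insert v n.A) Subset.rfl)
  refine card_lt_card (Finset.ssubset_of_subset_of_ssubset
    (undecided_close_subset (h.valid_preRight hl hv)) ((ssubset_iff_of_subset h1).2 ⟨v, hv, ?_⟩))
  simp [mem_undecided, preRight]

/-- Completion to a leaf only adds decisions and respects `Aopt`, so relevance of a child depends
only on the parent and the branching antenna. With the analogue for the right child: a relevant node
has exactly one relevant child, an irrelevant node none. -/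
theorem Closed.relevant_left_iff {Aopt : Finset (Fin N)} (hcard : Aopt.card = L) {n : BBNode N}
    (h : n.Closed L) (hl : ¬ n.IsLeaf L) {v : Fin N} (hv : v ∈ n.undecided) :
    (n.left L v).Relevant Aopt ↔ n.Relevant Aopt ∧ v ∉ Aopt := by
  obtain ⟨h1, h2⟩ := (h.valid_preLeft hl hv).subset_close
  constructor
  · rintro ⟨hA, hB⟩
    have hB' := h2.trans hB
    refine ⟨⟨h1.trans hA, (subset_insert v n.B).trans hB'⟩, ?_⟩
    simpa using hB' (mem_insert_self v n.B)
  · rintro ⟨⟨hA, hB⟩, hvA⟩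
    exact Relevant.close (n := n.preLeft v) ⟨hA, insert_subset (by simpa using hvA) hB⟩ hcard

theorem Closed.relevant_right_iff {Aopt : Finset (Fin N)} (hcard : Aopt.card = L) {n : BBNode N}
    (h : n.Closed L) (hl : ¬ n.IsLeaf L) {v : Fin N} (hv : v ∈ n.undecided) :
    (n.right L v).Relevant Aopt ↔ n.Relevant Aopt ∧ v ∈ Aopt := by
  obtain ⟨h1, h2⟩ := (h.valid_preRight hl hv).subset_close
  constructor
  · rintro ⟨hA, hB⟩
    have hA' := h1.trans hA
    exact ⟨⟨(subset_insert v n.A).trans hA', h2.trans hB⟩, hA' (mem_insert_self v n.A)⟩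
  · rintro ⟨⟨hA, hB⟩, hvA⟩
    exact Relevant.close (n := n.preRight v) ⟨insert_subset hvA hA, hB⟩ hcard

theorem valid_empty : Valid L (⟨∅, ∅, 0⟩ : BBNode N) := ⟨disjoint_empty_left _, by simp, by simp⟩

theorem closed_root (hL : L ≤ N) : (root N L).Closed L := valid_empty.close_closed hL

theorem relevant_root {Aopt : Finset (Fin N)} (hcard : Aopt.card = L) :
    (root N L).Relevant Aopt := Relevant.close ⟨by simp, by simp⟩ hcard

theorem card_undecided_le (n : BBNode N) : n.undecided.card ≤ N := by
  simpa using card_le_univ n.undecided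

end BBNode

/-! ## Values of the relaxed problems -/

namespace BFInstance

variable {N M : ℕ} {Q : BFInstance N M}

theorem value_mono {B B' : Finset (Fin N)} (h : B ⊆ B') : Q.value B ≤ Q.value B' :=
  biInf_mono fun _ hW => ⟨hW.1, fun n hn => hW.2 n (h hn)⟩

theorem feasible_of_mem_relaxed {B : Finset (Fin N)} (hB : B.card = N - Q.L)
    {W : Matrix (Fin N) (Fin M) ℂ} (hW : W ∈ Q.relaxed B) : Q.Feasible W := by
  refine ⟨hW.1, ?_⟩
  have hsub : {n : Fin N | ∃ m, W n m ≠ 0} ⊆ ((univ \ B : Finset (Fin N)) : Set (Fin N)) := by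
    rintro n ⟨m, hm⟩
    simp only [coe_sdiff, coe_univ, Set.mem_sdiff, Set.mem_univ, true_and, mem_coe]
    exact fun hn => hm (hW.2 n hn m)
  refine (Set.ncard_le_ncard hsub (Finset.finite_toSet _)).trans ?_
  rw [Set.ncard_coe_finset, BBNode.card_univ_sdiff, hB]
  have := Q.L_le
  omega

theorem sqFrob_nonneg (W : Matrix (Fin N) (Fin M) ℂ) : 0 ≤ sqFrob W := by
  unfold sqFrob; positivity

/-- The zero matrix has gain 0 and misses the positive target of the first user. A positive optimal
value keeps the relative gap meaningful when the lower bound is 0. -/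
theorem MeetsSINR.sqFrob_pos (hM : 0 < M) {W : Matrix (Fin N) (Fin M) ℂ} (hW : Q.MeetsSINR W) :
    0 < sqFrob W := by
  refine (sqFrob_nonneg W).lt_of_ne fun h => ?_
  have h0 : ∀ n m, W n m = 0 := by
    intro n m
    have h1 := (sum_eq_zero_iff_of_nonneg fun n _ => by positivity).1 h.symm n (mem_univ n)
    have h2 := (sum_eq_zero_iff_of_nonneg fun m _ => by positivity).1 h1 m (mem_univ m)
    simpa using h2
  have h1 := hW ⟨0, hM⟩ (Q.h ⟨0, hM⟩) (by simpa using Q.err_nonneg _)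
  have h2 : gain W ⟨0, hM⟩ (Q.h ⟨0, hM⟩) = 0 := by simp [gain, h0]
  rw [h2, zero_div] at h1
  exact absurd (Q.gamma_pos ⟨0, hM⟩) (not_lt.2 h1)

/-- The value at the leaf of an optimal subset is the optimal value of the joint problem. -/
theorem IsOptimalSubset.exists_value_eq {Aopt : Finset (Fin N)} (hA : Q.IsOptimalSubset Aopt) :
    ∃ W, Q.OptimalWithin 0 W ∧ Q.value (univ \ Aopt) = ENNReal.ofReal (sqFrob W) ∧
      ∀ B : Finset (Fin N), B.card = N - Q.L → Q.value (univ \ Aopt) ≤ Q.value B := by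
  obtain ⟨hcard, W, hW, hz⟩ := hA
  have hle : ∀ B : Finset (Fin N), B.card = N - Q.L → ENNReal.ofReal (sqFrob W) ≤ Q.value B := by
    intro B hB
    refine le_iInf₂ fun W' hW' => ENNReal.ofReal_le_ofReal ?_
    simpa using hW.2 W' (feasible_of_mem_relaxed hB hW')
  have hge : Q.value (univ \ Aopt) ≤ ENNReal.ofReal (sqFrob W) :=
    iInf₂_le W ⟨hW.1.1, fun n hn => hz n (by simpa using hn)⟩
  refine ⟨W, hW, le_antisymm hge (hle _ ?_), fun B hB => hge.trans (hle B hB)⟩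
  rw [BBNode.card_univ_sdiff, hcard]

theorem relaxed_nonempty_of_value_ne_top {B : Finset (Fin N)} (h : Q.value B ≠ ⊤) :
    (Q.relaxed B).Nonempty := by
  by_contra hn
  rw [Set.not_nonempty_iff_eq_empty] at hn
  exact h (by simp [value, hn])

theorem value_eq_sqFrob_solve (R : BBRules Q) {B : Finset (Fin N)} (h : (Q.relaxed B).Nonempty) :
    Q.value B = ENNReal.ofReal (sqFrob (R.solve B)) :=
  le_antisymm (iInf₂_le _ (R.solve_spec B h).1)
    (le_iInf₂ fun W hW => ENNReal.ofReal_le_ofReal ((R.solve_spec B h).2 W hW))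

end BFInstance

/-! ## Invariants of branch and bound -/

namespace BBRules

variable {N M : ℕ} {Q : BFInstance N M} (R : BBRules Q)

/-- What holds in every state that the procedure reaches. -/
structure Invariant (Aopt : Finset (Fin N)) (S : BBState N M) : Prop where
  closed : ∀ n ∈ S.frontier, n.Closed Q.L
  upper_le : ∀ n ∈ S.frontier, n.IsLeaf Q.L → S.upper ≤ Q.value n.B
  upper_eq : ∃ B : Finset (Fin N), B.card = N - Q.L ∧ S.upper = Q.value B ∧
    S.incumbent = R.solve B
  lower_le : (∃ n ∈ S.frontier, n.Relevant Aopt) → S.lower ≤ Q.value (univ \ Aopt)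

variable {R}

theorem ub_eq_of_isLeaf {n : BBNode N} (hn : n.Valid Q.L) (hl : n.IsLeaf Q.L) :
    R.ub n = Q.value n.B := by
  obtain ⟨h1, _, h3, _⟩ := R.shut_spec n hn
  rw [ub, eq_of_subset_of_card_le h1 (by rw [h3, hl.2])]

theorem current_spec {ε : ℝ≥0} {S : BBState N M} (h : R.Continues ε S) :
    R.current S ∈ S.frontier ∧ ¬ (R.current S).IsLeaf Q.L := by
  have := (R.pick_spec _ h.1).1
  simp only [open_, mem_filter] at this
  exact this

theorem branch_mem {ε : ℝ≥0} {Aopt : Finset (Fin N)} {S : BBState N M} (hS : R.Invariant Aopt S)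
    (h : R.Continues ε S) : R.branch (R.current S) ∈ (R.current S).undecided :=
  (R.branch_spec _ ((hS.closed _ (current_spec h).1).undecided_nonempty (current_spec h).2)).1

theorem invariant_init {Aopt : Finset (Fin N)} (hcard : Aopt.card = Q.L) :
    R.Invariant Aopt R.init := by
  have hroot := BBNode.closed_root (N := N) Q.L_le
  refine ⟨?_, ?_, ?_, ?_⟩
  · intro n hn
    rw [mem_singleton.1 hn]; exact hroot
  · intro n hn hl
    rw [mem_singleton.1 hn] at hl ⊢
    exact (ub_eq_of_isLeaf hroot.1 hl).le
  · exact ⟨R.shut (BBNode.root N Q.L), (R.shut_spec _ hroot.1).2.2.1, rfl, rfl⟩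
  · intro _
    exact BFInstance.value_mono (BBNode.relevant_root hcard).2

/-- The two children of the selected node. -/
def children (S : BBState N M) : BBNode N × BBNode N :=
  ((R.current S).left Q.L (R.branch (R.current S)),
    (R.current S).right Q.L (R.branch (R.current S)))

theorem step_upper_le (ε : ℝ≥0) (S : BBState N M) (d : Bool) : (R.step ε S d).upper ≤ S.upper := by
  have hk : ∀ k : BBNode N, (if R.ub k ≤ S.upper then R.ub k else S.upper) ≤ S.upper := by
    intro k
    split_ifs with h3
    · exact h3
    · exact le_rfl
  unfold step
  by_cases h1 : R.Continues ε S
  · cases d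
    · simp only [if_pos h1, Bool.false_eq_true, if_false, le_refl]
    · simp only [if_pos h1, if_true]
      exact hk _
  · simp only [if_neg h1, le_refl]

/-- The update uses the child with the smaller upper bound, so the new global bound is below both.
For a child that is a leaf this yields the leaf clause of the invariant. -/
theorem step_true_upper_le {ε : ℝ≥0} {S : BBState N M} (h : R.Continues ε S) :
    (R.step ε S true).upper ≤ R.ub (R.children S).1 ∧
      (R.step ε S true).upper ≤ R.ub (R.children S).2 := by
  have hk : ∀ k : BBNode N, (if R.ub k ≤ S.upper then R.ub k else S.upper) ≤ R.ub k := by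
    intro k
    split_ifs with h3
    · exact le_rfl
    · exact (not_le.1 h3).le
  simp only [step, if_pos h, if_true]
  by_cases h2 : R.ub (R.children S).1 ≤ R.ub (R.children S).2
  · have h2' := h2
    simp only [children] at h2'
    simp only [h2', if_true]
    exact ⟨hk _, (hk _).trans h2⟩
  · have h2' := h2
    simp only [children] at h2'
    simp only [h2', if_false]
    exact ⟨(hk _).trans (not_le.1 h2).le, hk _⟩

theorem mem_step_true_frontier {ε : ℝ≥0} {S : BBState N M} (h : R.Continues ε S) {n : BBNode N} :
    n ∈ (R.step ε S true).frontier ↔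
      (n = (R.children S).1 ∨ n = (R.children S).2 ∨ n ∈ S.frontier.erase (R.current S)) ∧
        Q.value n.B ≤ (R.step ε S true).upper := by
  simp only [step, if_pos h, if_true, mem_filter, mem_insert, children]
  rfl

theorem mem_step_false_frontier {ε : ℝ≥0} {S : BBState N M} (h : R.Continues ε S) {n : BBNode N} :
    n ∈ (R.step ε S false).frontier ↔
      n ∈ S.frontier.erase (R.current S) ∧ Q.value n.B ≤ S.upper := by
  simp only [step, if_pos h, Bool.false_eq_true, if_false, mem_filter]
  rfl

theorem step_true_lower_le {ε : ℝ≥0} {S : BBState N M} (h : R.Continues ε S) {n : BBNode N}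
    (hn : n ∈ (R.step ε S true).frontier) : (R.step ε S true).lower ≤ Q.value n.B := by
  have hn := ((mem_step_true_frontier h).1 hn).1
  simp only [step, if_pos h, if_true]
  refine inf_le (f := R.lb) ?_
  simpa only [mem_insert, children] using hn

theorem step_of_not_continues {ε : ℝ≥0} {S : BBState N M} (h : ¬ R.Continues ε S) (d : Bool) :
    R.step ε S d = S := by simp [step, h]

/-- The bound on `lower` is claimed only while a relevant node remains. After branching it follows
from that node's own lower bound; after a discard `lower` is unchanged and the surviving relevant
node was already there. -/
theorem Invariant.step {Aopt : Finset (Fin N)} {S : BBState N M} (hS : R.Invariant Aopt S)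
    (ε : ℝ≥0) (d : Bool) : R.Invariant Aopt (R.step ε S d) := by
  by_cases h : R.Continues ε S
  swap
  · rwa [step_of_not_continues h]
  obtain ⟨hcur, hleaf⟩ := current_spec h
  have hb := branch_mem hS h
  have hcl := hS.closed _ hcur
  cases d with
  | false =>
    refine ⟨fun n hn => ?_, fun n hn hl => ?_, ?_, ?_⟩
    · exact hS.closed n (mem_of_mem_erase ((mem_step_false_frontier h).1 hn).1)
    · exact (step_upper_le ε S false).trans
        (hS.upper_le n (mem_of_mem_erase ((mem_step_false_frontier h).1 hn).1) hl)
    · simpa [BBRules.step, h] using hS.upper_eq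
    · rintro ⟨n, hn, hr⟩
      have := hS.lower_le ⟨n, mem_of_mem_erase ((mem_step_false_frontier h).1 hn).1, hr⟩
      simpa [BBRules.step, h] using this
  | true =>
    have hc₁ : (R.children S).1.Closed Q.L := hcl.left Q.L_le hleaf hb
    have hc₂ : (R.children S).2.Closed Q.L := hcl.right Q.L_le hleaf hb
    refine ⟨fun n hn => ?_, fun n hn hl => ?_, ?_, ?_⟩
    · rcases ((mem_step_true_frontier h).1 hn).1 with rfl | rfl | hn
      · exact hc₁
      · exact hc₂
      · exact hS.closed n (mem_of_mem_erase hn)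
    · rcases ((mem_step_true_frontier h).1 hn).1 with rfl | rfl | hn
      · exact (step_true_upper_le h).1.trans (ub_eq_of_isLeaf hc₁.1 hl).le
      · exact (step_true_upper_le h).2.trans (ub_eq_of_isLeaf hc₂.1 hl).le
      · exact (step_upper_le ε S true).trans (hS.upper_le n (mem_of_mem_erase hn) hl)
    · have hsh : ∀ k : BBNode N, k.Closed Q.L → ∃ B : Finset (Fin N), B.card = N - Q.L ∧
          (if R.ub k ≤ S.upper then R.ub k else S.upper) = Q.value B ∧
          (if R.ub k ≤ S.upper then R.solve (R.shut k) else S.incumbent) = R.solve B := by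
        intro k hk
        split_ifs
        · exact ⟨_, (R.shut_spec k hk.1).2.2.1, rfl, rfl⟩
        · exact hS.upper_eq
      simp only [BBRules.step, if_pos h, if_true]
      refine hsh _ ?_
      split_ifs
      · exact hc₁
      · exact hc₂
    · rintro ⟨n, hn, hr⟩
      exact (step_true_lower_le h hn).trans (BFInstance.value_mono hr.2)

theorem Invariant.le_upper {Aopt : Finset (Fin N)} (hA : Q.IsOptimalSubset Aopt)
    {S : BBState N M} (hS : R.Invariant Aopt S) : Q.value (univ \ Aopt) ≤ S.upper := by
  obtain ⟨_, _, _, hle⟩ := hA.exists_value_eq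
  obtain ⟨B, hB, hu, _⟩ := hS.upper_eq
  exact hu ▸ hle B hB

/-- A relevant node that is not selected stays. -/
theorem Invariant.mem_step_of_ne {Aopt : Finset (Fin N)} (hA : Q.IsOptimalSubset Aopt)
    {S : BBState N M} (hS : R.Invariant Aopt S) {ε : ℝ≥0} (h : R.Continues ε S) {m : BBNode N}
    (hm : m ∈ S.frontier) (hr : m.Relevant Aopt) (hne : m ≠ R.current S) (d : Bool) :
    m ∈ (R.step ε S d).frontier := by
  have h1 : m ∈ S.frontier.erase (R.current S) := mem_erase.2 ⟨hne, hm⟩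
  have h2 := BFInstance.value_mono (Q := Q) hr.2
  cases d with
  | false => exact (mem_step_false_frontier h).2 ⟨h1, h2.trans (hS.le_upper hA)⟩
  | true =>
    exact (mem_step_true_frontier h).2 ⟨Or.inr (Or.inr h1), h2.trans ((hS.step ε true).le_upper hA)⟩

/-- Branching a relevant node leaves a relevant child. -/
theorem Invariant.exists_relevant_child {Aopt : Finset (Fin N)} (hA : Q.IsOptimalSubset Aopt)
    {S : BBState N M} (hS : R.Invariant Aopt S) {ε : ℝ≥0} (h : R.Continues ε S)
    (hr : (R.current S).Relevant Aopt) :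
    ∃ m ∈ (R.step ε S true).frontier, m.Relevant Aopt ∧
      m.undecided.card < (R.current S).undecided.card := by
  obtain ⟨hcur, hleaf⟩ := current_spec h
  have hb := branch_mem hS h
  have hcl := hS.closed _ hcur
  have hup := (hS.step ε true).le_upper hA
  by_cases hv : R.branch (R.current S) ∈ Aopt
  · have hrel : (R.children S).2.Relevant Aopt :=
      (hcl.relevant_right_iff hA.1 hleaf hb).2 ⟨hr, hv⟩
    exact ⟨_, (mem_step_true_frontier h).2 ⟨Or.inr (Or.inl rfl),
      (BFInstance.value_mono hrel.2).trans hup⟩, hrel, hcl.card_undecided_right_lt hleaf hb⟩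
  · have hrel : (R.children S).1.Relevant Aopt :=
      (hcl.relevant_left_iff hA.1 hleaf hb).2 ⟨hr, hv⟩
    exact ⟨_, (mem_step_true_frontier h).2 ⟨Or.inl rfl,
      (BFInstance.value_mono hrel.2).trans hup⟩, hrel, hcl.card_undecided_left_lt hleaf hb⟩

/-- When the procedure stops and a relevant node is left, the incumbent is good enough. -/
theorem Invariant.optimalWithin_of_not_continues {Aopt : Finset (Fin N)} (hM : 0 < M)
    (hA : Q.IsOptimalSubset Aopt) {S : BBState N M} (hS : R.Invariant Aopt S) {ε : ℝ≥0}
    (h : ¬ R.Continues ε S) {m : BBNode N} (hm : m ∈ S.frontier) (hr : m.Relevant Aopt) :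
    Q.OptimalWithin ε S.incumbent := by
  obtain ⟨W, hW, hval, hle⟩ := hA.exists_value_eq
  have hpos : 0 < sqFrob W := BFInstance.MeetsSINR.sqFrob_pos hM hW.1.1
  have hup := hS.le_upper hA
  have hlow := hS.lower_le ⟨m, hm, hr⟩
  have hbound : S.upper ≤ (1 + ε) * ENNReal.ofReal (sqFrob W) := by
    rw [← hval]
    by_cases ho : (R.open_ S).Nonempty
    · have hgap : (S.upper - S.lower) / S.lower ≤ ε := not_lt.1 fun hlt => h ⟨ho, hlt⟩
      -- With `lower = 0` the quotient would be `∞`, as `upper` is at least the positive optimal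
      -- value, contradicting the gap bound.
      have hl0 : S.lower ≠ 0 := by
        intro hl
        rw [hl, tsub_zero, ENNReal.div_zero, top_le_iff] at hgap
        · exact ENNReal.coe_ne_top hgap
        · intro hu
          rw [hu, nonpos_iff_eq_zero, hval, ENNReal.ofReal_eq_zero] at hup
          linarith
      have hlt : S.lower ≠ ⊤ := ne_top_of_le_ne_top (hval ▸ ENNReal.ofReal_ne_top) hlow
      rw [ENNReal.div_le_iff hl0 hlt] at hgap
      calc S.upper ≤ S.upper - S.lower + S.lower := le_tsub_add
        _ ≤ ε * S.lower + S.lower := by gcongr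
        _ = (1 + ε) * S.lower := by ring
        _ ≤ _ := by gcongr
    -- With nothing left to select, the relevant node is the leaf of `Aopt`, whose value bounds
    -- `upper` directly.
    · have hleaf : m.IsLeaf Q.L := by
        by_contra hl
        exact ho ⟨m, by simp [open_, hm, hl]⟩
      have hB : m.B = univ \ Aopt := eq_of_subset_of_card_le hr.2 (by
        rw [BBNode.card_univ_sdiff, hA.1, hleaf.2])
      have := hS.upper_le m hm hleaf
      rw [hB] at this
      exact this.trans (le_mul_of_one_le_left zero_le le_self_add)
  obtain ⟨B, hB, hu, hinc⟩ := hS.upper_eq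
  -- `solve` is only meaningful on feasible problems; feasibility follows because `upper` is finite.
  have hne : (Q.relaxed B).Nonempty := by
    refine BFInstance.relaxed_nonempty_of_value_ne_top ?_
    rw [← hu]
    refine ne_top_of_le_ne_top ?_ hbound
    exact ENNReal.mul_ne_top (by simp) ENNReal.ofReal_ne_top
  rw [hinc]
  refine ⟨BFInstance.feasible_of_mem_relaxed hB (R.solve_spec B hne).1, fun W' hW' => ?_⟩
  rw [hu, BFInstance.value_eq_sqFrob_solve R hne,
    show (1 + (ε : ℝ≥0∞)) = ENNReal.ofReal (1 + (ε : ℝ)) by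
      rw [ENNReal.ofReal_add zero_le_one ε.coe_nonneg]; simp,
    ← ENNReal.ofReal_mul (by positivity), ENNReal.ofReal_le_ofReal_iff
      (mul_nonneg (by positivity) hpos.le)] at hbound
  have := hW.2 W' hW'
  simp only [NNReal.coe_zero, add_zero, one_mul] at this
  refine hbound.trans ?_
  gcongr

/-! ### Weights of the frontier -/

/-- Total weight of the frontier. -/
def weight (f : BBNode N → ℝ) (S : BBState N M) : ℝ := ∑ n ∈ S.frontier, f n

theorem weight_step_false {f : BBNode N → ℝ} (hf : ∀ n, 0 ≤ f n) {ε : ℝ≥0} {S : BBState N M}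
    (h : R.Continues ε S) : weight f (R.step ε S false) + f (R.current S) ≤ weight f S := by
  rw [weight, weight, ← sum_erase_add _ _ (current_spec h).1]
  gcongr ?_ + _
  exact sum_le_sum_of_subset_of_nonneg (fun n hn => ((mem_step_false_frontier h).1 hn).1)
    fun n _ _ => hf n

theorem sum_insert_le {α : Type*} [DecidableEq α] {f : α → ℝ} (hf : ∀ n, 0 ≤ f n) (a : α)
    (s : Finset α) : ∑ n ∈ insert a s, f n ≤ f a + ∑ n ∈ s, f n := by
  by_cases h : a ∈ s
  · rw [insert_eq_of_mem h]; linarith [hf a]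
  · rw [sum_insert h]

/-- Only an inequality: new nodes may be pruned at once or coincide with nodes already present. -/
theorem weight_step_true {f : BBNode N → ℝ} (hf : ∀ n, 0 ≤ f n) {ε : ℝ≥0} {S : BBState N M}
    (h : R.Continues ε S) : weight f (R.step ε S true) + f (R.current S) ≤
      weight f S + f (R.children S).1 + f (R.children S).2 := by
  rw [weight, weight, ← sum_erase_add _ _ (current_spec h).1]
  have h1 : ∑ n ∈ (R.step ε S true).frontier, f n ≤
      ∑ n ∈ insert (R.children S).1 (insert (R.children S).2 (S.frontier.erase (R.current S))), f n :=
    sum_le_sum_of_subset_of_nonneg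
      (fun n hn => by simpa only [mem_insert] using ((mem_step_true_frontier h).1 hn).1)
      fun n _ _ => hf n
  have h2 := sum_insert_le hf (R.children S).1
    (insert (R.children S).2 (S.frontier.erase (R.current S)))
  have h3 := sum_insert_le hf (R.children S).2 (S.frontier.erase (R.current S))
  linarith

/-- Every iteration decreases this weight by at least one. -/
theorem Invariant.weight_step_add_one_le {Aopt : Finset (Fin N)} {S : BBState N M}
    (hS : R.Invariant Aopt S) {ε : ℝ≥0} (h : R.Continues ε S) (d : Bool) :
    weight (fun n => 3 ^ n.undecided.card) (R.step ε S d) + 1 ≤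
      weight (fun n => 3 ^ n.undecided.card) S := by
  obtain ⟨hcur, hleaf⟩ := current_spec h
  have hb := branch_mem hS h
  have hcl := hS.closed _ hcur
  have hf : ∀ n : BBNode N, (0 : ℝ) ≤ 3 ^ n.undecided.card := fun n => by positivity
  cases d with
  | false =>
    have h1 := weight_step_false hf h
    have : (1 : ℝ) ≤ 3 ^ (R.current S).undecided.card := one_le_pow₀ (by norm_num)
    linarith
  | true =>
    have h1 := weight_step_true hf h
    -- Base 3 leaves room for two children: each weighs at most a third of the parent, so the parent
    -- exceeds their sum by at least half of that sum, which is at least 1.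
    have key : ∀ c : BBNode N, c.undecided.card < (R.current S).undecided.card →
        (3 : ℝ) * 3 ^ c.undecided.card ≤ 3 ^ (R.current S).undecided.card := by
      intro c hc
      rw [← pow_succ']
      exact pow_le_pow_right₀ (by norm_num) hc
    have h2 := key (R.children S).1 (hcl.card_undecided_left_lt hleaf hb)
    have h3 := key (R.children S).2 (hcl.card_undecided_right_lt hleaf hb)
    have h4 : (1 : ℝ) ≤ 3 ^ (R.children S).1.undecided.card := one_le_pow₀ (by norm_num)
    have h5 : (1 : ℝ) ≤ 3 ^ (R.children S).2.undecided.card := one_le_pow₀ (by norm_num)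
    linarith

end BBRules

/-! ## Branch and bound with a random classifier -/

namespace BBRules

variable {N M : ℕ} {Q : BFInstance N M} {R : BBRules Q}

/-- Bound on the expected number of nodes that a node will add to the tree. -/
def nodeWeight (Aopt : Finset (Fin N)) (y : ℝ) (n : BBNode N) : ℝ :=
  open Classical in if n.Relevant Aopt then n.undecided.card * (2 + y) else y

theorem nodeWeight_nonneg (Aopt : Finset (Fin N)) {y : ℝ} (hy : 0 ≤ y) (n : BBNode N) :
    0 ≤ nodeWeight Aopt y n := by
  unfold nodeWeight; split_ifs <;> positivity

/-- The visited nodes and a bound on the expected number of nodes to come. -/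
def nodePotential (Aopt : Finset (Fin N)) (y : ℝ) (S : BBState N M) : ℝ :=
  S.visited + weight (nodeWeight Aopt y) S

theorem nodePotential_nonneg (Aopt : Finset (Fin N)) {y : ℝ} (hy : 0 ≤ y) (S : BBState N M) :
    0 ≤ nodePotential Aopt y S :=
  add_nonneg (Nat.cast_nonneg _) (sum_nonneg fun n _ => nodeWeight_nonneg Aopt hy n)

theorem step_visited {ε : ℝ≥0} {S : BBState N M} (h : R.Continues ε S) (d : Bool) :
    (R.step ε S d).visited = if d then S.visited + 2 else S.visited := by
  cases d <;> simp [step, h]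

theorem visited_le_step (ε : ℝ≥0) (S : BBState N M) (d : Bool) :
    S.visited ≤ (R.step ε S d).visited := by
  by_cases h : R.Continues ε S
  · rw [step_visited h]; split_ifs <;> omega
  · rw [step_of_not_continues h]

/-- The supermartingale step. At a relevant node neither decision raises the potential: branching
adds two nodes, one irrelevant child of weight `y` and a relevant child with fewer undecided
antennas, which the weight `k * (2 + y)` pays for. At an irrelevant node branching has probability
at most `1 - ρ` and creates two nodes of weight `y`; the equation for `y` balances this. -/
theorem Invariant.nodePotential_step_le {Aopt : Finset (Fin N)} (hcard : Aopt.card = Q.L)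
    {S : BBState N M} (hS : R.Invariant Aopt S) {ε : ℝ≥0} (h : R.Continues ε S) {y p q ρ : ℝ}
    (hy : 0 ≤ y) (hyρ : y = (1 - ρ) * (2 + 2 * y)) (hp : 0 ≤ p) (hq : 0 ≤ q) (hpq : p + q = 1)
    (hacc : ρ ≤ if (R.current S).label Aopt then p else q) :
    p * nodePotential Aopt y (R.step ε S true) + q * nodePotential Aopt y (R.step ε S false) ≤
      nodePotential Aopt y S := by
  obtain ⟨hcur, hleaf⟩ := current_spec h
  have hb := branch_mem hS h
  have hcl := hS.closed _ hcur
  have ht := weight_step_true (nodeWeight_nonneg Aopt hy) h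
  have hf := weight_step_false (nodeWeight_nonneg Aopt hy) h
  have hvt : ((R.step ε S true).visited : ℝ) = S.visited + 2 := by simp [step_visited h]
  have hvf : ((R.step ε S false).visited : ℝ) = S.visited := by simp [step_visited h]
  have h1 := hcl.relevant_left_iff hcard hleaf hb
  have h2 := hcl.relevant_right_iff hcard hleaf hb
  have hq' : q = 1 - p := by linarith
  unfold nodePotential
  rw [hvt, hvf]
  by_cases hr : (R.current S).Relevant Aopt
  · have hw : nodeWeight Aopt y (R.current S) = (R.current S).undecided.card * (2 + y) := by
      simp [nodeWeight, hr]
    have hsum : nodeWeight Aopt y (R.children S).1 + nodeWeight Aopt y (R.children S).2 + 2 ≤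
        nodeWeight Aopt y (R.current S) := by
      have hcount : ∀ c : BBNode N, c.undecided.card < (R.current S).undecided.card →
          c.undecided.card * (2 + y) + (2 + y) ≤ nodeWeight Aopt y (R.current S) := by
        intro c hc
        have : (c.undecided.card : ℝ) + 1 ≤ (R.current S).undecided.card := by exact_mod_cast hc
        rw [hw]
        nlinarith
      by_cases hv : R.branch (R.current S) ∈ Aopt
      · have hw1 : nodeWeight Aopt y (R.children S).1 = y :=
          if_neg fun hc => (h1.1 hc).2 hv
        have hw2 : nodeWeight Aopt y (R.children S).2 = (R.children S).2.undecided.card * (2 + y) :=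
          if_pos (h2.2 ⟨hr, hv⟩)
        have := hcount (R.children S).2 (hcl.card_undecided_right_lt hleaf hb)
        linarith
      · have hw1 : nodeWeight Aopt y (R.children S).1 = (R.children S).1.undecided.card * (2 + y) :=
          if_pos (h1.2 ⟨hr, hv⟩)
        have hw2 : nodeWeight Aopt y (R.children S).2 = y :=
          if_neg fun hc => hv (h2.1 hc).2
        have := hcount (R.children S).1 (hcl.card_undecided_left_lt hleaf hb)
        linarith
    have hw0 := nodeWeight_nonneg Aopt hy (R.current S)
    have ht' : (S.visited : ℝ) + 2 + weight (nodeWeight Aopt y) (R.step ε S true) ≤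
        S.visited + weight (nodeWeight Aopt y) S := by linarith
    have hf' : (S.visited : ℝ) + weight (nodeWeight Aopt y) (R.step ε S false) ≤
        S.visited + weight (nodeWeight Aopt y) S := by linarith
    calc _ ≤ p * (S.visited + weight (nodeWeight Aopt y) S) +
          q * (S.visited + weight (nodeWeight Aopt y) S) := by gcongr
      _ = _ := by rw [← add_mul, hpq, one_mul]
  · have hlab : (R.current S).label Aopt = false := by
      rw [← Bool.not_eq_true, BBNode.label_eq_true_iff]; exact hr
    rw [hlab] at hacc
    simp only [Bool.false_eq_true, if_false] at hacc
    have hw : nodeWeight Aopt y (R.current S) = y := if_neg hr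
    have hw1 : nodeWeight Aopt y (R.children S).1 = y := if_neg fun hc => hr (h1.1 hc).1
    have hw2 : nodeWeight Aopt y (R.children S).2 = y := if_neg fun hc => hr (h2.1 hc).1
    rw [hw] at ht hf
    rw [hw1, hw2] at ht
    have hp1 : p * (2 + 2 * y) ≤ (1 - ρ) * (2 + 2 * y) := by gcongr; linarith
    calc _ ≤ p * (S.visited + 2 + (weight (nodeWeight Aopt y) S + y)) +
          q * (S.visited + (weight (nodeWeight Aopt y) S - y)) := by
            gcongr <;> linarith
      _ ≤ _ := by rw [hq']; linarith

/-- Lower bound on the probability that a relevant node stays in the frontier until the end. -/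
def survival (Aopt : Finset (Fin N)) (ρ : ℝ≥0) (S : BBState N M) : ℝ≥0 :=
  open Classical in
  (S.frontier.filter fun n => n.Relevant Aopt).sup fun n => ρ ^ n.undecided.card

theorem le_survival {Aopt : Finset (Fin N)} (ρ : ℝ≥0) {S : BBState N M} {n : BBNode N}
    (hn : n ∈ S.frontier) (hr : n.Relevant Aopt) : ρ ^ n.undecided.card ≤ survival Aopt ρ S := by
  classical
  exact le_sup (f := fun n : BBNode N => ρ ^ n.undecided.card) (mem_filter.2 ⟨hn, hr⟩)

theorem survival_le_one {Aopt : Finset (Fin N)} {ρ : ℝ≥0} (hρ : ρ ≤ 1) (S : BBState N M) :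
    survival Aopt ρ S ≤ 1 :=
  Finset.sup_le fun _ _ => pow_le_one₀ zero_le hρ

theorem survival_eq {Aopt : Finset (Fin N)} (ρ : ℝ≥0) (S : BBState N M) :
    survival Aopt ρ S = 0 ∨
      ∃ n ∈ S.frontier, n.Relevant Aopt ∧ survival Aopt ρ S = ρ ^ n.undecided.card := by
  classical
  by_cases h : (S.frontier.filter fun n => n.Relevant Aopt).Nonempty
  · obtain ⟨n, hn, he⟩ := exists_mem_eq_sup _ h fun n : BBNode N => ρ ^ n.undecided.card
    obtain ⟨hn, hr⟩ := mem_filter.1 hn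
    refine Or.inr ⟨n, hn, hr, ?_⟩
    rw [← he, survival]
  · left
    rw [survival]
    refine (Finset.sup_eq_bot_iff _ _).2 fun n hn => absurd ⟨n, ?_⟩ h
    simpa using hn

/-- The submartingale step. If the node attaining the maximum is not selected, it survives either
decision. If it is selected, it is branched with probability at least `ρ`, and its relevant child
has lost at least one undecided antenna, which compensates the factor `ρ`. -/
theorem Invariant.survival_le_step {Aopt : Finset (Fin N)} (hA : Q.IsOptimalSubset Aopt)
    {S : BBState N M} (hS : R.Invariant Aopt S) {ε : ℝ≥0} (h : R.Continues ε S) {p q : ℝ}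
    {ρ : ℝ≥0} (hρ : ρ ≤ 1) (hp : 0 ≤ p) (hq : 0 ≤ q) (hpq : p + q = 1)
    (hacc : (ρ : ℝ) ≤ if (R.current S).label Aopt then p else q) :
    (survival Aopt ρ S : ℝ) ≤
      p * survival Aopt ρ (R.step ε S true) + q * survival Aopt ρ (R.step ε S false) := by
  rcases survival_eq (Aopt := Aopt) ρ S with h0 | ⟨n, hn, hr, he⟩
  · rw [h0, NNReal.coe_zero]; positivity
  rw [he]
  by_cases hc : n = R.current S
  · subst hc
    rw [BBNode.label_eq_true_iff.2 hr, if_pos rfl] at hacc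
    obtain ⟨m, hm, hmr, hlt⟩ := hS.exists_relevant_child hA h hr
    have h1 : ((ρ ^ m.undecided.card : ℝ≥0) : ℝ) ≤ survival Aopt ρ (R.step ε S true) :=
      NNReal.coe_le_coe.2 (le_survival ρ hm hmr)
    have h2 : (ρ : ℝ) ^ (R.current S).undecided.card ≤ (ρ : ℝ) ^ (m.undecided.card + 1) :=
      pow_le_pow_of_le_one ρ.coe_nonneg (by exact_mod_cast hρ) hlt
    push_cast at h1 ⊢
    calc (ρ : ℝ) ^ (R.current S).undecided.card ≤ ρ * ρ ^ m.undecided.card := by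
          rw [← pow_succ']; exact h2
      _ ≤ p * survival Aopt ρ (R.step ε S true) := by gcongr
      _ ≤ _ := le_add_of_nonneg_right (by positivity)
  · have hd : ∀ d, ((ρ ^ n.undecided.card : ℝ≥0) : ℝ) ≤ survival Aopt ρ (R.step ε S d) := fun d =>
      NNReal.coe_le_coe.2 (le_survival ρ (hS.mem_step_of_ne hA h hn hr hc d) hr)
    calc ((ρ ^ n.undecided.card : ℝ≥0) : ℝ) = p * ((ρ ^ n.undecided.card : ℝ≥0) : ℝ) +
          q * ((ρ ^ n.undecided.card : ℝ≥0) : ℝ) := by rw [← add_mul, hpq, one_mul]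
      _ ≤ _ := by gcongr <;> exact hd _

end BBRules

/-! ### The classified search as a random process -/

namespace Training

variable {N M E J : ℕ} {Z : Type*} {T : Training N M E J Z}
variable {Q : BFInstance N M} {R : BBRules Q} {ε : ℝ≥0}
  {feat : BBState N M → BBNode N → Features N M E}

theorem minimal_congr {w w' : ℕ → Params E × ℝ} {t : ℕ} (h : ∀ k < t, w k = w' k) :
    T.minimal R ε feat w t = T.minimal R ε feat w' t := by
  induction t with
  | zero => rfl
  | succ t ih => simp only [minimal, ih fun k hk => h k (by omega), h t (by omega)]

theorem invariant_minimal {Aopt : Finset (Fin N)} (hcard : Aopt.card = Q.L)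
    (w : ℕ → Params E × ℝ) (t : ℕ) : R.Invariant Aopt (T.minimal R ε feat w t) := by
  induction t with
  | zero => exact BBRules.invariant_init hcard
  | succ t ih => exact ih.step ε _

theorem weight_minimal_add_le {Aopt : Finset (Fin N)} (hcard : Aopt.card = Q.L)
    (w : ℕ → Params E × ℝ) (t : ℕ) (h : R.Continues ε (T.minimal R ε feat w t)) :
    BBRules.weight (fun n => 3 ^ n.undecided.card) (T.minimal R ε feat w t) + t ≤ (3 : ℝ) ^ N := by
  induction t with
  | zero =>
    have : (3 : ℝ) ^ (BBNode.root N Q.L).undecided.card ≤ 3 ^ N :=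
      pow_le_pow_right₀ (by norm_num) (BBNode.card_undecided_le _)
    simpa [minimal, BBRules.init, BBRules.weight] using this
  | succ t ih =>
    have hc : R.Continues ε (T.minimal R ε feat w t) := by
      by_contra hn
      exact hn (by simpa only [minimal, BBRules.step_of_not_continues hn] using h)
    have h1 := (invariant_minimal (T := T) (feat := feat) hcard w t).weight_step_add_one_le hc
      (T.classify (w t).1 (w t).2
        (feat (T.minimal R ε feat w t) (R.current (T.minimal R ε feat w t))))
    have h2 := ih hc
    push_cast
    simp only [minimal]
    linarith

/-- The weight starts at most `3 ^ N`, stays nonnegative and drops by at least 1 per iteration,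
whatever the classifier decides. -/
theorem not_continues_minimal {Aopt : Finset (Fin N)} (hcard : Aopt.card = Q.L)
    (w : ℕ → Params E × ℝ) : ¬ R.Continues ε (T.minimal R ε feat w (3 ^ N + 1)) := by
  intro h
  have h1 := weight_minimal_add_le (T := T) (feat := feat) hcard w _ h
  have h2 : 0 ≤ BBRules.weight (fun n => (3 : ℝ) ^ n.undecided.card)
    (T.minimal R ε feat w (3 ^ N + 1)) := sum_nonneg fun n _ => by positivity
  push_cast at h1
  linarith

variable {κ : Measure (Params E)} [IsProbabilityMeasure κ] {τ : Measure ℝ}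
  [IsProbabilityMeasure τ]

theorem accuracy_le_one {p : Measure (Sample N M E)} [IsProbabilityMeasure p] :
    T.accuracy p κ τ ≤ 1 := measureReal_le_one

variable [MeasurableSpace Z]

namespace Assumptions

variable {c : Bounds} {I : ℕ} {G H : ℝ} (hT : T.Assumptions c I G H)
include hT

/-- States carry no σ-algebra and `feat` is arbitrary. Yet the state after `t` iterations is
determined by `t` Boolean decisions, so every function of it is measurable; quantifying over all `f`
makes the induction work, since the features of the selected node are one such function. -/
theorem measurable_minimal (t : ℕ) {β : Type} [MeasurableSpace β] (f : BBState N M → β) :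
    Measurable fun w : ℕ → Params E × ℝ => f (T.minimal R ε feat w t) := by
  induction t generalizing β with
  | zero => exact measurable_const (a := f R.init)
  | succ t ih =>
    have hd : Measurable fun w : ℕ → Params E × ℝ => T.classify (w t).1 (w t).2
        (feat (T.minimal R ε feat w t) (R.current (T.minimal R ε feat w t))) :=
      hT.measurable_classify (measurable_pi_apply t).fst (measurable_pi_apply t).snd
        (ih fun S => feat S (R.current S))
    have hite : (fun w : ℕ → Params E × ℝ => f (T.minimal R ε feat w (t + 1))) = fun w =>
        if T.classify (w t).1 (w t).2
          (feat (T.minimal R ε feat w t) (R.current (T.minimal R ε feat w t))) = true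
        then f (R.step ε (T.minimal R ε feat w t) true)
        else f (R.step ε (T.minimal R ε feat w t) false) := by
      funext w
      rw [minimal]
      split_ifs with h
      · rw [h]
      · rw [Bool.not_eq_true] at h; rw [h]
    rw [hite]
    exact Measurable.ite (hd (measurableSet_singleton true)) (ih fun S => f (R.step ε S true))
      (ih fun S => f (R.step ε S false))

theorem accuracy_dirac_add (φ : Features N M E) :
    T.accuracy (Measure.dirac (φ, true)) κ τ + T.accuracy (Measure.dirac (φ, false)) κ τ = 1 := by
  have hm : MeasurableSet {a : Params E × ℝ | T.classify a.1 a.2 φ = true} :=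
    hT.measurable_classify measurable_fst measurable_snd measurable_const
      (measurableSet_singleton true)
  rw [hT.accuracy_dirac, hT.accuracy_dirac]
  have : {a : Params E × ℝ | T.classify a.1 a.2 φ = false} =
      {a | T.classify a.1 a.2 φ = true}ᶜ := by
    ext a; simp
  rw [this, probReal_add_probReal_compl hm]

/-- One step of the expectation of a function of the state. -/
theorem lintegral_minimal_succ {f : BBState N M → ℝ} (hf : ∀ S, 0 ≤ f S) (t : ℕ) :
    ∫⁻ w, ENNReal.ofReal (f (T.minimal R ε feat w (t + 1)))
        ∂(Measure.infinitePi fun _ : ℕ => κ.prod τ) =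
      ∫⁻ w, ENNReal.ofReal
        (T.accuracy (Measure.dirac (feat (T.minimal R ε feat w t)
            (R.current (T.minimal R ε feat w t)), true)) κ τ *
          f (R.step ε (T.minimal R ε feat w t) true) +
        T.accuracy (Measure.dirac (feat (T.minimal R ε feat w t)
            (R.current (T.minimal R ε feat w t)), false)) κ τ *
          f (R.step ε (T.minimal R ε feat w t) false))
        ∂(Measure.infinitePi fun _ : ℕ => κ.prod τ) := by
  have hfst : Measurable fun q : (ℕ → Params E × ℝ) × (Params E × ℝ) => q.1 := measurable_fst
  have hcl : Measurable fun q : (ℕ → Params E × ℝ) × (Params E × ℝ) => T.classify q.2.1 q.2.2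
      (feat (T.minimal R ε feat q.1 t) (R.current (T.minimal R ε feat q.1 t))) :=
    hT.measurable_classify measurable_snd.fst measurable_snd.snd
      ((hT.measurable_minimal t fun S => feat S (R.current S)).comp hfst)
  have hite : (fun q : (ℕ → Params E × ℝ) × (Params E × ℝ) => ENNReal.ofReal
      (f (R.step ε (T.minimal R ε feat q.1 t) (T.classify q.2.1 q.2.2
        (feat (T.minimal R ε feat q.1 t) (R.current (T.minimal R ε feat q.1 t))))))) = fun q =>
      if T.classify q.2.1 q.2.2
        (feat (T.minimal R ε feat q.1 t) (R.current (T.minimal R ε feat q.1 t))) = true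
      then ENNReal.ofReal (f (R.step ε (T.minimal R ε feat q.1 t) true))
      else ENNReal.ofReal (f (R.step ε (T.minimal R ε feat q.1 t) false)) := by
    funext q
    split_ifs with h
    · rw [h]
    · rw [Bool.not_eq_true] at h; rw [h]
  have hmeas : Measurable fun q : (ℕ → Params E × ℝ) × (Params E × ℝ) => ENNReal.ofReal
      (f (R.step ε (T.minimal R ε feat q.1 t) (T.classify q.2.1 q.2.2
        (feat (T.minimal R ε feat q.1 t) (R.current (T.minimal R ε feat q.1 t)))))) := by
    rw [hite]
    exact Measurable.ite (hcl (measurableSet_singleton true))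
      ((hT.measurable_minimal t fun S => ENNReal.ofReal (f (R.step ε S true))).comp hfst)
      ((hT.measurable_minimal t fun S => ENNReal.ofReal (f (R.step ε S false))).comp hfst)
  simp only [minimal]
  -- The state before iteration `t` ignores the pair drawn at `t`, so that pair is integrated first;
  -- it matters only through the Boolean decision.
  rw [lintegral_infinitePi_eval (κ.prod τ) t (F := fun w a => ENNReal.ofReal
      (f (R.step ε (T.minimal R ε feat w t) (T.classify a.1 a.2
        (feat (T.minimal R ε feat w t) (R.current (T.minimal R ε feat w t))))))) hmeas
    (fun w w' h => by rw [minimal_congr (t := t) fun k hk => h k hk.ne])]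
  refine lintegral_congr fun w => ?_
  set S := T.minimal R ε feat w t
  set φ := feat S (R.current S)
  have hc : Measurable fun a : Params E × ℝ => T.classify a.1 a.2 φ :=
    hT.measurable_classify measurable_fst measurable_snd measurable_const
  have hmap := lintegral_map (μ := κ.prod τ)
    (f := fun b : Bool => ENNReal.ofReal (f (R.step ε S b))) (measurable_of_finite _) hc
  rw [← hmap, lintegral_fintype, Fintype.sum_bool, Measure.map_apply hc (measurableSet_singleton _),
    Measure.map_apply hc (measurableSet_singleton _), hT.accuracy_dirac, hT.accuracy_dirac,
    ENNReal.ofReal_add (mul_nonneg measureReal_nonneg (hf _)) (mul_nonneg measureReal_nonneg (hf _)),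
    ENNReal.ofReal_mul measureReal_nonneg, ENNReal.ofReal_mul measureReal_nonneg,
    ofReal_measureReal, ofReal_measureReal, mul_comm, mul_comm (ENNReal.ofReal (f (R.step ε S false)))]
  rfl

/-- The expected number of visited nodes. -/
theorem expectedNodes_le (hN : 0 < N) {Aopt : Finset (Fin N)} (hcard : Aopt.card = Q.L) {ρ : ℝ}
    (hρ : 1 / 2 < ρ) (hρ1 : ρ ≤ 1) (hcls : T.ClassifiesWith R ε feat Aopt κ τ ρ) :
    T.expectedNodes R ε feat κ τ ≤
      ENNReal.ofReal (2 * N * (2 * ρ - ρ ^ N) / (2 * ρ - 1) + 1) := by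
  have hpos : 0 < 2 * ρ - 1 := by linarith
  -- The solution of `y = (1 - ρ) * (2 + 2 * y)`, the expected number of descendants of an
  -- irrelevant node that is branched with probability `1 - ρ`.
  set y := 2 * (1 - ρ) / (2 * ρ - 1) with hy
  have hy0 : 0 ≤ y := div_nonneg (by linarith) hpos.le
  have hyρ : y = (1 - ρ) * (2 + 2 * y) := by rw [hy]; field_simp; ring
  have hmono : ∀ t, ∫⁻ w, ENNReal.ofReal (BBRules.nodePotential Aopt y (T.minimal R ε feat w t))
      ∂(Measure.infinitePi fun _ : ℕ => κ.prod τ) ≤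
      ENNReal.ofReal (BBRules.nodePotential Aopt y R.init) := by
    intro t
    induction t with
    | zero => simp [minimal]
    | succ t ih =>
      rw [hT.lintegral_minimal_succ (BBRules.nodePotential_nonneg Aopt hy0)]
      refine (lintegral_mono_ae ((hcls t).mono fun w hw => ENNReal.ofReal_le_ofReal ?_)).trans ih
      have hsum := hT.accuracy_dirac_add (κ := κ) (τ := τ) (feat (T.minimal R ε feat w t)
            (R.current (T.minimal R ε feat w t)))
      by_cases hc : R.Continues ε (T.minimal R ε feat w t)
      · refine (invariant_minimal hcard w t).nodePotential_step_le hcard hc hy0 hyρ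
          measureReal_nonneg measureReal_nonneg hsum ?_
        refine (hw hc).trans (le_of_eq ?_)
        cases (R.current (T.minimal R ε feat w t)).label Aopt <;> rfl
      · rw [BBRules.step_of_not_continues hc, BBRules.step_of_not_continues hc, ← add_mul, hsum,
          one_mul]
  have hinit : BBRules.nodePotential Aopt y R.init ≤
      2 * N * (2 * ρ - ρ ^ N) / (2 * ρ - 1) + 1 := by
    have h1 : BBRules.nodeWeight Aopt y (BBNode.root N Q.L) ≤ N * (2 + y) := by
      rw [BBRules.nodeWeight, if_pos (BBNode.relevant_root hcard)]
      gcongr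
      exact BBNode.card_undecided_le _
    -- The potential gives `2ρN / (2ρ - 1) + 1`; the stated bound is weaker because `ρ ^ N ≤ ρ`.
    have h2 : 2 + y = 2 * ρ / (2 * ρ - 1) := by rw [hy]; field_simp; ring
    have h3 : ρ ^ N ≤ ρ := pow_le_of_le_one (by linarith) hρ1 hN.ne'
    have h4 : (N : ℝ) * (2 * ρ / (2 * ρ - 1)) ≤ 2 * N * (2 * ρ - ρ ^ N) / (2 * ρ - 1) := by
      rw [← mul_div_assoc]
      gcongr ?_ / _
      have hN0 : (0 : ℝ) ≤ N := Nat.cast_nonneg N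
      nlinarith
    rw [h2] at h1
    simp only [BBRules.nodePotential, BBRules.init, BBRules.weight, sum_singleton, Nat.cast_one]
    linarith
  unfold expectedNodes
  rw [lintegral_iSup (fun t => hT.measurable_minimal t fun S => (S.visited : ℝ≥0∞))]
  · refine iSup_le fun t => ?_
    refine (lintegral_mono fun w => ?_).trans ((hmono t).trans (ENNReal.ofReal_le_ofReal hinit))
    rw [← ENNReal.ofReal_natCast]
    exact ENNReal.ofReal_le_ofReal (le_add_of_nonneg_right
      (sum_nonneg fun n _ => BBRules.nodeWeight_nonneg Aopt hy0 n))
  · refine monotone_nat_of_le_succ fun t w => ?_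
    simp only [minimal]
    exact_mod_cast BBRules.visited_le_step ε _ _

/-- The probability of success. -/
theorem pow_le_measure_success (hM : 0 < M) {Aopt : Finset (Fin N)} (hA : Q.IsOptimalSubset Aopt)
    {ρ : ℝ} (hρ0 : 0 ≤ ρ) (hρ1 : ρ ≤ 1) (hcls : T.ClassifiesWith R ε feat Aopt κ τ ρ) :
    ENNReal.ofReal (ρ ^ N) ≤
      Measure.infinitePi (fun _ : ℕ => κ.prod τ) (T.success R ε feat) := by
  lift ρ to ℝ≥0 using hρ0
  have hρ1 : ρ ≤ 1 := by exact_mod_cast hρ1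
  have hmono : ∀ t, ENNReal.ofReal (BBRules.survival Aopt ρ R.init) ≤
      ∫⁻ w, ENNReal.ofReal (BBRules.survival Aopt ρ (T.minimal R ε feat w t))
        ∂(Measure.infinitePi fun _ : ℕ => κ.prod τ) := by
    intro t
    induction t with
    | zero => simp [minimal]
    | succ t ih =>
      rw [hT.lintegral_minimal_succ (f := fun S => (BBRules.survival Aopt ρ S : ℝ))
        fun S => NNReal.coe_nonneg _]
      refine ih.trans (lintegral_mono_ae ((hcls t).mono fun w hw => ENNReal.ofReal_le_ofReal ?_))
      have hsum := hT.accuracy_dirac_add (κ := κ) (τ := τ) (feat (T.minimal R ε feat w t)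
            (R.current (T.minimal R ε feat w t)))
      by_cases hc : R.Continues ε (T.minimal R ε feat w t)
      · refine (invariant_minimal hA.1 w t).survival_le_step hA hc hρ1
          measureReal_nonneg measureReal_nonneg hsum ?_
        refine (hw hc).trans (le_of_eq ?_)
        cases (R.current (T.minimal R ε feat w t)).label Aopt <;> rfl
      · rw [BBRules.step_of_not_continues hc, BBRules.step_of_not_continues hc, ← add_mul, hsum,
          one_mul]
  have hinit : (ρ : ℝ) ^ N ≤ BBRules.survival Aopt ρ R.init := by
    have h1 : ρ ^ (BBNode.root N Q.L).undecided.card ≤ BBRules.survival Aopt ρ R.init :=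
      BBRules.le_survival ρ (mem_singleton_self _) (BBNode.relevant_root hA.1)
    have h2 : ρ ^ N ≤ ρ ^ (BBNode.root N Q.L).undecided.card :=
      pow_le_pow_of_le_one zero_le hρ1 (BBNode.card_undecided_le _)
    exact_mod_cast h2.trans h1
  -- By iteration `3 ^ N + 1` the procedure has stopped, and there `survival` is at most the
  -- indicator of success. The inequality for the integral of an indicator needs no measurability of
  -- that event.
  refine (ENNReal.ofReal_le_ofReal hinit).trans ((hmono (3 ^ N + 1)).trans ?_)
  refine (lintegral_mono fun w => ?_).trans (lintegral_indicator_one_le (T.success R ε feat))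
  have hhalt := not_continues_minimal (T := T) (R := R) (ε := ε) (feat := feat) hA.1 w
  rcases BBRules.survival_eq (Aopt := Aopt) ρ (T.minimal R ε feat w (3 ^ N + 1)) with
    h0 | ⟨n, hn, hr, _⟩
  · rw [h0]; simp
  · have hmem : w ∈ T.success R ε feat := ⟨3 ^ N + 1, hhalt,
      (invariant_minimal hA.1 w _).optimalWithin_of_not_continues hM hA hhalt hn hr⟩
    rw [Set.indicator_of_mem hmem, Pi.one_apply, ENNReal.ofReal_le_one]
    exact_mod_cast BBRules.survival_le_one hρ1 _

end Assumptions

end Training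

end

/-! ### Assembly of the four parts -/

theorem theorem2 (E : ℕ) (G H : ℝ) :
    ∃ (C : ℝ) (rate : ℕ → ℝ), (∀ I, 0 < rate I) ∧
    ∀ (N M I J : ℕ), 0 < N → 0 < M → 0 < I → 0 < J →
    ∀ (η : ℝ), 0 < η →
    ∀ (Z : Type*) [MeasurableSpace Z] (μ : Measure Z) [IsProbabilityMeasure μ]
      (T : Training N M E J Z) (c : Bounds), T.Assumptions c I G H →
    ∀ (Ω : Type*) [MeasurableSpace Ω] (P : Measure Ω) [IsProbabilityMeasure P]
      (X : ℕ → Ω → (Fin J → Z) × Params E),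
      (∀ i, Measurable (X i)) → (∀ i, P.map (X i) = roundLaw E J μ η) → iIndepFun X P →
    -- the index of the returned parameter
    ∀ (best : Ω → ℕ), (∀ ω, best ω < I) →
      (∀ ω, ∀ i < I, T.roundLoss μ η (fun k => X k ω) (best ω) ≤ T.roundLoss μ η (fun k => X k ω) i) →
    -- the expected loss
    (∀ (ν δ : ℝ), 0 < δ → δ < 1 → η = rate I → c.α (N + M) ≠ 1 →
      (∀ᵐ ω ∂P, ∃ θ ∈ c.paramSet E,
        (1 / (I * J : ℝ)) * ∑ i, ∑ j, T.sampleLoss θ (T.data (fun k => X k ω) I i j) ≤ ν) →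
      ENNReal.ofReal (1 - δ) ≤ P {ω | T.roundLoss μ η (fun k => X k ω) (best ω) ≤
        ν + C / (I : ℝ) ^ (1 / 3 : ℝ)
          + c.gap E (N + M) T.depth (δ / 2) J * √(2 * Real.log (2 / δ) / I)}) ∧
    -- the learned classifier: averaged over the perturbation, or the realized parameter
    ∀ (ω : Ω) (κ : Measure (Params E)) [IsProbabilityMeasure κ],
      (κ = T.paramLaw η (fun k => X k ω) (best ω) ∨
        κ = Measure.dirac (T.param (fun k => X k ω) (best ω))) →
      -- accuracy from the logistic loss
      (T.loss = logisticLoss →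
        Real.exp (-T.expectedLoss (T.sampleLaw μ (fun k => X k ω) (best ω)) κ) ≤
          T.accuracy (T.sampleLaw μ (fun k => X k ω) (best ω)) κ
            (volume.restrict (Set.Icc (0 : ℝ) 1))) ∧
      -- number of nodes and optimality
      ∀ (τ : Measure ℝ) [IsProbabilityMeasure τ] (ρ : ℝ),
        ρ = T.accuracy (T.sampleLaw μ (fun k => X k ω) (best ω)) κ τ →
        ∀ (Q : BFInstance N M) (R : BBRules Q) (ε : ℝ≥0)
          (feat : BBState N M → BBNode N → Features N M E) (Aopt : Finset (Fin N)),
          Q.IsOptimalSubset Aopt → T.ClassifiesWith R ε feat Aopt κ τ ρ →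
          (1 / 2 < ρ → T.expectedNodes R ε feat κ τ ≤
            ENNReal.ofReal (2 * N * (2 * ρ - ρ ^ N) / (2 * ρ - 1) + 1)) ∧
          ENNReal.ofReal (ρ ^ N) ≤
            Measure.infinitePi (fun _ : ℕ => κ.prod τ) (T.success R ε feat) := by
  refine ⟨regretConst E G H, perturbRate, perturbRate_pos, ?_⟩
  intro N M I J hN hM hI hJ η hη Z _ μ _ T c hT Ω _ P _ X hX hlaw hind best _ hmin
  refine ⟨?_, ?_⟩
  · rintro ν δ hδ hδ1 rfl _ hν
    exact hT.roundLoss_best_le hI hJ μ hX hlaw hind hmin hδ hδ1 hν (N + M)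
  · intro ω κ _ hκ
    have := hT.isProbabilityMeasure_sampleLaw μ (fun k => X k ω) (best ω)
    -- Both readings of the classifier, redrawn or realized, are supported in `Θ`, where the loss is
    -- bounded.
    have hκmem : ∀ᵐ θ ∂κ, θ ∈ c.paramSet E := by
      rcases hκ with rfl | rfl
      · exact hT.paramLaw_mem _ _
      · rw [ae_dirac_iff (p := fun θ => θ ∈ c.paramSet E) (c.measurableSet_paramSet E)]
        exact hT.param_mem _ _
    refine ⟨fun hloss => hT.exp_neg_expectedLoss_le hN hloss
      (hT.sampleLaw_admissible μ _ _) hκmem, ?_⟩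
    -- Being an accuracy, `ρ` lies in `[0, 1]`, as both search bounds require.
    rintro τ _ ρ rfl Q R ε feat Aopt hA hcls
    exact ⟨fun hρ => hT.expectedNodes_le hN hA.1 hρ Training.accuracy_le_one hcls,
      hT.pow_le_measure_success hM hA measureReal_nonneg Training.accuracy_le_one hcls⟩
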